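/- **Setting.** Let $n$ be the security parameter and let $k=k(n)$, $m=m(n)$, $b=b(n)$ be polynomially bounded. Party $P_0$ holds a dense matrix $X$ of size $k\times m$, and $P_1$ holds a sparse matrix $Y$ of size $m\times m$, both with integer (fixed-point) entries of at most $b$ bits and a sign. Let $l_Y$ be the set of the locations $(a,j)$ of the nonzero entries of $Y$ and $|l_Y|$ their number. All algorithms, simulators and distinguishers are families of Boolean circuits of polynomial size (algorithms and simulators with random coins). *Homomorphic encryption.* $(\mathsf{Gen},\mathsf{Enc},\mathsf{Dec},\oplus,\otimes)$ is an efficient, correct, semantically secure (IND-CPA) public-key encryption scheme with plaintext ring $\mathbb Z_\delta$, where $\delta$ may depend on the public key $pk$, that is additively homomorphic: $\mathsf{Enc}_{pk}(x)\oplus\mathsf{Enc}_{pk}(y)=\mathsf{Enc}_{pk}(x+y)$ and $\mathsf{Enc}_{pk}(x)\otimes y=\mathsf{Enc}_{pk}(xy)$. This means that $\oplus$ and $\otimes$ map encryptions to encryptions of the indicated plaintext, and that a fresh encryption of $x$ added to any fixed encryption of $y$ is distributed as a fresh encryption of $x+y$, up to a negligible statistical distance (as in Paillier's scheme). *PIR.*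 $(\mathsf{Query},\mathsf{Response},\mathsf{Extract})$ is an efficient, correct single-server private information retrieval protocol for databases of $km$ ciphertexts that is secure: for any two indices, the queries are computationally indistinguishable. **Protocol.** Offline, $P_0$ generates $(pk,sk)$ and sends $pk$ to $P_1$. 1. $P_0$ encrypts all entries of $X$ and takes the $km$ ciphertexts $e_{i,a}=\mathsf{Enc}_{pk}(x_{i,a})$ as the PIR database. 2. For every $(a,j)\in l_Y$ and every row $i$ of $X$, $P_1$ sends a PIR query for $e_{i,a}$. $P_0$ sends the responses, and $P_1$ extracts the ciphertexts $e_{i,a}$. 3. For all $i,j$, $P_1$ starts with $\beta_{i,j}=\mathsf{Enc}_{pk}(0)$, sets $\beta_{i,j}\gets(e_{i,a}\otimes y_{a,j})\oplus\beta_{i,j}$ for every $a$ with $(a,j)\in l_Y$, samples a uniform mask $g_{i,j}\in\mathbb Z_\delta$, sets $\beta_{i,j}\gets\mathsf{Enc}_{pk}(g_{i,j})\oplus\beta_{i,j}$, sends $\beta_{i,j}$ to $P_0$, and outputs the share $-g_{i,j}$. 4. $P_0$ outputs the share $\mathsf{Dec}_{sk}(\beta_{i,j})$. **Claim.** The protocol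 securely computes uniformly random additive shares of $XY$ modulo $\delta$ against semi-honest adversaries, with $|l_Y|$ as the only leakage. That is, there are simulators $S_0$, $S_1$ of polynomial size such that, for all families of inputs $X$, $Y$: - **Corrupted $P_0$.** The view of $P_0$ in the protocol (its random coins, including those of the key generation, and all received messages), jointly with both output shares, is computationally indistinguishable from the output of the following ideal experiment. The offline key generation is run, random additive shares $(Z_0,Z_1)$ of $XY$ modulo $\delta$ are drawn, and $S_0$ produces the rest of the view from the key generation coins, $X$, $Z_0$ and $|l_Y|$ only; the output is the simulated view together with $Z_0$ and $Z_1$. - **Corrupted $P_1$.** The view of $P_1$ (the public key, its random coins and masks, and all received messages), jointly with both output shares, is computationally indistinguishable from the output of the analogous experiment, in which $S_1$ is given only $pk$, $Y$ and $Z_1$. -/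

import Mathlib

open Filter

noncomputable section

/-! Boolean circuits, polynomial size, negligible functions, probability. -/

/-- Bit strings of length `n`. -/
abbrev Bits (n : ℕ) : Type := Fin n → Bool

/-- A gate of a Boolean circuit: a constant, or the NAND of two earlier wires. -/
inductive Gate : Type
  | const (b : Bool) : Gate
  | nand (i j : ℕ) : Gate

/-- The value of a gate, given the values of the earlier wires (an absent wire reads `false`). -/
def Gate.eval (w : List Bool) : Gate → Bool
  | .const b => b
  | .nand i j => !(w.getD i false && w.getD j false)

/-- A Boolean circuit: the gates in topological order, and the list of the output wires. Wires
are numbered consecutively, the input wires first and then one wire for every gate. -/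
structure Circuit : Type where
  gates : List Gate
  outputs : List ℕ

/-- The number of gates plus the number of outputs. -/
def Circuit.size (C : Circuit) : ℕ := C.gates.length + C.outputs.length

/-- The output of a circuit on an input string. -/
def Circuit.eval (C : Circuit) (x : List Bool) : List Bool :=
  C.outputs.map fun i => (C.gates.foldl (fun w g => w ++ [g.eval w]) x).getD i false

/-- The first output bit, used as the decision of a distinguisher. -/
def Circuit.accepts (C : Circuit) (x : List Bool) : Bool := (C.eval x).headD false

/-- Growth at most polynomial. -/
def PolyBounded (f : ℕ → ℕ) : Prop := ∃ P : Polynomial ℕ, ∀ n, f n ≤ P.eval n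

/-- A family of functions, given by the encodings `inp` of its arguments and `out` of its values,
is computed by circuits of polynomial size (on inputs of polynomial length); the polynomial is
evaluated at `sz i` for the member with index `i` of the family. -/
def PolySize {ι : Type} (sz : ι → ℕ) {α : ι → Type} (inp out : ∀ i, α i → List Bool) : Prop :=
  ∃ P : Polynomial ℕ, ∀ i, ∃ C : Circuit, C.size ≤ P.eval (sz i) ∧
    ∀ a, (inp i a).length ≤ P.eval (sz i) ∧ C.eval (inp i a) = out i a

/-- A function is negligible if it decays faster than every inverse polynomial. -/
def Negligible (f : ℕ → ℝ) : Prop :=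
  Asymptotics.SuperpolynomialDecay atTop (fun n : ℕ => (n : ℝ)) f

/-- The uniform distribution. -/
abbrev unif (α : Type) [Fintype α] [Nonempty α] : PMF α := PMF.uniformOfFintype α

/-- The advantage of `D` in distinguishing two distributions on strings. -/
def advantage (D : Circuit) (p q : PMF (List Bool)) : ℝ :=
  |((p.map D.accepts) true).toReal - ((q.map D.accepts) true).toReal|

/-- Computational indistinguishability against families of circuits of polynomial size.
(Circuits are non-uniform, so that random coins would not help a distinguisher.) -/
def Indistinguishable (p q : ℕ → PMF (List Bool)) : Prop :=
  ∀ D : ℕ → Circuit, PolyBounded (fun n => (D n).size) →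
    Negligible fun n => advantage (D n) (p n) (q n)

/-- The statistical (total variation) distance of two distributions on a finite type. -/
def statDist {α : Type} [Fintype α] (p q : PMF α) : ℝ :=
  (1 / 2) * ∑ a, |(p a).toReal - (q a).toReal|

/-! Encodings as strings. -/

/-- A bit string as a list. -/
def encBits {a : ℕ} (x : Bits a) : List Bool := List.ofFn x

/-- The `w` low-order binary digits of a number. -/
def encNat (w x : ℕ) : List Bool := List.ofFn fun i : Fin w => x.testBit i

/-- The concatenation of a vector of encoded entries. -/
def encVec {a : ℕ} (f : Fin a → List Bool) : List Bool := (List.ofFn f).flatten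

/-- The concatenation of a matrix of encoded entries, row by row. -/
def encMat {a b : ℕ} (f : Fin a → Fin b → List Bool) : List Bool :=
  encVec fun i => encVec fun j => f i j

/-- Integers of at most `b` bits (and a sign). -/
abbrev BInt (b : ℕ) : Type := {z : ℤ // z.natAbs < 2 ^ b}

/-- Sign and magnitude. -/
def encInt {b : ℕ} (z : BInt b) : List Bool := decide (0 ≤ z.1) :: encNat b z.1.natAbs

/-! Additively homomorphic public-key encryption. -/

/-- The algorithms of a public-key encryption scheme with plaintexts in `ℤ/δ`, where the modulus
`δ` may depend on the public key (as in Paillier's scheme), and with operations on ciphertexts.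
The first argument is the security parameter; the coins of `gen` and `enc` are explicit. -/
structure HEScheme : Type where
  (pkLen skLen ptLen ctLen genLen encLen : ℕ → ℕ)
  modulus : ∀ n, Bits (pkLen n) → ℕ+
  modulus_lt : ∀ n pk, (modulus n pk : ℕ) < 2 ^ ptLen n
  gen : ∀ n, Bits (genLen n) → Bits (pkLen n) × Bits (skLen n)
  enc : ∀ n (pk : Bits (pkLen n)), ZMod (modulus n pk) → Bits (encLen n) → Bits (ctLen n)
  dec : ∀ n (pk : Bits (pkLen n)), Bits (skLen n) → Bits (ctLen n) → ZMod (modulus n pk)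
  add : ∀ n, Bits (pkLen n) → Bits (ctLen n) → Bits (ctLen n) → Bits (ctLen n)
  smul : ∀ n (pk : Bits (pkLen n)), Bits (ctLen n) → ZMod (modulus n pk) → Bits (ctLen n)

namespace HEScheme

variable (H : HEScheme)

/-- The plaintexts under a public key. -/
abbrev Pt (n : ℕ) (pk : Bits (H.pkLen n)) : Type := ZMod (H.modulus n pk)

/-- The encoding of a plaintext by the binary digits of its least nonnegative representative. -/
def encPt {n : ℕ} {pk : Bits (H.pkLen n)} (x : H.Pt n pk) : List Bool := encNat (H.ptLen n) x.val

/-- The public key produced from the given coins. -/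
def pk {n : ℕ} (w : Bits (H.genLen n)) : Bits (H.pkLen n) := (H.gen n w).1

/-- The secret key produced from the given coins. -/
def sk {n : ℕ} (w : Bits (H.genLen n)) : Bits (H.skLen n) := (H.gen n w).2

/-- All algorithms have polynomial size. -/
structure Efficient : Prop where
  modulus : PolySize (id : ℕ → ℕ) (α := fun n => Bits (H.pkLen n))
    (fun _ p => encBits p) (fun n p => encNat (H.ptLen n) (H.modulus n p))
  gen : PolySize (id : ℕ → ℕ) (α := fun n => Bits (H.genLen n))
    (fun _ w => encBits w) (fun _ w => encBits (H.pk w) ++ encBits (H.sk w))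
  enc : PolySize (id : ℕ → ℕ)
    (α := fun n => Σ p : Bits (H.pkLen n), H.Pt n p × Bits (H.encLen n))
    (fun _ a => encBits a.1 ++ H.encPt a.2.1 ++ encBits a.2.2)
    (fun n a => encBits (H.enc n a.1 a.2.1 a.2.2))
  dec : PolySize (id : ℕ → ℕ)
    (α := fun n => Bits (H.pkLen n) × Bits (H.skLen n) × Bits (H.ctLen n))
    (fun _ a => encBits a.1 ++ encBits a.2.1 ++ encBits a.2.2)
    (fun n a => H.encPt (H.dec n a.1 a.2.1 a.2.2))
  add : PolySize (id : ℕ → ℕ)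
    (α := fun n => Bits (H.pkLen n) × Bits (H.ctLen n) × Bits (H.ctLen n))
    (fun _ a => encBits a.1 ++ encBits a.2.1 ++ encBits a.2.2)
    (fun n a => encBits (H.add n a.1 a.2.1 a.2.2))
  smul : PolySize (id : ℕ → ℕ)
    (α := fun n => Σ p : Bits (H.pkLen n), Bits (H.ctLen n) × H.Pt n p)
    (fun _ a => encBits a.1 ++ encBits a.2.1 ++ H.encPt a.2.2)
    (fun n a => encBits (H.smul n a.1 a.2.1 a.2.2))

/-- Decryption inverts encryption. -/
def Correct : Prop :=
  ∀ n (w : Bits (H.genLen n)) (x : H.Pt n (H.pk w)) (r : Bits (H.encLen n)),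
    H.dec n (H.pk w) (H.sk w) (H.enc n (H.pk w) x r) = x

/-- The distribution of a fresh encryption. -/
def encDist (n : ℕ) (p : Bits (H.pkLen n)) (x : H.Pt n p) : PMF (Bits (H.ctLen n)) :=
  (unif (Bits (H.encLen n))).map (H.enc n p x)

/-- `Enc(x) ⊕ Enc(y) = Enc(x + y)` and `Enc(x) ⊗ y = Enc(x * y)`: the operations map
encryptions to encryptions, and adding a fresh encryption of `x` to any encryption of `y`
gives a fresh encryption of `x + y`, up to a negligible statistical distance. -/
structure Homomorphic : Prop where
  add_eq : ∀ n (w : Bits (H.genLen n)) (x y : H.Pt n (H.pk w)) (r s : Bits (H.encLen n)),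
    ∃ u, H.add n (H.pk w) (H.enc n (H.pk w) x r) (H.enc n (H.pk w) y s)
      = H.enc n (H.pk w) (x + y) u
  smul_eq : ∀ n (w : Bits (H.genLen n)) (x y : H.Pt n (H.pk w)) (r : Bits (H.encLen n)),
    ∃ u, H.smul n (H.pk w) (H.enc n (H.pk w) x r) y = H.enc n (H.pk w) (x * y) u
  add_fresh : ∃ ν : ℕ → ℝ, Negligible ν ∧
    ∀ n (w : Bits (H.genLen n)) (x y : H.Pt n (H.pk w)) (s : Bits (H.encLen n)),
      statDist
        ((H.encDist n (H.pk w) x).map fun c =>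
          H.add n (H.pk w) c (H.enc n (H.pk w) y s))
        (H.encDist n (H.pk w) (x + y)) ≤ ν n

/-- What an attacker sees who chooses a plaintext by `M` from the public key: the public key and
an encryption of the chosen plaintext. -/
def cpaDist (M : ∀ n (p : Bits (H.pkLen n)), H.Pt n p) (n : ℕ) : PMF (List Bool) := do
  let w ← unif (Bits (H.genLen n))
  let c ← H.encDist n (H.pk w) (M n (H.pk w))
  pure (encBits (H.pk w) ++ encBits c)

/-- Semantic security (indistinguishability under chosen-plaintext attack). -/
def SemanticallySecure : Prop :=
  ∀ M₀ M₁ : ∀ n (p : Bits (H.pkLen n)), H.Pt n p,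
    PolySize (id : ℕ → ℕ) (α := fun n => Bits (H.pkLen n))
      (fun _ p => encBits p) (fun n p => H.encPt (M₀ n p)) →
    PolySize (id : ℕ → ℕ) (α := fun n => Bits (H.pkLen n))
      (fun _ p => encBits p) (fun n p => H.encPt (M₁ n p)) →
    Indistinguishable (H.cpaDist M₀) (H.cpaDist M₁)

end HEScheme

/-! Single-server private information retrieval. -/

/-- The algorithms of a one-round single-server PIR protocol for databases of `N n` records of
`d n` bits. The client's state between query and extraction is its index and its coins. -/
structure PIRScheme (N d : ℕ → ℕ) : Type where
  (queryLen respLen queryCoinLen respCoinLen : ℕ → ℕ)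
  query : ∀ n, Fin (N n) → Bits (queryCoinLen n) → Bits (queryLen n)
  response : ∀ n, (Fin (N n) → Bits (d n)) → Bits (queryLen n) → Bits (respCoinLen n) →
    Bits (respLen n)
  extract : ∀ n, Fin (N n) → Bits (queryCoinLen n) → Bits (respLen n) → Bits (d n)

namespace PIRScheme

variable {N d : ℕ → ℕ} (R : PIRScheme N d)

/-- The encoding of an index into the database. -/
def encIdx {n : ℕ} (i : Fin (N n)) : List Bool := encNat (Nat.size (N n)) i

/-- All algorithms have polynomial size. -/
structure Efficient : Prop where
  query : PolySize (id : ℕ → ℕ) (α := fun n => Fin (N n) × Bits (R.queryCoinLen n))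
    (fun _ a => encIdx a.1 ++ encBits a.2) (fun n a => encBits (R.query n a.1 a.2))
  response : PolySize (id : ℕ → ℕ)
    (α := fun n => (Fin (N n) → Bits (d n)) × Bits (R.queryLen n) × Bits (R.respCoinLen n))
    (fun _ a => encVec (fun i => encBits (a.1 i)) ++ encBits a.2.1 ++ encBits a.2.2)
    (fun n a => encBits (R.response n a.1 a.2.1 a.2.2))
  extract : PolySize (id : ℕ → ℕ)
    (α := fun n => Fin (N n) × Bits (R.queryCoinLen n) × Bits (R.respLen n))
    (fun _ a => encIdx a.1 ++ encBits a.2.1 ++ encBits a.2.2)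
    (fun n a => encBits (R.extract n a.1 a.2.1 a.2.2))

/-- The client obtains the record that it asked for. -/
def Correct : Prop :=
  ∀ n (db : Fin (N n) → Bits (d n)) (i : Fin (N n)) (c : Bits (R.queryCoinLen n))
    (s : Bits (R.respCoinLen n)),
    R.extract n i c (R.response n db (R.query n i c) s) = db i

/-- The distribution of the query for an index. -/
def queryDist (n : ℕ) (i : Fin (N n)) : PMF (List Bool) :=
  (unif (Bits (R.queryCoinLen n))).map fun c => encBits (R.query n i c)

/-- The query hides the index from the server. -/
def Secure : Prop :=
  ∀ D : ℕ → Circuit, PolyBounded (fun n => (D n).size) →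
    ∃ ν : ℕ → ℝ, Negligible ν ∧
      ∀ n (i j : Fin (N n)), advantage (D n) (R.queryDist n i) (R.queryDist n j) ≤ ν n

end PIRScheme

/-! The secure matrix multiplication protocol. Party 0 holds a dense `k × m` matrix `X`, party 1
holds a sparse `m × m` matrix `Y`. -/

namespace MatrixMul

/-- The set `l_y` of the locations of the nonzero entries; `(a, b)` is numbered `m * a + b`. -/
def locations {m b : ℕ} (Y : Matrix (Fin m) (Fin m) (BInt b)) : Finset (Fin (m * m)) :=
  Finset.univ.filter fun s =>
    (Y (finProdFinEquiv.symm s).1 (finProdFinEquiv.symm s).2).1 ≠ 0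

/-- The number `|l_y|` of nonzero entries. -/
def nnz {m b : ℕ} (Y : Matrix (Fin m) (Fin m) (BInt b)) : ℕ := (locations Y).card

/-- The row and the column of the `s`-th nonzero entry. -/
def loc {m b : ℕ} (Y : Matrix (Fin m) (Fin m) (BInt b)) (s : Fin (nnz Y)) : Fin m × Fin m :=
  finProdFinEquiv.symm ((locations Y).orderEmbOfFin rfl s)

/-- The entries of an integer matrix as residues. -/
def residues {a c b : ℕ} (M : ℕ+) (A : Matrix (Fin a) (Fin c) (BInt b)) :
    Matrix (Fin a) (Fin c) (ZMod M) := A.map fun z => (z.1 : ZMod M)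

variable (H : HEScheme) (k m b : ℕ → ℕ)
variable (R : PIRScheme (fun n => m n * k n) H.ctLen)

/-- The coins of party 0 after key generation, if there are `t` nonzero entries: for encrypting
the entries of `X` and for the PIR responses. -/
structure Tape0 (n t : ℕ) : Type where
  encCoins : Fin (k n) → Fin (m n) → Bits (H.encLen n)
  respCoins : Fin t → Fin (k n) → Bits (R.respCoinLen n)

/-- The random choices of party 1: the coins of the PIR queries, of the initial encryptions of
zero, the masks `g`, and the coins for encrypting the masks. -/
structure Tape1 (n t : ℕ) (pk : Bits (H.pkLen n)) : Type where
  queryCoins : Fin t → Fin (k n) → Bits (R.queryCoinLen n)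
  zeroCoins : Fin (k n) → Fin (m n) → Bits (H.encLen n)
  mask : Fin (k n) → Fin (m n) → H.Pt n pk
  maskCoins : Fin (k n) → Fin (m n) → Bits (H.encLen n)

/-- The uniform choice of the coins of party 0. -/
def tape0Dist (n t : ℕ) : PMF (Tape0 H k m R n t) := do
  let e ← unif (Fin (k n) → Fin (m n) → Bits (H.encLen n))
  let s ← unif (Fin t → Fin (k n) → Bits (R.respCoinLen n))
  pure ⟨e, s⟩

/-- The uniform choice of the coins and masks of party 1. -/
def tape1Dist (n t : ℕ) (pk : Bits (H.pkLen n)) : PMF (Tape1 H k m R n t pk) := do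
  let q ← unif (Fin t → Fin (k n) → Bits (R.queryCoinLen n))
  let z ← unif (Fin (k n) → Fin (m n) → Bits (H.encLen n))
  let g ← unif (Fin (k n) → Fin (m n) → H.Pt n pk)
  let e ← unif (Fin (k n) → Fin (m n) → Bits (H.encLen n))
  pure ⟨q, z, g, e⟩

/-- The view of party 0, without its input and its key generation coins: its remaining coins, and
the received PIR queries and masked ciphertexts. -/
structure View0 (n t : ℕ) : Type where
  tape : Tape0 H k m R n t
  queries : Fin t → Fin (k n) → Bits (R.queryLen n)
  masked : Fin (k n) → Fin (m n) → Bits (H.ctLen n)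

/-- The view of party 1, without its input and the public key received in the offline phase: its
random choices and the received PIR responses. -/
structure View1 (n t : ℕ) (pk : Bits (H.pkLen n)) : Type where
  tape : Tape1 H k m R n t pk
  responses : Fin t → Fin (k n) → Bits (R.respLen n)

variable {H k m b R}

/-- Encoding of a view of party 0. -/
def View0.encode {n t : ℕ} (v : View0 H k m R n t) : List Bool :=
  encMat (fun i a => encBits (v.tape.encCoins i a)) ++
  encMat (fun s i => encBits (v.tape.respCoins s i)) ++
  encMat (fun s i => encBits (v.queries s i)) ++
  encMat (fun i j => encBits (v.masked i j))

/-- Encoding of a view of party 1. -/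
def View1.encode {n t : ℕ} {pk : Bits (H.pkLen n)} (v : View1 H k m R n t pk) : List Bool :=
  encMat (fun s i => encBits (v.tape.queryCoins s i)) ++
  encMat (fun i j => encBits (v.tape.zeroCoins i j)) ++
  encMat (fun i j => H.encPt (v.tape.mask i j)) ++
  encMat (fun i j => encBits (v.tape.maskCoins i j)) ++
  encMat (fun s i => encBits (v.responses s i))

/-- Encoding of a matrix of plaintexts. -/
def encShare {n : ℕ} {pk : Bits (H.pkLen n)}
    (Z : Matrix (Fin (k n)) (Fin (m n)) (H.Pt n pk)) : List Bool :=
  encMat fun i j => H.encPt (Z i j)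

section Run

variable {n : ℕ} (X : Matrix (Fin (k n)) (Fin (m n)) (BInt (b n)))
  (Y : Matrix (Fin (m n)) (Fin (m n)) (BInt (b n)))
  (w : Bits (H.genLen n)) (T₀ : Tape0 H k m R n (nnz Y)) (T₁ : Tape1 H k m R n (nnz Y) (H.pk w))

/-- The position `i + k * a` of entry `(i, a)` of the encrypted matrix in the database. -/
def dbIndex (i : Fin (k n)) (a : Fin (m n)) : Fin (m n * k n) := finProdFinEquiv (a, i)

/-- Party 0: the database, that is, the encrypted entries of `X`. -/
def database (idx : Fin (m n * k n)) : Bits (H.ctLen n) :=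
  H.enc n (H.pk w)
    (residues (H.modulus n (H.pk w)) X (finProdFinEquiv.symm idx).2 (finProdFinEquiv.symm idx).1)
    (T₀.encCoins (finProdFinEquiv.symm idx).2 (finProdFinEquiv.symm idx).1)

/-- Party 1: for every nonzero entry `(a, j)` of `Y` and every `i`, the PIR query for the
encryption of `X i a`. -/
def queries (s : Fin (nnz Y)) (i : Fin (k n)) : Bits (R.queryLen n) :=
  R.query n (dbIndex i (loc Y s).1) (T₁.queryCoins s i)

/-- Party 0: the PIR responses. -/
def responses (s : Fin (nnz Y)) (i : Fin (k n)) : Bits (R.respLen n) :=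
  R.response n (database X Y w T₀) (queries Y w T₁ s i) (T₀.respCoins s i)

/-- Party 1: the retrieved ciphertexts. -/
def retrieved (s : Fin (nnz Y)) (i : Fin (k n)) : Bits (H.ctLen n) :=
  R.extract n (dbIndex i (loc Y s).1) (T₁.queryCoins s i) (responses X Y w T₀ T₁ s i)

/-- Party 1: starting from an encryption of zero, the homomorphic inner product of row `i` of `X`
with the nonzero entries of column `j` of `Y`. -/
def innerProduct (i : Fin (k n)) (j : Fin (m n)) : Bits (H.ctLen n) :=
  (List.finRange (nnz Y)).foldl
    (fun acc s =>
      if (loc Y s).2 = j then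
        H.add n (H.pk w)
          (H.smul n (H.pk w) (retrieved X Y w T₀ T₁ s i)
            (residues (H.modulus n (H.pk w)) Y (loc Y s).1 (loc Y s).2))
          acc
      else acc)
    (H.enc n (H.pk w) 0 (T₁.zeroCoins i j))

/-- Party 1: the masked ciphertexts, sent to party 0. -/
def masked (i : Fin (k n)) (j : Fin (m n)) : Bits (H.ctLen n) :=
  H.add n (H.pk w) (H.enc n (H.pk w) (T₁.mask i j) (T₁.maskCoins i j))
    (innerProduct X Y w T₀ T₁ i j)

/-- The output share of party 0. -/
def out0 : Matrix (Fin (k n)) (Fin (m n)) (H.Pt n (H.pk w)) :=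
  fun i j => H.dec n (H.pk w) (H.sk w) (masked X Y w T₀ T₁ i j)

/-- The output share of party 1. -/
def out1 : Matrix (Fin (k n)) (Fin (m n)) (H.Pt n (H.pk w)) := fun i j => -T₁.mask i j

/-- The view of party 0 in a run. -/
def view0 : View0 H k m R n (nnz Y) := ⟨T₀, queries Y w T₁, masked X Y w T₀ T₁⟩

/-- The view of party 1 in a run. -/
def view1 : View1 H k m R n (nnz Y) (H.pk w) := ⟨T₁, responses X Y w T₀ T₁⟩

end Run

/-- The ideal functionality: uniformly random additive shares of the product `X * Y` modulo the
plaintext modulus of the public key. -/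
def functionality {n : ℕ} (pk : Bits (H.pkLen n))
    (X : Matrix (Fin (k n)) (Fin (m n)) (BInt (b n)))
    (Y : Matrix (Fin (m n)) (Fin (m n)) (BInt (b n))) :
    PMF (Matrix (Fin (k n)) (Fin (m n)) (H.Pt n pk) ×
      Matrix (Fin (k n)) (Fin (m n)) (H.Pt n pk)) := do
  let g ← unif (Fin (k n) → Fin (m n) → H.Pt n pk)
  let Z₁ : Matrix (Fin (k n)) (Fin (m n)) (H.Pt n pk) := Matrix.of g
  pure (residues (H.modulus n pk) X * residues (H.modulus n pk) Y - Z₁, Z₁)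

variable (R) in
/-- Real execution, party 0 corrupted: its view and the outputs of both parties. -/
def real0 (n : ℕ) (X : Matrix (Fin (k n)) (Fin (m n)) (BInt (b n)))
    (Y : Matrix (Fin (m n)) (Fin (m n)) (BInt (b n))) : PMF (List Bool) := do
  let w ← unif (Bits (H.genLen n))
  let T₀ ← tape0Dist H k m R n (nnz Y)
  let T₁ ← tape1Dist H k m R n (nnz Y) (H.pk w)
  pure (encBits w ++ (view0 X Y w T₀ T₁).encode ++
    encShare (out0 X Y w T₀ T₁) ++ encShare (out1 Y w T₁))

variable (R) in
/-- Real execution, party 1 corrupted: its view and the outputs of both parties. -/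
def real1 (n : ℕ) (X : Matrix (Fin (k n)) (Fin (m n)) (BInt (b n)))
    (Y : Matrix (Fin (m n)) (Fin (m n)) (BInt (b n))) : PMF (List Bool) := do
  let w ← unif (Bits (H.genLen n))
  let T₀ ← tape0Dist H k m R n (nnz Y)
  let T₁ ← tape1Dist H k m R n (nnz Y) (H.pk w)
  pure (encBits (H.pk w) ++ (view1 X Y w T₀ T₁).encode ++
    encShare (out0 X Y w T₀ T₁) ++ encShare (out1 Y w T₁))

variable (H k m b R)

/-- A simulator for party 0. It gets the number `t` of nonzero entries of the other party's
matrix, party 0's key generation coins, its input and its output share, and its own coins. -/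
structure Simulator0 : Type where
  coinLen : ℕ → ℕ → ℕ
  run : ∀ n t (w : Bits (H.genLen n)), Matrix (Fin (k n)) (Fin (m n)) (BInt (b n)) →
    Matrix (Fin (k n)) (Fin (m n)) (H.Pt n (H.pk w)) → Bits (coinLen n t) → View0 H k m R n t

/-- A simulator for party 1. It gets the public key, party 1's input and its output share, and its
own coins. -/
structure Simulator1 : Type where
  coinLen : ℕ → ℕ → ℕ
  run : ∀ n (pk : Bits (H.pkLen n)) (Y : Matrix (Fin (m n)) (Fin (m n)) (BInt (b n))),
    Matrix (Fin (k n)) (Fin (m n)) (H.Pt n pk) → Bits (coinLen n (nnz Y)) →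
      View1 H k m R n (nnz Y) pk

variable {H k m b R}

/-- The simulator for party 0 has polynomial size. -/
def Simulator0.Efficient (S : Simulator0 H k m b R) : Prop :=
  PolySize (fun i : ℕ × ℕ => i.1 + i.2)
    (α := fun i => Σ w : Bits (H.genLen i.1), Matrix (Fin (k i.1)) (Fin (m i.1)) (BInt (b i.1)) ×
      Matrix (Fin (k i.1)) (Fin (m i.1)) (H.Pt i.1 (H.pk w)) × Bits (S.coinLen i.1 i.2))
    (fun _ a => encBits a.1 ++ encMat (fun i j => encInt (a.2.1 i j)) ++ encShare a.2.2.1 ++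
      encBits a.2.2.2)
    (fun i a => (S.run i.1 i.2 a.1 a.2.1 a.2.2.1 a.2.2.2).encode)

/-- The simulator for party 1 has polynomial size. -/
def Simulator1.Efficient (S : Simulator1 H k m b R) : Prop :=
  PolySize (fun i : ℕ × ℕ => i.1 + i.2)
    (α := fun i => Σ pk : Bits (H.pkLen i.1),
      Σ Y : {Y : Matrix (Fin (m i.1)) (Fin (m i.1)) (BInt (b i.1)) // nnz Y = i.2},
        Matrix (Fin (k i.1)) (Fin (m i.1)) (H.Pt i.1 pk) × Bits (S.coinLen i.1 (nnz Y.1)))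
    (fun _ a => encBits a.1 ++ encMat (fun i j => encInt (a.2.1.1 i j)) ++ encShare a.2.2.1 ++
      encBits a.2.2.2)
    (fun i a => (S.run i.1 a.1 a.2.1.1 a.2.2.1 a.2.2.2).encode)

/-- Ideal execution, party 0 corrupted. The keys are generated in the offline phase; about `Y` the
simulator gets nothing but its number of nonzero entries (and party 0's output). -/
def Simulator0.ideal (S : Simulator0 H k m b R) (n : ℕ)
    (X : Matrix (Fin (k n)) (Fin (m n)) (BInt (b n)))
    (Y : Matrix (Fin (m n)) (Fin (m n)) (BInt (b n))) : PMF (List Bool) := do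
  let w ← unif (Bits (H.genLen n))
  let Z ← functionality (H.pk w) X Y
  let c ← unif (Bits (S.coinLen n (nnz Y)))
  pure (encBits w ++ (S.run n (nnz Y) w X Z.1 c).encode ++ encShare Z.1 ++ encShare Z.2)

/-- Ideal execution, party 1 corrupted. The keys are generated in the offline phase; about `X` the
simulator gets nothing but party 1's output. -/
def Simulator1.ideal (S : Simulator1 H k m b R) (n : ℕ)
    (X : Matrix (Fin (k n)) (Fin (m n)) (BInt (b n)))
    (Y : Matrix (Fin (m n)) (Fin (m n)) (BInt (b n))) : PMF (List Bool) := do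
  let w ← unif (Bits (H.genLen n))
  let Z ← functionality (H.pk w) X Y
  let c ← unif (Bits (S.coinLen n (nnz Y)))
  pure (encBits (H.pk w) ++ (S.run n (H.pk w) Y Z.2 c).encode ++ encShare Z.1 ++ encShare Z.2)

variable (H k m b R) in
/-- Security against semi-honest adversaries with leakage `|l_y|`: the view of either party,
jointly with the outputs, can be simulated from that party's input and output alone, and, for
party 0, the number of nonzero entries of `Y`. -/
def SemiHonestSecure : Prop :=
  (∃ S : Simulator0 H k m b R, S.Efficient ∧
    ∀ (X : ∀ n, Matrix (Fin (k n)) (Fin (m n)) (BInt (b n)))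
      (Y : ∀ n, Matrix (Fin (m n)) (Fin (m n)) (BInt (b n))),
      Indistinguishable (fun n => real0 R n (X n) (Y n)) (fun n => S.ideal n (X n) (Y n))) ∧
  (∃ S : Simulator1 H k m b R, S.Efficient ∧
    ∀ (X : ∀ n, Matrix (Fin (k n)) (Fin (m n)) (BInt (b n)))
      (Y : ∀ n, Matrix (Fin (m n)) (Fin (m n)) (BInt (b n))),
      Indistinguishable (fun n => real1 R n (X n) (Y n)) (fun n => S.ideal n (X n) (Y n)))

end MatrixMul

end

noncomputable section

open scoped BigOperators

/-! The outputs need no cryptography. For every choice of coins, correctness of PIR and the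
homomorphic laws force party 0's output to be `X * Y + g`, where `g` is the matrix of masks, while
party 1 outputs `-g` (`out0_eq`). These are uniform additive shares, so it remains to simulate the
messages jointly with them.

Party 0 knows the secret key, so its view must be simulated without semantic security. Each inner
product computed by party 1 is some fixed encryption of an entry of `X * Y`. Adding a fresh
encryption of the mask makes it statistically close to a fresh encryption of party 0's own output,
which the simulator can produce. The PIR queries are exchanged one at a time for queries of the
first record, by query privacy. `advantage_party0_le` adds up the losses.

Party 1 never sees the secret key. Its simulator builds a database of encryptions of zero and
answers the queries itself. Exchanging the database entries one at a time reduces to semantic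
security (`advantage_party1_le`, `exists_enc_distinguisher`). The reduction receives only a public
key and one ciphertext, and has to supply masks and shares modulo a `δ` that depends on this key.
All inputs and coins can be fixed in advance, but a residue modulo an unknown `δ` cannot. Hence each
mask is drawn as an integer below `2 ^ (ptLen + n)`, hardwired, and reduced by the circuit; this
costs at most `2 ^ (-n)` per mask. The entries of `X * Y + g` are likewise hardwired integers, so
gates never have to multiply modulo `δ`.

Both hybrid arguments fix all randomness except that of one exchanged entry (for party 1, also that
of the keys), and the resulting circuits depend on the fixed values. Their advantages are bounded
uniformly because a family that is negligible along every sequence of choices is negligible in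
supremum (`exists_negligible_bound`); this is where non-uniformity enters.

Polynomial size is handled through `Computes`, a gate-counting calculus on sets of bit functions. It
composes by addition of costs and converts to and from circuits. The only explicit circuits needed
are conditional subtraction, reduction of constants modulo `δ`, and the search for the `s`-th
nonzero entry of `Y`. -/

/-! Derivations of bit functions by NAND gates, and their relation to circuits. -/

/-- `Computes S s T`: from the bit functions in `S`, all bit functions in `T` are obtained with at
most `s` NAND gates. -/
inductive Computes {α : Type} : Set (α → Bool) → ℕ → Set (α → Bool) → Prop
  | of_subset {S T : Set (α → Bool)} {s : ℕ} (h : T ⊆ S) : Computes S s T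
  | nand {S T : Set (α → Bool)} {s : ℕ} {f g : α → Bool} (hf : f ∈ S) (hg : g ∈ S)
      (h : Computes (insert (fun a => !(f a && g a)) S) s T) : Computes S (s + 1) T

/-- The bit functions of a string-valued function (including the constant `false`). -/
def bitsOf {α : Type} (f : α → List Bool) : Set (α → Bool) :=
  Set.range fun i a => (f a).getD i false

namespace Computes

variable {α : Type} {S S' T T' U : Set (α → Bool)} {s r : ℕ} {f g h : α → Bool}

theorem mono_left (hc : Computes S s T) (hS : S ⊆ S') : Computes S' s T := by
  induction hc generalizing S' with
  | of_subset h => exact .of_subset (h.trans hS)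
  | nand hf hg _ ih => exact .nand (hS hf) (hS hg) (ih (Set.insert_subset_insert hS))

theorem mono (hc : Computes S s T) (hsr : s ≤ r) : Computes S r T := by
  induction hc generalizing r with
  | of_subset h => exact .of_subset h
  | nand hf hg _ ih =>
    obtain ⟨r, rfl⟩ := Nat.exists_eq_add_of_le hsr
    rw [show ∀ s : ℕ, s + 1 + r = s + r + 1 by intros; omega]
    exact .nand hf hg (ih (by omega))

theorem mono_right (hc : Computes S s T) (hT : T' ⊆ T) : Computes S s T' := by
  induction hc with
  | of_subset h => exact .of_subset (hT.trans h)
  | nand hf hg _ ih => exact .nand hf hg (ih hT)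

/-- Gates accumulate: the second derivation may use the original functions as well as the new ones,
and wires are reused at no cost. -/
theorem trans (h₁ : Computes S s T) (h₂ : Computes (S ∪ T) r U) : Computes S (s + r) U := by
  induction h₁ with
  | of_subset h => exact (h₂.mono_left (Set.union_subset le_rfl h)).mono (by omega)
  | @nand S T s f g hf hg _ ih =>
    rw [show s + 1 + r = s + r + 1 by omega]
    exact .nand hf hg (ih (h₂.mono_left (Set.union_subset_union_left _ (Set.subset_insert _ _))))

theorem union (h₁ : Computes S s T) (h₂ : Computes S r U) : Computes S (s + r) (T ∪ U) := by
  induction h₁ with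
  | of_subset h =>
    refine Computes.mono (s := r) ?_ (by omega)
    clear * - h₂ h
    induction h₂ with
    | of_subset h' => exact .of_subset (Set.union_subset h h')
    | nand hf hg _ ih => exact .nand hf hg (ih (h.trans (Set.subset_insert _ _)))
  | @nand S T s f g hf hg _ ih =>
    rw [show s + 1 + r = s + r + 1 by omega]
    exact .nand hf hg (ih (h₂.mono_left (Set.subset_insert _ _)))

theorem biUnion {ι : Type} (t : Finset ι) {T : ι → Set (α → Bool)}
    (h : ∀ i ∈ t, Computes S s (T i)) : Computes S (t.card * s) (⋃ i ∈ t, T i) := by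
  classical
  induction t using Finset.induction_on with
  | empty => exact .of_subset (by simp)
  | insert i t hi ih =>
    rw [Finset.card_insert_of_notMem hi, Finset.set_biUnion_insert, add_mul, one_mul, add_comm]
    exact (h i (by simp)).union (ih fun j hj => h j (by simp [hj]))

theorem iUnion {ι : Type} [Fintype ι] {T : ι → Set (α → Bool)}
    (h : ∀ i, Computes S s (T i)) : Computes S (Fintype.card ι * s) (⋃ i, T i) := by
  simpa using biUnion (S := S) (s := s) Finset.univ fun i _ => h i

theorem single_nand (hf : f ∈ S) (hg : g ∈ S) : Computes S 1 {fun a => !(f a && g a)} :=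
  .nand hf hg (.of_subset (by simp))

/-- There are four unary operations. Constant false and the identity are free, negation is `NAND(f,
f)`, and constant true is `NAND(false, false)`. -/
theorem op1 (hS : (fun _ => false) ∈ S) (hf : f ∈ S) (o : Bool → Bool) :
    Computes S 1 {fun a => o (f a)} := by
  rcases h0 : o false <;> rcases h1 : o true
  · have : (fun a => o (f a)) = fun _ => false := by
      funext a; cases f a <;> simp [h0, h1]
    exact .of_subset (by simpa [this])
  · have : (fun a => o (f a)) = f := by
      funext a; cases f a <;> simp [h0, h1]
    exact .of_subset (by simpa [this])
  · have : (fun a => o (f a)) = fun a => !(f a && f a) := by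
      funext a; cases f a <;> simp [h0, h1]
    rw [this]; exact single_nand hf hf
  · have : (fun a => o (f a)) = fun a => !(false && false) := by
      funext a; cases f a <;> simp [h0, h1]
    rw [this]; exact single_nand hS hS

/-- The multiplexer is `NAND(NAND(f, g), NAND(NAND(f, f), h))`. -/
theorem mux (hf : f ∈ S) (hg : g ∈ S) (hh : h ∈ S) :
    Computes S 4 {fun a => bif f a then g a else h a} := by
  have : (fun a => bif f a then g a else h a)
      = fun a => !(!(f a && g a) && !((!(f a && f a)) && h a)) := by
    funext a; cases f a <;> cases g a <;> cases h a <;> rfl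
  rw [this]
  refine .nand hf hf (.nand (f := f) (g := g) ?_ ?_ (.nand (f := fun a => !(f a && f a)) (g := h)
    ?_ ?_ (.nand (f := fun a => !(f a && g a)) (g := fun a => !((!(f a && f a)) && h a))
    ?_ ?_ (.of_subset ?_)))) <;> simp [hf, hg, hh]

/-- Shannon expansion in the first argument: two unary operations and a multiplexer, `1 + 1 + 4`.
The ternary case repeats this with `6 + 6 + 4`. -/
theorem op2 (hS : (fun _ => false) ∈ S) (hf : f ∈ S) (hg : g ∈ S) (o : Bool → Bool → Bool) :
    Computes S 6 {fun a => o (f a) (g a)} := by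
  have h := (op1 hS hg (o true)).union (op1 hS hg (o false))
  refine h.trans (r := 4) ?_
  have : (fun a => o (f a) (g a)) = fun a => bif f a then o true (g a) else o false (g a) := by
    funext a; cases f a <;> rfl
  rw [this]
  exact mux (f := f) (by simp [hf]) (by simp) (by simp)

theorem op3 (hS : (fun _ => false) ∈ S) (hf : f ∈ S) (hg : g ∈ S) (hh : h ∈ S)
    (o : Bool → Bool → Bool → Bool) : Computes S 16 {fun a => o (f a) (g a) (h a)} := by
  have h' := (op2 hS hg hh (o true)).union (op2 hS hg hh (o false))
  refine h'.trans (r := 4) ?_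
  have : (fun a => o (f a) (g a) (h a))
      = fun a => bif f a then o true (g a) (h a) else o false (g a) (h a) := by
    funext a; cases f a <;> rfl
  rw [this]
  exact mux (f := f) (by simp [hf]) (by simp) (by simp)

theorem const (hS : (fun _ => false) ∈ S) (b : Bool) : Computes S 1 {fun _ : α => b} :=
  op1 hS hS fun _ => b

/-- The disjunction of finitely many bit functions. -/
theorem any (hS : (fun _ => false) ∈ S) {ι : Type} (t : Finset ι) {F : ι → α → Bool}
    (hF : ∀ i ∈ t, F i ∈ S) : Computes S (t.card * 6) {fun a => decide (∃ i ∈ t, F i a = true)} := by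
  classical
  induction t using Finset.induction_on with
  | empty => exact .of_subset (by simpa using hS)
  | insert i t hi ih =>
    rw [Finset.card_insert_of_notMem hi, add_mul, one_mul]
    refine (ih fun j hj => hF j (by simp [hj])).trans ?_
    have : (fun a => decide (∃ j ∈ insert i t, F j a = true))
        = fun a => F i a || decide (∃ j ∈ t, F j a = true) := by
      funext a; simp
    rw [this]
    exact op2 (f := F i) (by simp [hS]) (by simp [hF]) (by simp) or

end Computes

/-! ### Bit functions of concatenated encodings. -/

section Bits

variable {α β : Type}

theorem bitsOf_subset {f : α → List Bool} {S : Set (α → Bool)} (hS : (fun _ => false) ∈ S) {l : ℕ}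
    (hf : ∀ a, (f a).length = l) (h : ∀ i < l, (fun a => (f a).getD i false) ∈ S) :
    bitsOf f ⊆ S := by
  rintro _ ⟨i, rfl⟩
  by_cases hi : i < l
  · exact h i hi
  · convert hS using 2 with a
    simp [List.getD, List.getElem?_eq_none (show (f a).length ≤ i by rw [hf]; omega)]

theorem false_mem_bitsOf {f : α → List Bool} {l : ℕ} (hf : ∀ a, (f a).length = l) :
    (fun _ => false) ∈ bitsOf f :=
  ⟨l, by funext a; simp [List.getD, List.getElem?_eq_none (show (f a).length ≤ l by rw [hf])]⟩

theorem bitsOf_nil : bitsOf (fun _ : α => []) ⊆ {fun _ => false} := by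
  rintro _ ⟨i, rfl⟩; simp

theorem bitsOf_append_subset {f g : α → List Bool} {l : ℕ} (hf : ∀ a, (f a).length = l) :
    bitsOf (fun a => f a ++ g a) ⊆ bitsOf f ∪ bitsOf g := by
  rintro _ ⟨i, rfl⟩
  by_cases hi : i < l
  · left
    exact ⟨i, by funext a; simp [List.getD, List.getElem?_append, hf, hi]⟩
  · right
    exact ⟨i - l, by funext a; simp [List.getD, List.getElem?_append, hf, hi]⟩

theorem bitsOf_subset_append_right {f g : α → List Bool} {l : ℕ} (hf : ∀ a, (f a).length = l) :
    bitsOf g ⊆ bitsOf fun a => f a ++ g a := by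
  rintro _ ⟨i, rfl⟩
  exact ⟨l + i, by funext a; simp [List.getD, List.getElem?_append, hf]⟩

/-- Reading `f` past its end gives `false`, whereas the same position of the concatenation may lie
in `g`. The constant `false` is instead found past the end of the concatenation, so the length of
`g` has to be fixed too. -/
theorem bitsOf_subset_append_left {f g : α → List Bool} {l l' : ℕ} (hf : ∀ a, (f a).length = l)
    (hg : ∀ a, (g a).length = l') : bitsOf f ⊆ bitsOf fun a => f a ++ g a := by
  refine bitsOf_subset ?_ hf fun i hi => ?_
  · exact bitsOf_subset_append_right (g := g) hf (false_mem_bitsOf hg)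
  · exact ⟨i, by funext a; simp [List.getD, List.getElem?_append, hf, hi]⟩

theorem length_encBits {a : ℕ} (x : Bits a) : (encBits x).length = a := by simp [encBits]

theorem length_encNat (w x : ℕ) : (encNat w x).length = w := by simp [encNat]

theorem length_encVec {a l : ℕ} {f : Fin a → List Bool} (h : ∀ i, (f i).length = l) :
    (encVec f).length = a * l := by
  simp [encVec, List.length_flatten, Function.comp_def, h]

theorem length_encMat {a b l : ℕ} {f : Fin a → Fin b → List Bool} (h : ∀ i j, (f i j).length = l) :
    (encMat f).length = a * (b * l) :=
  length_encVec fun i => length_encVec (h i)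

theorem length_encInt {b : ℕ} (z : BInt b) : (encInt z).length = b + 1 := by
  simp [encInt, length_encNat]

theorem encVec_succ {a : ℕ} (f : Fin (a + 1) → List Bool) :
    encVec f = f 0 ++ encVec fun i => f i.succ := by
  simp [encVec, List.ofFn_succ]

theorem bitsOf_encVec_subset {a l : ℕ} {f : Fin a → α → List Bool} {S : Set (α → Bool)}
    (hS : (fun _ => false) ∈ S) (hl : ∀ i x, (f i x).length = l) (h : ∀ i, bitsOf (f i) ⊆ S) :
    bitsOf (fun x => encVec fun i => f i x) ⊆ S := by
  induction a with
  | zero => exact (bitsOf_nil (α := α)).trans (by simpa using hS)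
  | succ a ih =>
    simp only [encVec_succ]
    exact (bitsOf_append_subset (hl 0)).trans
      (Set.union_subset (h 0) (ih (fun i => hl i.succ) fun i => h i.succ))

theorem bitsOf_subset_encVec {a l : ℕ} {f : Fin a → α → List Bool}
    (hl : ∀ i x, (f i x).length = l) (i : Fin a) :
    bitsOf (f i) ⊆ bitsOf fun x => encVec fun i => f i x := by
  induction a with
  | zero => exact i.elim0
  | succ a ih =>
    simp only [encVec_succ]
    refine Fin.cases ?_ (fun i => ?_) i
    · exact bitsOf_subset_append_left (hl 0) fun x => length_encVec fun i => hl i.succ x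
    · exact (ih (fun i => hl i.succ) i).trans (bitsOf_subset_append_right (hl 0))

theorem bitsOf_encMat_subset {a b l : ℕ} {f : Fin a → Fin b → α → List Bool} {S : Set (α → Bool)}
    (hS : (fun _ => false) ∈ S) (hl : ∀ i j x, (f i j x).length = l)
    (h : ∀ i j, bitsOf (f i j) ⊆ S) :
    bitsOf (fun x => encMat fun i j => f i j x) ⊆ S :=
  bitsOf_encVec_subset hS (fun i x => length_encVec fun j => hl i j x)
    fun i => bitsOf_encVec_subset hS (hl i) (h i)

theorem bitsOf_subset_encMat {a b l : ℕ} {f : Fin a → Fin b → α → List Bool}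
    (hl : ∀ i j x, (f i j x).length = l) (i : Fin a) (j : Fin b) :
    bitsOf (f i j) ⊆ bitsOf fun x => encMat fun i j => f i j x :=
  (bitsOf_subset_encVec (hl i) j).trans
    (bitsOf_subset_encVec (f := fun i x => encVec fun j => f i j x)
      (fun i x => length_encVec fun j => hl i j x) i)

/-- A constant string costs at most one gate. -/
theorem Computes.const_bits {S : Set (α → Bool)} (hS : (fun _ => false) ∈ S) (x : List Bool) :
    Computes S 1 (bitsOf fun _ => x) := by
  refine .nand hS hS (.of_subset ?_)
  rintro _ ⟨i, rfl⟩
  simp only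
  cases x.getD i false
  · right; exact hS
  · left; rfl

end Bits

/-! ### Translation between gate derivations and circuits. -/

namespace Circuit

variable {α : Type}

/-- The values of all wires. -/
def wires (gs : List Gate) (x : List Bool) : List Bool :=
  gs.foldl (fun w g => w ++ [g.eval w]) x

theorem wires_append (gs hs : List Gate) (x : List Bool) :
    wires (gs ++ hs) x = wires hs (wires gs x) := by simp [wires]

theorem length_wires (gs : List Gate) (x : List Bool) :
    (wires gs x).length = x.length + gs.length := by
  induction gs generalizing x with
  | nil => rfl
  | cons g gs ih =>
    show (wires gs (x ++ [g.eval x])).length = _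
    rw [ih]; simp; omega

theorem eval_eq (C : Circuit) (x : List Bool) :
    C.eval x = C.outputs.map fun i => (wires C.gates x).getD i false := rfl

/-- Each gate of the list costs at most one derivation step: a NAND gate is one step, constant true
is `NAND(false, false)`, and constant false is already available past the end of the input. -/
theorem computes_wires {f : α → List Bool} {l : ℕ} (hf : ∀ a, (f a).length = l) (gs : List Gate) :
    Computes (bitsOf f) gs.length (bitsOf fun a => wires gs (f a)) := by
  induction gs generalizing f l with
  | nil => exact .of_subset le_rfl
  | cons g gs ih =>
    have h₁ : Computes (bitsOf f) 1 (bitsOf fun a => f a ++ [g.eval (f a)]) := by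
      have key : ∀ S, bitsOf f ⊆ S → (fun a => g.eval (f a)) ∈ S →
          bitsOf (fun a => f a ++ [g.eval (f a)]) ⊆ S := by
        intro S h₁ h₂
        refine (bitsOf_append_subset hf).trans (Set.union_subset h₁ ?_)
        rintro _ ⟨i, rfl⟩
        cases i with
        | zero => simpa using h₂
        | succ i => simpa using h₁ (false_mem_bitsOf hf)
      cases g with
      | const b =>
        cases b with
        | false => exact .of_subset (key _ le_rfl (false_mem_bitsOf hf))
        | true =>
          refine .nand (false_mem_bitsOf hf) (false_mem_bitsOf hf) (.of_subset ?_)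
          exact key _ (Set.subset_insert _ _) (by left; rfl)
      | nand i j =>
        refine .nand (f := fun a => (f a).getD i false) (g := fun a => (f a).getD j false)
          ⟨i, rfl⟩ ⟨j, rfl⟩ (.of_subset ?_)
        exact key _ (Set.subset_insert _ _) (by left; rfl)
    have h₂ := ih (f := fun a => f a ++ [g.eval (f a)]) (l := l + 1) fun a => by simp [hf]
    have := h₁.trans (h₂.mono_left Set.subset_union_right)
    rw [add_comm] at this
    exact this

/-- The output bits of a circuit are computed from its input bits. -/
theorem computes_eval (C : Circuit) {f : α → List Bool} {l : ℕ} (hf : ∀ a, (f a).length = l)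
    {S : Set (α → Bool)} (hS : bitsOf f ⊆ S) :
    Computes S C.size (bitsOf fun a => C.eval (f a)) := by
  have h := ((computes_wires hf C.gates).mono (r := C.size) (by simp [size])).mono_left hS
  refine h.mono_right (bitsOf_subset (l := C.outputs.length) ?_ (by simp [eval_eq]) fun i hi => ?_)
  · exact false_mem_bitsOf (l := l + C.gates.length) fun a => by rw [length_wires, hf]
  · exact ⟨C.outputs[i], by funext a; simp [eval_eq, hi]⟩

theorem computes_accepts (C : Circuit) {f : α → List Bool} {l : ℕ} (hf : ∀ a, (f a).length = l)
    {S : Set (α → Bool)} (hS : bitsOf f ⊆ S) :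
    Computes S C.size {fun a => C.accepts (f a)} :=
  (C.computes_eval hf hS).mono_right (by
    rw [Set.singleton_subset_iff]
    exact ⟨0, by funext a; simp [accepts, List.headD_eq_head?_getD, List.head?_eq_getElem?]⟩)

/-- The invariant is that every derived function sits on an existing wire. The bound on the wire
number matters: an absent wire also reads `false`, but its value could change when gates are
appended. -/
theorem exists_gates {S T : Set (α → Bool)} {s : ℕ} (h : Computes S s T) {f : α → List Bool}
    {l : ℕ} (hf : ∀ a, (f a).length = l) (gs : List Gate)
    (hS : ∀ g ∈ S, ∃ i < l + gs.length, ∀ a, (wires gs (f a)).getD i false = g a) :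
    ∃ gs' : List Gate, gs'.length ≤ gs.length + s ∧
      ∀ g ∈ T, ∃ i < l + gs'.length, ∀ a, (wires gs' (f a)).getD i false = g a := by
  induction h generalizing gs with
  | of_subset h => exact ⟨gs, by omega, fun g hg => hS g (h hg)⟩
  | @nand S T s g₁ g₂ h₁ h₂ _ ih =>
    obtain ⟨i, hi, hi'⟩ := hS _ h₁
    obtain ⟨j, hj, hj'⟩ := hS _ h₂
    obtain ⟨gs', hlen, hgs'⟩ := ih (gs ++ [.nand i j]) (by
      rintro g (rfl | hg)
      · refine ⟨l + gs.length, by simp, fun a => ?_⟩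
        have hl : l + gs.length = (wires gs (f a)).length := by rw [length_wires, hf]
        rw [wires_append, hl]
        show (wires gs (f a) ++ [!((wires gs (f a)).getD i false &&
          (wires gs (f a)).getD j false)]).getD _ false = _
        rw [hi', hj']
        simp [List.getD]
      · obtain ⟨p, hp, hp'⟩ := hS _ hg
        refine ⟨p, by simp; omega, fun a => ?_⟩
        have hl : p < (wires gs (f a)).length := by rw [length_wires, hf]; exact hp
        rw [wires_append, ← hp' a]
        show (wires gs (f a) ++ [_]).getD p false = _
        simp [List.getD, List.getElem?_append, hl])
    exact ⟨gs', by simp at hlen; omega, hgs'⟩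

/-- Functions that are computed by few gates are computed by a small circuit. -/
theorem exists_of_computes {f g : α → List Bool} {l l' s : ℕ} (hf : ∀ a, (f a).length = l)
    (hg : ∀ a, (g a).length = l') (h : Computes (bitsOf f) s (bitsOf g)) :
    ∃ C : Circuit, C.size ≤ s + 1 + l' ∧ ∀ a, C.eval (f a) = g a := by
  -- The initial constant gate provides a genuine wire `l` for the bits read past the end of the
  -- input; it accounts for the `1` in the size bound.
  obtain ⟨gs, hlen, hgs⟩ := exists_gates h hf [.const false] (by
    rintro _ ⟨i, rfl⟩
    by_cases hi : i < l
    · exact ⟨i, by omega, fun a => by simp [wires, List.getD, List.getElem?_append, hf, hi]⟩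
    · refine ⟨l, by simp, fun a => ?_⟩
      simp only [wires, List.foldl_cons, List.foldl_nil, Gate.eval]
      simp [List.getD, hf, List.getElem?_eq_none (show (f a).length ≤ i by rw [hf]; omega)])
  choose! idx hidx using hgs
  refine ⟨⟨gs, List.ofFn fun i : Fin l' => idx fun a => (g a).getD i false⟩, ?_, fun a => ?_⟩
  · simp [size] at hlen ⊢; omega
  · refine List.ext_getElem (by simp [eval_eq, hg]) fun i h₁ h₂ => ?_
    have := (hidx (fun a => (g a).getD i false) ⟨i, rfl⟩).2 a
    simp only [eval_eq, List.getElem_map, List.getElem_ofFn, this]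
    simp [h₂]

theorem exists_accepts_of_computes {f : α → List Bool} {g : α → Bool} {l s : ℕ}
    (hf : ∀ a, (f a).length = l) (h : Computes (bitsOf f) s {g}) :
    ∃ C : Circuit, C.size ≤ s + 2 ∧ ∀ a, C.accepts (f a) = g a := by
  have h' : Computes (bitsOf f) s (bitsOf fun a => [g a]) := by
    have h'' := h.union (Computes.of_subset (s := 0) (le_refl (bitsOf f)))
    refine h''.mono_right (bitsOf_subset (l := 1) (.inr (false_mem_bitsOf hf)) (by simp) ?_)
    intro i hi
    obtain rfl : i = 0 := by omega
    left; rfl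
  obtain ⟨C, hC, hC'⟩ := exists_of_computes hf (l' := 1) (by simp) h'
  exact ⟨C, by omega, fun a => by simp [accepts, hC']⟩

end Circuit

/-! Arithmetic by gates. -/

section Arithmetic

variable {α : Type}

/-- The binary digits of a number-valued function. -/
def digits (x : α → ℕ) : Set (α → Bool) := Set.range fun i a => (x a).testBit i

theorem false_mem_digits {x : α → ℕ} {W : ℕ} (hx : ∀ a, x a < 2 ^ W) :
    (fun _ => false) ∈ digits x :=
  ⟨W, by funext a; exact Nat.testBit_lt_two_pow (hx a)⟩

theorem digits_subset {x : α → ℕ} {W : ℕ} (hx : ∀ a, x a < 2 ^ W) {S : Set (α → Bool)}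
    (hS : (fun _ => false) ∈ S) (h : ∀ i < W, (fun a => (x a).testBit i) ∈ S) :
    digits x ⊆ S := by
  rintro _ ⟨i, rfl⟩
  by_cases hi : i < W
  · exact h i hi
  · convert hS using 2 with a
    exact Nat.testBit_lt_two_pow ((hx a).trans_le (Nat.pow_le_pow_right (by omega) (by omega)))

theorem bitsOf_encNat_subset (W : ℕ) {x : α → ℕ} {S : Set (α → Bool)}
    (hS : (fun _ => false) ∈ S) (h : digits x ⊆ S) : bitsOf (fun a => encNat W (x a)) ⊆ S :=
  bitsOf_subset hS (fun _ => length_encNat _ _) fun i hi =>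
    h ⟨i, by funext a; simp [encNat, List.getD, hi]⟩

theorem digits_subset_encNat {W : ℕ} {x : α → ℕ} (hx : ∀ a, x a < 2 ^ W) :
    digits x ⊆ bitsOf fun a => encNat W (x a) :=
  digits_subset hx (false_mem_bitsOf fun _ => length_encNat _ _) fun i hi =>
    ⟨i, by funext a; simp [encNat, List.getD, hi]⟩

/-- This is long subtraction seen on residues: the residue of the difference wraps around exactly
when there is a borrow. For `p = 2 ^ i` and `p = 2 ^ (i + 1)` it determines the `i`-th digit of the
difference. -/
theorem sub_mod_cases {x y p : ℕ} (hp : 0 < p) (h : y ≤ x) :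
    (x % p < y % p → (x - y) % p + y % p = x % p + p) ∧
      (y % p ≤ x % p → (x - y) % p + y % p = x % p) := by
  have h₁ : x % p = (y % p + (x - y) % p) % p := by
    rw [← Nat.add_mod, Nat.add_sub_cancel' h]
  have h₂ := Nat.mod_lt y hp
  have h₃ := Nat.mod_lt (x - y) hp
  by_cases h₄ : y % p + (x - y) % p < p
  · rw [Nat.mod_eq_of_lt h₄] at h₁; omega
  · rw [Nat.mod_eq_sub_mod (Nat.le_of_not_lt h₄),
      Nat.mod_eq_of_lt (a := y % p + (x - y) % p - p) (by omega)] at h₁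
    omega

theorem mod_two_pow_succ (x i : ℕ) :
    x % 2 ^ (i + 1) = x % 2 ^ i + 2 ^ i * (x.testBit i).toNat := by
  rw [Nat.mod_pow_succ, Nat.toNat_testBit]

/-- The borrow into position `i` of a subtraction. -/
def borrow (x y i : ℕ) : Bool := decide (x % 2 ^ i < y % 2 ^ i)

/-- The top digits decide the comparison if they differ; otherwise it is inherited from the lower
digits. -/
theorem borrow_succ (x y i : ℕ) : borrow x y (i + 1)
    = bif x.testBit i == y.testBit i then borrow x y i else y.testBit i := by
  have hx := Nat.mod_lt x (show 0 < 2 ^ i by positivity)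
  have hy := Nat.mod_lt y (show 0 < 2 ^ i by positivity)
  unfold borrow
  rw [mod_two_pow_succ, mod_two_pow_succ]
  cases x.testBit i <;> cases y.testBit i <;> simp <;> omega

theorem testBit_sub_eq {x y : ℕ} (h : y ≤ x) (i : ℕ) :
    (x - y).testBit i = (x.testBit i ^^ (y.testBit i ^^ borrow x y i)) := by
  have hx := Nat.mod_lt x (show 0 < 2 ^ i by positivity)
  have hy := Nat.mod_lt y (show 0 < 2 ^ i by positivity)
  have hd := Nat.mod_lt (x - y) (show 0 < 2 ^ i by positivity)
  have h₁ := sub_mod_cases (p := 2 ^ i) (by positivity) h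
  have h₂ := sub_mod_cases (p := 2 ^ (i + 1)) (by positivity) h
  rw [mod_two_pow_succ, mod_two_pow_succ, mod_two_pow_succ, Nat.pow_succ] at h₂
  by_cases hb : x % 2 ^ i < y % 2 ^ i
  · have hb' : borrow x y i = true := by simpa [borrow] using hb
    rw [hb']
    have h₁ := h₁.1 hb
    revert h₂
    cases x.testBit i <;> cases y.testBit i <;> cases (x - y).testBit i <;> simp <;> omega
  · have hb' : borrow x y i = false := by simpa [borrow] using hb
    rw [hb']
    have h₁ := h₁.2 (by omega)
    revert h₂
    cases x.testBit i <;> cases y.testBit i <;> cases (x - y).testBit i <;> simp <;> omega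

/-- `x - y` if this is nonnegative, and `x` otherwise. -/
def condSub (x y : ℕ) : ℕ := if y ≤ x then x - y else x

theorem condSub_le (x y : ℕ) : condSub x y ≤ x := by unfold condSub; split <;> omega

theorem Computes.borrow {S : Set (α → Bool)} {x y : α → ℕ} (hS : (fun _ => false) ∈ S)
    (hx : digits x ⊆ S) (hy : digits y ⊆ S) (W : ℕ) :
    Computes S (W * 16) {g | ∃ i ≤ W, g = fun a => borrow (x a) (y a) i} := by
  induction W with
  | zero =>
    refine .of_subset ?_
    rintro _ ⟨i, hi, rfl⟩
    obtain rfl : i = 0 := by omega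
    simpa [_root_.borrow, Nat.mod_one] using hS
  | succ W ih =>
    rw [add_mul, one_mul]
    have h₁ : Computes (S ∪ {g | ∃ i ≤ W, g = fun a => _root_.borrow (x a) (y a) i}) 16
        {fun a => _root_.borrow (x a) (y a) (W + 1)} := by
      simp only [borrow_succ]
      exact op3 (f := fun a => (x a).testBit W) (g := fun a => (y a).testBit W)
        (h := fun a => _root_.borrow (x a) (y a) W) (.inl hS) (.inl (hx ⟨W, rfl⟩))
        (.inl (hy ⟨W, rfl⟩)) (.inr ⟨W, le_rfl, rfl⟩) fun p q r => bif p == q then r else q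
    have h₂ := ih.trans (h₁.union (Computes.of_subset (s := 0)
      (T := {g | ∃ i ≤ W, g = fun a => _root_.borrow (x a) (y a) i}) Set.subset_union_right))
    refine h₂.mono_right ?_
    rintro _ ⟨i, hi, rfl⟩
    rcases Nat.lt_or_ge W i with h | h
    · obtain rfl : i = W + 1 := by omega
      exact .inl rfl
    · exact .inr ⟨i, h, rfl⟩

/-- All borrows cost 16 gates per digit. Each output digit then costs 16 for the difference digit
and 4 for the choice between difference and `x`. -/
theorem Computes.condSub {S : Set (α → Bool)} {x y : α → ℕ} {W : ℕ} (hx' : ∀ a, x a < 2 ^ W)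
    (hy' : ∀ a, y a < 2 ^ W) (hx : digits x ⊆ S) (hy : digits y ⊆ S) :
    Computes S (W * 36) (digits fun a => condSub (x a) (y a)) := by
  have hS := hx (false_mem_digits hx')
  have h₁ := Computes.borrow hS hx hy W
  set T := S ∪ {g | ∃ i ≤ W, g = fun a => _root_.borrow (x a) (y a) i}
  have h₂ : ∀ i : Fin W, Computes T 20 {fun a => (_root_.condSub (x a) (y a)).testBit i} := by
    intro i
    have h := op3 (S := T) (f := fun a => (x a).testBit i) (g := fun a => (y a).testBit i)
        (h := fun a => _root_.borrow (x a) (y a) i) (.inl hS) (.inl (hx ⟨i, rfl⟩))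
        (.inl (hy ⟨i, rfl⟩)) (.inr ⟨i, i.2.le, rfl⟩) fun p q r => p ^^ (q ^^ r)
    refine h.trans (r := 4) ?_
    -- The borrow out of the top position `W` is the comparison `x < y`, since both numbers are
    -- below `2 ^ W`.
    have e : (fun a => (_root_.condSub (x a) (y a)).testBit i)
        = fun a => bif _root_.borrow (x a) (y a) W then (x a).testBit i
          else (x a).testBit i ^^ ((y a).testBit i ^^ _root_.borrow (x a) (y a) i) := by
      funext a
      have hb : _root_.borrow (x a) (y a) W = decide (x a < y a) := by
        simp [_root_.borrow, Nat.mod_eq_of_lt (hx' a), Nat.mod_eq_of_lt (hy' a)]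
      rw [hb, _root_.condSub]
      by_cases h : y a ≤ x a
      · rw [if_pos h, testBit_sub_eq h, decide_eq_false (Nat.not_lt.2 h), cond_false]
      · rw [if_neg h, decide_eq_true (Nat.lt_of_not_le h), cond_true]
    rw [e]
    exact mux (f := fun a => _root_.borrow (x a) (y a) W) (g := fun a => (x a).testBit i)
      (h := fun a => (x a).testBit i ^^ ((y a).testBit i ^^ _root_.borrow (x a) (y a) i))
      (.inl (.inr ⟨W, le_rfl, rfl⟩)) (.inl (.inl (hx ⟨i, rfl⟩))) (.inr rfl)
  have h₃ := h₁.trans ((Computes.iUnion h₂).union (Computes.of_subset (s := 0)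
    (T := {fun _ => false}) (by simpa [T] using .inl hS)))
  rw [Fintype.card_fin] at h₃
  refine (h₃.mono (by omega)).mono_right
    (digits_subset (W := W) (fun a => (condSub_le _ _).trans_lt (hx' a)) (.inr rfl) ?_)
  exact fun i hi => .inl (Set.mem_iUnion.2 ⟨⟨i, hi⟩, rfl⟩)

/-- Computation of `(δ - x) mod δ`. -/
theorem Computes.neg_mod {S : Set (α → Bool)} {x d : α → ℕ} {W : ℕ} (hd' : ∀ a, d a < 2 ^ W)
    (hxd : ∀ a, x a < d a) (hx : digits x ⊆ S) (hd : digits d ⊆ S) :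
    Computes S (W * 72) (digits fun a => (d a - x a) % d a) := by
  have h₁ := Computes.condSub hd' (fun a => (hxd a).trans (hd' a)) hd hx
  have h₂ := Computes.condSub (x := fun a => _root_.condSub (d a) (x a)) (y := d)
    (fun a => (condSub_le _ _).trans_lt (hd' a)) hd' (Set.subset_union_right (s := S)
    (t := digits fun a => _root_.condSub (d a) (x a)))
    (hd.trans Set.subset_union_left)
  have h₃ := h₁.trans h₂
  -- The first conditional subtraction always subtracts, as `x < d`. The second changes the result
  -- only for `x = 0`, where it turns `d` into `0`.
  have : (fun a => (d a - x a) % d a)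
      = fun a => _root_.condSub (_root_.condSub (d a) (x a)) (d a) := by
    funext a
    have := hxd a
    unfold _root_.condSub
    rw [if_pos this.le]
    rcases Nat.eq_zero_or_pos (x a) with h | h
    · simp [h]
    · rw [if_neg (by omega), Nat.mod_eq_of_lt (by omega)]
  rw [this]
  exact h₃.mono (by omega)

theorem digits_two_mul_add {S : Set (α → Bool)} {x : α → ℕ} (hx : digits x ⊆ S) (b : Bool)
    (hb : (fun _ => b) ∈ S) : digits (fun a => 2 * x a + b.toNat) ⊆ S := by
  rintro _ ⟨i, rfl⟩
  cases i with
  | zero =>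
    convert hb using 2 with a
    cases b <;> simp [Nat.testBit_zero, Nat.add_mod]
  | succ i =>
    convert hx ⟨i, rfl⟩ using 1
    funext a
    show (2 * x a + b.toNat).testBit (i + 1) = (x a).testBit i
    rw [Nat.testBit_succ]
    congr 1
    have := Bool.toNat_lt b
    omega

/-- Reduction of a constant of `B` binary digits. -/
theorem Computes.const_mod {S : Set (α → Bool)} {d : α → ℕ} {W : ℕ} (hd' : ∀ a, d a < 2 ^ W)
    (hd₀ : ∀ a, 0 < d a) (hd : digits d ⊆ S) (B z : ℕ) (hz : z < 2 ^ B) :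
    Computes S (B * ((W + 1) * 36 + 1)) (digits fun a => z % d a) := by
  have hS := hd (false_mem_digits hd')
  induction B generalizing z with
  | zero =>
    obtain rfl : z = 0 := by simpa using hz
    refine .of_subset ?_
    rintro _ ⟨i, rfl⟩
    simpa using hS
  | succ B ih =>
    rw [add_mul, one_mul]
    -- Horner's scheme from the leading digit: with `z = 2 * (z / 2) + b`, doubling the residue of
    -- `z / 2` and adding `b` gives a number below `2 * d`, so one conditional subtraction reduces
    -- it.
    refine (ih (z / 2) (by rw [pow_succ] at hz; omega)).trans ?_
    set T := S ∪ digits fun a => z / 2 % d a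
    set b := z.testBit 0
    have hT : (fun _ => false) ∈ T := .inl hS
    rw [add_comm _ 1]
    refine (Computes.const hT b).trans ?_
    set x : α → ℕ := fun a => 2 * (z / 2 % d a) + b.toNat
    have hxd : ∀ a, x a < 2 * d a := fun a => by
      have := Nat.mod_lt (z / 2) (hd₀ a)
      have : b.toNat < 2 := Bool.toNat_lt b
      simp only [x]; omega
    have h : (fun a => z % d a) = fun a => _root_.condSub (x a) (d a) := by
      funext a
      have h₁ : z % d a = x a % d a := by
        have hz2 : z = 2 * (z / 2) + b.toNat := by
          have : b.toNat = z % 2 := by simp [b, Nat.testBit_zero]; rcases Nat.mod_two_eq_zero_or_one z with h | h <;> simp [h]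
          omega
        conv_lhs => rw [hz2]
        simp only [x]
        exact (((Nat.mod_modEq (z / 2) (d a)).symm.mul_left 2).add_right _)
      have := hxd a
      rw [h₁, _root_.condSub]
      split_ifs with h
      · rw [Nat.mod_eq_sub_mod h, Nat.mod_eq_of_lt (by omega)]
      · rw [Nat.mod_eq_of_lt (by omega)]
    rw [h]
    -- One additional digit is needed for the doubled residue.
    refine Computes.condSub (W := W + 1) (fun a => ?_) (fun a => ?_) ?_ ?_
    · have := hxd a; have := hd' a; rw [pow_succ]; omega
    · have := hd' a; rw [pow_succ]; omega
    · exact digits_two_mul_add (x := fun a => z / 2 % d a)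
        (Set.subset_union_right.trans Set.subset_union_left) b (.inr rfl)
    · exact (hd.trans Set.subset_union_left).trans Set.subset_union_left

end Arithmetic

/-! Polynomial bounds. -/

section PolyBounds

variable {ι : Type} {sz : ι → ℕ} {f g : ι → ℕ}

/-- Growth at most polynomial in the size of the index. -/
def PolyBound (sz f : ι → ℕ) : Prop := ∃ P : Polynomial ℕ, ∀ i, f i ≤ P.eval (sz i)

theorem eval_nat_mono (P : Polynomial ℕ) : Monotone fun n => P.eval n := by
  intro a b h
  simp only [Polynomial.eval_eq_sum_range]
  gcongr

namespace PolyBound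

theorem add (hf : PolyBound sz f) (hg : PolyBound sz g) : PolyBound sz fun i => f i + g i := by
  obtain ⟨P, hP⟩ := hf
  obtain ⟨Q, hQ⟩ := hg
  exact ⟨P + Q, fun i => by rw [Polynomial.eval_add]; exact add_le_add (hP i) (hQ i)⟩

theorem mul (hf : PolyBound sz f) (hg : PolyBound sz g) : PolyBound sz fun i => f i * g i := by
  obtain ⟨P, hP⟩ := hf
  obtain ⟨Q, hQ⟩ := hg
  exact ⟨P * Q, fun i => by rw [Polynomial.eval_mul]; exact Nat.mul_le_mul (hP i) (hQ i)⟩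

theorem const (c : ℕ) : PolyBound sz fun _ => c := ⟨Polynomial.C c, by simp⟩

theorem self : PolyBound sz sz := ⟨Polynomial.X, by simp⟩

theorem mono (hg : PolyBound sz g) (h : ∀ i, f i ≤ g i) : PolyBound sz f := by
  obtain ⟨P, hP⟩ := hg
  exact ⟨P, fun i => (h i).trans (hP i)⟩

theorem eval (hf : PolyBound sz f) (P : Polynomial ℕ) : PolyBound sz fun i => P.eval (f i) := by
  obtain ⟨Q, hQ⟩ := hf
  refine ⟨P.comp Q, fun i => ?_⟩
  rw [Polynomial.eval_comp]
  exact eval_nat_mono P (hQ i)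

theorem comp {f : ℕ → ℕ} (hf : PolyBounded f) {h : ι → ℕ} (hh : PolyBound sz h) :
    PolyBound sz fun i => f (h i) := by
  obtain ⟨P, hP⟩ := hf
  exact (hh.eval P).mono fun i => hP (h i)

end PolyBound

/-- A family of functions that are computed by polynomially many gates is computed by circuits of
polynomial size. -/
theorem PolySize.of_computes {α : ι → Type} {inp out : ∀ i, α i → List Bool} {l l' c : ι → ℕ}
    (hinp : ∀ i a, (inp i a).length = l i) (hout : ∀ i a, (out i a).length = l' i)
    (hl : PolyBound sz l) (hl' : PolyBound sz l') (hc : PolyBound sz c)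
    (h : ∀ i, Computes (bitsOf (inp i)) (c i) (bitsOf (out i))) : PolySize sz inp out := by
  obtain ⟨P, hP⟩ := (hl.add hc).add (hl'.add (PolyBound.const 1))
  refine ⟨P, fun i => ?_⟩
  obtain ⟨C, hC, hC'⟩ := Circuit.exists_of_computes (hinp i) (hout i) (h i)
  have : l i + c i + (l' i + 1) ≤ P.eval (sz i) := hP i
  exact ⟨C, by omega, fun a => ⟨by rw [hinp]; omega, hC' a⟩⟩

/-- Application of a family of functions of polynomial size. -/
theorem PolySize.exists_computes {α : ι → Type} {inp out : ∀ i, α i → List Bool} {l : ι → ℕ}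
    (h : PolySize sz inp out) (hinp : ∀ i a, (inp i a).length = l i) :
    ∃ c : ι → ℕ, PolyBound sz c ∧ ∀ (i : ι) {β : Type} {S : Set (β → Bool)} (e : β → α i),
      bitsOf (fun x => inp i (e x)) ⊆ S → Computes S (c i) (bitsOf fun x => out i (e x)) := by
  obtain ⟨P, hP⟩ := h
  refine ⟨fun i => P.eval (sz i), ⟨P, fun _ => le_rfl⟩, fun i β S e hS => ?_⟩
  obtain ⟨C, hC, hC'⟩ := hP i
  have := (C.computes_eval (fun x => hinp i (e x)) hS).mono hC
  simpa only [(hC' _).2] using this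

/-- `PolySize` bounds the length of inputs that exist. Where the argument type may be empty it says
nothing, hence the alternative `l i = 0`. -/
theorem PolySize.polyBound_inp {α : ι → Type} {inp out : ∀ i, α i → List Bool} {l : ι → ℕ}
    (h : PolySize sz inp out) (hl : ∀ i, l i = 0 ∨ ∃ a, l i ≤ (inp i a).length) :
    PolyBound sz l := by
  obtain ⟨P, hP⟩ := h
  refine ⟨P, fun i => ?_⟩
  obtain ⟨C, -, hC⟩ := hP i
  rcases hl i with h | ⟨a, ha⟩
  · omega
  · exact ha.trans (hC a).1

/-- The output wires of a circuit are counted in its size. -/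
theorem PolySize.polyBound_out {α : ι → Type} {inp out : ∀ i, α i → List Bool} {l : ι → ℕ}
    (h : PolySize sz inp out) (hl : ∀ i, ∃ a, l i ≤ (out i a).length) :
    PolyBound sz l := by
  obtain ⟨P, hP⟩ := h
  refine ⟨P, fun i => ?_⟩
  obtain ⟨C, hCs, hC⟩ := hP i
  obtain ⟨a, ha⟩ := hl i
  rw [← (hC a).2, Circuit.eval_eq, List.length_map] at ha
  unfold Circuit.size at hCs
  omega

end PolyBounds

/-! Probabilities as averages, hybrid arguments, negligible functions. -/

section Average

variable {α β γ : Type}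

/-- The probability that a sample has the property `g`. -/
def prob (g : α → Bool) (p : PMF α) : ℝ := ((p.map g) true).toReal

theorem advantage_eq (D : Circuit) (p q : PMF (List Bool)) :
    advantage D p q = |prob D.accepts p - prob D.accepts q| := rfl

theorem prob_pure (g : α → Bool) (a : α) : prob g (pure a) = if g a then 1 else 0 := by
  unfold prob
  rw [show (pure a : PMF α) = PMF.pure a from rfl, PMF.pure_map, PMF.pure_apply]
  by_cases h : g a <;> simp [h]

theorem prob_map (g : β → Bool) (f : α → β) (p : PMF α) :
    prob g (p.map f) = prob (fun a => g (f a)) p := by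
  unfold prob; rw [PMF.map_comp]; rfl

theorem prob_bind_unif [Fintype α] [Nonempty α] (g : β → Bool) (f : α → PMF β) :
    prob g (unif α >>= f) = 𝔼 a, prob g (f a) := by
  unfold prob
  rw [show (unif α >>= f) = (unif α).bind f from rfl, PMF.map_bind, PMF.bind_apply, tsum_fintype,
    ENNReal.toReal_sum (fun a _ => ENNReal.mul_ne_top (PMF.apply_ne_top _ _)
      (PMF.apply_ne_top _ _)), Fintype.expect_eq_sum_div_card, Finset.sum_div]
  refine Finset.sum_congr rfl fun a _ => ?_
  rw [ENNReal.toReal_mul, PMF.uniformOfFintype_apply, ENNReal.toReal_inv, ENNReal.toReal_natCast]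
  rw [mul_comm, div_eq_mul_inv]

theorem prob_unif [Fintype α] [Nonempty α] (g : α → Bool) :
    prob g (unif α) = 𝔼 a, if g a then 1 else 0 := by
  rw [← bind_pure (unif α), prob_bind_unif]
  simp only [prob_pure]

theorem abs_expect_sub_le [Fintype α] [Nonempty α] {f g : α → ℝ} {ε : ℝ}
    (h : ∀ a, |f a - g a| ≤ ε) : |𝔼 a, f a - 𝔼 a, g a| ≤ ε := by
  rw [← Finset.expect_sub_distrib]
  exact (Finset.abs_expect_le _ _).trans (Finset.expect_le Finset.univ_nonempty fun a _ => h a)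

theorem expect_mem_Icc [Fintype α] [Nonempty α] {f : α → ℝ} (h : ∀ a, f a ∈ Set.Icc (0 : ℝ) 1) :
    𝔼 a, f a ∈ Set.Icc (0 : ℝ) 1 :=
  ⟨Finset.le_expect Finset.univ_nonempty fun a _ => (h a).1,
    Finset.expect_le Finset.univ_nonempty fun a _ => (h a).2⟩

theorem ite_mem_Icc (p : Prop) [Decidable p] : (if p then (1 : ℝ) else 0) ∈ Set.Icc (0 : ℝ) 1 := by
  split <;> simp

theorem abs_sub_le_one {x y : ℝ} (hx : x ∈ Set.Icc (0 : ℝ) 1) (hy : y ∈ Set.Icc (0 : ℝ) 1) :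
    |x - y| ≤ 1 := by
  rw [abs_le]; constructor <;> linarith [hx.1, hx.2, hy.1, hy.2]

theorem prob_mem_Icc (g : α → Bool) (p : PMF α) : prob g p ∈ Set.Icc (0 : ℝ) 1 :=
  ⟨ENNReal.toReal_nonneg, ENNReal.toReal_le_of_le_ofReal zero_le_one (by
    rw [ENNReal.ofReal_one]; exact PMF.coe_le_one _ _)⟩

theorem advantage_nonneg (D : Circuit) (p q : PMF (List Bool)) : 0 ≤ advantage D p q :=
  abs_nonneg _

theorem advantage_le_one (D : Circuit) (p q : PMF (List Bool)) : advantage D p q ≤ 1 := by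
  rw [advantage_eq]; exact abs_sub_le_one (prob_mem_Icc _ _) (prob_mem_Icc _ _)

/-- Resampling one coordinate of a uniform vector leaves it uniform: exchanging the old and the new
coordinate is an involution on pairs. -/
theorem expect_update {ι : Type} [Fintype ι] [DecidableEq ι] [Fintype α] [Nonempty α] (i : ι)
    (g : (ι → α) → ℝ) : 𝔼 a, 𝔼 x, g (Function.update a i x) = 𝔼 a, g a := by
  have h₁ : 𝔼 a : ι → α, 𝔼 x, g (Function.update a i x)
      = 𝔼 p : (ι → α) × α, g (Function.update p.1 i p.2) :=
    (Finset.expect_product Finset.univ Finset.univ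
      fun p : (ι → α) × α => g (Function.update p.1 i p.2)).symm
  have h₂ : 𝔼 a : ι → α, g a = 𝔼 p : (ι → α) × α, g p.1 := by
    rw [← Finset.univ_product_univ, Finset.expect_product]
    simp
  rw [h₁, h₂]
  have inv : Function.Involutive fun p : (ι → α) × α => (Function.update p.1 i p.2, p.1 i) := by
    rintro ⟨a, x⟩; simp
  exact Fintype.expect_equiv inv.toPerm _ _ fun p => rfl

/-- Replacing the coordinates of a random vector one after the other. -/
theorem hybrid {ι : Type} [Fintype ι] [DecidableEq ι] [Fintype α] [Nonempty α] [Fintype β]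
    [Nonempty β] (u : ι → α → γ) (v : ι → β → γ) (F : (ι → γ) → ℝ) {ε : ℝ}
    (h : ∀ i (c : ι → γ), (∀ j, c j ∈ Set.range (u j) ∪ Set.range (v j)) →
      |𝔼 a, F (Function.update c i (u i a)) - 𝔼 b, F (Function.update c i (v i b))| ≤ ε) :
    |𝔼 a : ι → α, F (fun i => u i (a i)) - 𝔼 b : ι → β, F (fun i => v i (b i))|
      ≤ Fintype.card ι * ε := by
  -- The hybrids are indexed by the set `s` of coordinates already replaced. Adding `i` to `s`
  -- changes one coordinate, which is made independent of the others by resampling.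
  let mix (s : Finset ι) (a : ι → α) (b : ι → β) : ι → γ :=
    fun i => if i ∈ s then v i (b i) else u i (a i)
  have key : ∀ s : Finset ι, |𝔼 a : ι → α, F (fun i => u i (a i)) - 𝔼 a, 𝔼 b, F (mix s a b)|
      ≤ s.card * ε := by
    intro s
    induction s using Finset.induction_on with
    | empty => simp [mix]
    | insert i s hi ih =>
      rw [Finset.card_insert_of_notMem hi]
      have h₁ : 𝔼 a, 𝔼 b, F (mix s a b)
          = 𝔼 a, 𝔼 b, 𝔼 x, F (Function.update (mix s a b) i (u i x)) := by
        rw [← expect_update i]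
        refine Finset.expect_congr rfl fun a _ => ?_
        rw [Finset.expect_comm]
        refine Finset.expect_congr rfl fun b _ => Finset.expect_congr rfl fun x _ => ?_
        congr 1
        funext j
        by_cases hj : j = i
        · subst hj; simp [mix, hi]
        · simp [mix, hj]
      have h₂ : 𝔼 a, 𝔼 b, F (mix (insert i s) a b)
          = 𝔼 a, 𝔼 b, 𝔼 y, F (Function.update (mix s a b) i (v i y)) := by
        refine Finset.expect_congr rfl fun a _ => ?_
        rw [← expect_update i]
        refine Finset.expect_congr rfl fun b _ => Finset.expect_congr rfl fun y _ => ?_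
        congr 1
        funext j
        by_cases hj : j = i
        · subst hj; simp [mix]
        · simp [mix, hj]
      have h₃ : |𝔼 a, 𝔼 b, F (mix s a b) - 𝔼 a, 𝔼 b, F (mix (insert i s) a b)| ≤ ε := by
        rw [h₁, h₂]
        refine abs_expect_sub_le fun a => abs_expect_sub_le fun b => h i _ fun j => ?_
        by_cases hj : j ∈ s
        · right; exact ⟨b j, by simp [mix, hj]⟩
        · left; exact ⟨a j, by simp [mix, hj]⟩
      have := abs_sub_le (𝔼 a : ι → α, F (fun i => u i (a i))) (𝔼 a, 𝔼 b, F (mix s a b))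
        (𝔼 a, 𝔼 b, F (mix (insert i s) a b))
      push_cast
      linarith
  simpa [mix] using key Finset.univ

theorem expect_curry {ι κ : Type} [Fintype ι] [Fintype κ] [DecidableEq ι] [DecidableEq κ]
    [Fintype α] (g : (ι → κ → α) → ℝ) :
    𝔼 a, g a = 𝔼 a : ι × κ → α, g fun i j => a (i, j) :=
  (Fintype.expect_equiv (Equiv.curry ι κ α) _ _ fun _ => rfl).symm

/-- Replacing the entries of a random matrix one after the other. -/
theorem hybrid_matrix {ι κ : Type} [Fintype ι] [Fintype κ] [DecidableEq ι] [DecidableEq κ]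
    [Fintype α] [Nonempty α] [Fintype β] [Nonempty β] (u : ι → κ → α → γ) (v : ι → κ → β → γ)
    (F : (ι → κ → γ) → ℝ) {ε : ℝ}
    (h : ∀ i (c : ι × κ → γ),
      (∀ j, c j ∈ Set.range (u j.1 j.2) ∪ Set.range (v j.1 j.2)) →
      |𝔼 a, F (fun i' j' => Function.update c i (u i.1 i.2 a) (i', j'))
        - 𝔼 b, F (fun i' j' => Function.update c i (v i.1 i.2 b) (i', j'))| ≤ ε) :
    |𝔼 a : ι → κ → α, F (fun i j => u i j (a i j)) - 𝔼 b : ι → κ → β, F (fun i j => v i j (b i j))|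
      ≤ Fintype.card ι * Fintype.card κ * ε := by
  rw [expect_curry, expect_curry]
  have := hybrid (fun i : ι × κ => u i.1 i.2) (fun i : ι × κ => v i.1 i.2)
    (fun c => F fun i j => c (i, j)) h
  simpa using this

theorem expect_comp_eq_sum [Fintype α] [Nonempty α] [Fintype γ] (u : α → γ) (F : γ → ℝ) :
    𝔼 a, F (u a) = ∑ c, (((unif α).map u) c).toReal * F c := by
  classical
  have h : ∀ c, (((unif α).map u) c).toReal
      = ∑ a, if c = u a then (Fintype.card α : ℝ)⁻¹ else 0 := by
    intro c
    rw [PMF.map_apply, tsum_fintype, ENNReal.toReal_sum]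
    · refine Finset.sum_congr rfl fun a _ => ?_
      split_ifs <;> simp
    · intro a _
      split_ifs
      · exact PMF.apply_ne_top _ _
      · simp
  simp only [h, Finset.sum_mul, ite_mul, zero_mul]
  rw [Finset.sum_comm, Fintype.expect_eq_sum_div_card, Finset.sum_div]
  refine Finset.sum_congr rfl fun a _ => ?_
  simp [div_eq_inv_mul]

/-- The triangle inequality with `0 ≤ F ≤ 1` bounds the difference by the full `ℓ¹` distance. The
resulting factor 2 is not sharp, but harmless for negligible bounds. -/
theorem abs_expect_sub_le_statDist [Fintype α] [Nonempty α] [Fintype β] [Nonempty β] [Fintype γ]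
    (u : α → γ) (v : β → γ) {F : γ → ℝ} (hF : ∀ c, F c ∈ Set.Icc (0 : ℝ) 1) :
    |𝔼 a, F (u a) - 𝔼 b, F (v b)| ≤ 2 * statDist ((unif α).map u) ((unif β).map v) := by
  rw [expect_comp_eq_sum, expect_comp_eq_sum, ← Finset.sum_sub_distrib, statDist, ← mul_assoc,
    show (2 : ℝ) * (1 / 2) = 1 by norm_num, one_mul]
  refine (Finset.abs_sum_le_sum_abs _ _).trans (Finset.sum_le_sum fun c _ => ?_)
  rw [← sub_mul, abs_mul, abs_of_nonneg (hF c).1]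
  exact mul_le_of_le_one_right (abs_nonneg _) (hF c).2

theorem sum_range_mul_zmod {d : ℕ} [NeZero d] (F : ZMod d → ℝ) (q : ℕ) :
    ∑ x ∈ Finset.range (d * q), F x = q * ∑ g, F g := by
  have h₁ : ∑ x ∈ Finset.range d, F x = ∑ g, F g := by
    refine Finset.sum_bij' (fun x _ => (x : ZMod d)) (fun g _ => g.val) ?_ ?_ ?_ ?_ ?_
    · simp
    · intro g _; simpa using ZMod.val_lt g
    · intro x hx; exact ZMod.val_cast_of_lt (by simpa using hx)
    · intro g _; simp
    · simp
  induction q with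
  | zero => simp
  | succ q ih =>
    rw [mul_add, mul_one, Finset.sum_range_add, ih]
    simp only [Nat.cast_add, Nat.cast_mul, CharP.cast_eq_zero, zero_mul, zero_add, h₁]
    push_cast; ring

/-- The reduction of a uniform number below `N` is almost uniform. -/
theorem abs_expect_fin_sub_le {d N : ℕ} [NeZero d] [NeZero N] {F : ZMod d → ℝ}
    (hF : ∀ g, F g ∈ Set.Icc (0 : ℝ) 1) :
    |𝔼 x : Fin N, F ((x : ℕ) : ZMod d) - 𝔼 g, F g| ≤ d / N := by
  have hd : (0 : ℝ) < d := by exact_mod_cast Nat.pos_of_ne_zero (NeZero.ne d)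
  have hN : (0 : ℝ) < N := by exact_mod_cast Nat.pos_of_ne_zero (NeZero.ne N)
  set A := 𝔼 g, F g with hA
  have hA' := expect_mem_Icc hF
  rw [← hA] at hA'
  have hsum : ∑ g, F g = d * A := by
    rw [hA, Fintype.expect_eq_sum_div_card, ZMod.card]; field_simp
  set r := N % d
  set q := N / d
  -- The first `d * q` numbers hit every residue exactly `q` times. Only the `r < d` remaining ones
  -- deviate from the mean, each by at most 1.
  have hNr : N = d * q + r := (Nat.div_add_mod N d).symm
  set E := ∑ x ∈ Finset.range r, F ((d * q + x : ℕ) : ZMod d)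
  have hE₀ : 0 ≤ E := Finset.sum_nonneg fun x _ => (hF _).1
  have hE₁ : E ≤ r := by
    simpa using Finset.sum_le_card_nsmul (Finset.range r) _ 1 fun x _ => (hF _).2
  have h₁ : ∑ x : Fin N, F ((x : ℕ) : ZMod d) = q * (d * A) + E := by
    rw [Fin.sum_univ_eq_sum_range (fun x => F (x : ZMod d)) N, hNr, Finset.sum_range_add,
      sum_range_mul_zmod, hsum]
  have hrd : (r : ℝ) ≤ d := by exact_mod_cast (Nat.mod_lt N (Nat.pos_of_ne_zero (NeZero.ne d))).le
  have hNr' : (N : ℝ) = d * q + r := by exact_mod_cast hNr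
  have h₂ : 𝔼 x : Fin N, F ((x : ℕ) : ZMod d) - A = (E - r * A) / N := by
    rw [Fintype.expect_eq_sum_div_card, Fintype.card_fin, h₁]
    field_simp
    rw [hNr']; ring
  rw [h₂, abs_div, abs_of_pos hN]
  gcongr
  have hr : (0 : ℝ) ≤ r := by positivity
  rw [abs_le]
  constructor <;> nlinarith [hA'.1, hA'.2]

end Average

section Negligible

theorem Negligible.mono {f g : ℕ → ℝ} (hg : Negligible g) (h : ∀ n, |f n| ≤ |g n|) :
    Negligible f := Asymptotics.SuperpolynomialDecay.trans_abs_le hg h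

theorem Negligible.add {f g : ℕ → ℝ} (hf : Negligible f) (hg : Negligible g) :
    Negligible fun n => f n + g n := Asymptotics.SuperpolynomialDecay.add hf hg

theorem Negligible.const_mul {f : ℕ → ℝ} (hf : Negligible f) (c : ℝ) :
    Negligible fun n => c * f n := Asymptotics.SuperpolynomialDecay.const_mul hf c

theorem Negligible.polyBounded_mul {f : ℕ → ℝ} (hf : Negligible f) {p : ℕ → ℕ}
    (hp : PolyBounded p) : Negligible fun n => p n * f n := by
  obtain ⟨P, hP⟩ := hp
  have h : Negligible fun n => (P.map (Nat.castRingHom ℝ)).eval (n : ℝ) * f n :=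
    Asymptotics.SuperpolynomialDecay.polynomial_mul hf _
  refine h.mono fun n => ?_
  rw [abs_mul, abs_mul]
  gcongr
  rw [Polynomial.eval_natCast_map]
  simpa using hP n

theorem negligible_inv_two_pow : Negligible fun n => ((2 : ℝ) ^ n)⁻¹ := by
  intro p
  have := tendsto_pow_const_mul_const_pow_of_abs_lt_one p (r := (1 / 2 : ℝ)) (by norm_num [abs_lt])
  simpa using this

/-- A bound that is negligible along every sequence of choices is uniform. -/
theorem exists_negligible_bound {X : ℕ → Type} [∀ n, Nonempty (X n)] {f : ∀ n, X n → ℝ}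
    (h₀ : ∀ n x, 0 ≤ f n x) (h₁ : ∀ n x, f n x ≤ 1)
    (h : ∀ x : ∀ n, X n, Negligible fun n => f n (x n)) :
    ∃ ν : ℕ → ℝ, Negligible ν ∧ ∀ n x, f n x ≤ ν n := by
  have hb : ∀ n, BddAbove (Set.range (f n)) := fun n => ⟨1, by rintro _ ⟨x, rfl⟩; exact h₁ n x⟩
  -- The supremum need not be attained, but a choice reaching half of it always exists; the
  -- hypothesis is applied along these choices.
  have hx : ∀ n, ∃ x, ⨆ y, f n y ≤ 2 * f n x := by
    intro n
    by_cases hs : ⨆ y, f n y ≤ 0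
    · obtain ⟨x⟩ := (inferInstance : Nonempty (X n))
      exact ⟨x, by linarith [h₀ n x]⟩
    · obtain ⟨x, hx⟩ := exists_lt_of_lt_ciSup (show (⨆ y, f n y) / 2 < ⨆ y, f n y by linarith)
      exact ⟨x, by linarith⟩
  choose x hx using hx
  refine ⟨fun n => ⨆ y, f n y, ?_, fun n y => le_ciSup (hb n) y⟩
  refine ((h x).const_mul 2).mono fun n => ?_
  have : 0 ≤ ⨆ y, f n y := (h₀ n (x n)).trans (le_ciSup (hb n) _)
  rw [abs_of_nonneg this]
  exact (hx n).trans (le_abs_self _)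

end Negligible

/-! Correctness of the protocol. -/

namespace MatrixMul

variable {H : HEScheme} {k m b : ℕ → ℕ} {R : PIRScheme (fun n => m n * k n) H.ctLen}

/-- `loc` enumerates the nonzero locations without repetition, and the remaining terms vanish. This
is why skipping the zeros of `Y` still gives the full product. -/
theorem sum_loc {m b : ℕ} (Y : Matrix (Fin m) (Fin m) (BInt b)) {A : Type} [AddCommMonoid A]
    (f : Fin m × Fin m → A) (hf : ∀ p, (Y p.1 p.2).1 = 0 → f p = 0) :
    ∑ s, f (loc Y s) = ∑ p, f p := by
  have h₁ : ∑ s, f (loc Y s) = ∑ p ∈ locations Y, f (finProdFinEquiv.symm p) := by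
    rw [← Finset.sum_coe_sort (locations Y)]
    exact Fintype.sum_equiv ((locations Y).orderIsoOfFin rfl).toEquiv _ _ fun s => rfl
  rw [h₁, Finset.sum_subset (Finset.subset_univ _)]
  · exact Fintype.sum_equiv finProdFinEquiv.symm _ _ fun s => rfl
  · intro p _ hp
    refine hf _ ?_
    simpa [locations] using hp

theorem sum_loc_eq_mul {k m b : ℕ} (X : Matrix (Fin k) (Fin m) (BInt b))
    (Y : Matrix (Fin m) (Fin m) (BInt b)) (M : ℕ+) (i : Fin k) (j : Fin m) :
    (∑ s, if (loc Y s).2 = j then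
      residues M X i (loc Y s).1 * residues M Y (loc Y s).1 (loc Y s).2 else 0)
      = (residues M X * residues M Y) i j := by
  rw [sum_loc Y (fun p => if p.2 = j then residues M X i p.1 * residues M Y p.1 p.2 else 0),
    Fintype.sum_prod_type, Matrix.mul_apply]
  · simp
  · intro p hp
    simp [residues, hp]

section Run

variable {n : ℕ} (X : Matrix (Fin (k n)) (Fin (m n)) (BInt (b n)))
  (Y : Matrix (Fin (m n)) (Fin (m n)) (BInt (b n)))
  (w : Bits (H.genLen n)) (T₀ : Tape0 H k m R n (nnz Y)) (T₁ : Tape1 H k m R n (nnz Y) (H.pk w))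

theorem retrieved_eq (hR : R.Correct) (s : Fin (nnz Y)) (i : Fin (k n)) :
    retrieved X Y w T₀ T₁ s i = H.enc n (H.pk w)
      (residues (H.modulus n (H.pk w)) X i (loc Y s).1) (T₀.encCoins i (loc Y s).1) := by
  rw [retrieved, responses, queries, hR]
  simp [database, dbIndex]

/-- The accumulator stays in the image of `enc` throughout, with unspecified coins. Membership in
this image is what `add_fresh` and decryption require; the distribution of the coins is irrelevant.
-/
theorem exists_foldl_eq_enc (hH : H.Homomorphic) {ι : Type} (l : List ι) (p : ι → Prop)
    [DecidablePred p] (x y : ι → H.Pt n (H.pk w)) (r : ι → Bits (H.encLen n)) (z : H.Pt n (H.pk w))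
    (u : Bits (H.encLen n)) :
    ∃ u', l.foldl (fun acc s => if p s then
        H.add n (H.pk w) (H.smul n (H.pk w) (H.enc n (H.pk w) (x s) (r s)) (y s)) acc else acc)
        (H.enc n (H.pk w) z u)
      = H.enc n (H.pk w) (z + (l.map fun s => if p s then x s * y s else 0).sum) u' := by
  induction l generalizing z u with
  | nil => exact ⟨u, by simp⟩
  | cons s l ih =>
    rw [List.foldl_cons, List.map_cons, List.sum_cons]
    by_cases hs : p s
    · obtain ⟨v, hv⟩ := hH.smul_eq n w (x s) (y s) (r s)
      obtain ⟨v', hv'⟩ := hH.add_eq n w (x s * y s) z v u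
      rw [if_pos hs, if_pos hs, hv, hv', ← add_assoc, add_comm z]
      exact ih _ _
    · rw [if_neg hs, if_neg hs, zero_add]
      exact ih _ _

theorem exists_innerProduct_eq (hH : H.Homomorphic) (hR : R.Correct) (i : Fin (k n))
    (j : Fin (m n)) : ∃ u, innerProduct X Y w T₀ T₁ i j = H.enc n (H.pk w)
      ((residues (H.modulus n (H.pk w)) X * residues (H.modulus n (H.pk w)) Y) i j) u := by
  obtain ⟨u, hu⟩ := exists_foldl_eq_enc w hH (List.finRange (nnz Y)) (fun s => (loc Y s).2 = j)
    (fun s => residues (H.modulus n (H.pk w)) X i (loc Y s).1)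
    (fun s => residues (H.modulus n (H.pk w)) Y (loc Y s).1 (loc Y s).2)
    (fun s => T₀.encCoins i (loc Y s).1) 0 (T₁.zeroCoins i j)
  refine ⟨u, ?_⟩
  unfold innerProduct
  simp only [retrieved_eq X Y w T₀ T₁ hR, hu]
  rw [zero_add, ← sum_loc_eq_mul, ← List.ofFn_eq_map, List.sum_ofFn]

/-- The identity holds pointwise in all coins, so both outputs are functions of the inputs and the
masks alone and survive every later exchange of messages. -/
theorem out0_eq (hH : H.Homomorphic) (hc : H.Correct) (hR : R.Correct) :
    out0 X Y w T₀ T₁ = residues (H.modulus n (H.pk w)) X * residues (H.modulus n (H.pk w)) Y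
      + Matrix.of T₁.mask := by
  ext i j
  obtain ⟨u, hu⟩ := exists_innerProduct_eq X Y w T₀ T₁ hH hR i j
  obtain ⟨v, hv⟩ := hH.add_eq n w (T₁.mask i j) _ (T₁.maskCoins i j) u
  rw [out0, masked, hu, hv, hc, Matrix.add_apply, Matrix.of_apply, add_comm]

end Run

end MatrixMul

/-! Random strings as tuples of coins. -/

/-- A string of length `a * l` as `a` strings of length `l`. -/
def splitVec (a l : ℕ) : Bits (a * l) ≃ (Fin a → Bits l) :=
  (Equiv.arrowCongr finProdFinEquiv.symm (Equiv.refl Bool)).trans (Equiv.curry _ _ _)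

theorem encVec_splitVec {a l : ℕ} (c : Bits (a * l)) :
    encVec (fun i => encBits (splitVec a l c i)) = encBits c := by
  rw [encVec, encBits, List.ofFn_mul]
  congr 2
  funext i
  rw [encBits]
  congr 1
  funext j
  simp only [splitVec, Equiv.trans_apply, Equiv.curry_apply, Function.curry, Equiv.arrowCongr_apply,
    Function.comp, Equiv.refl_apply, Equiv.symm_symm]
  congr 1
  ext
  simp [finProdFinEquiv]
  ring

/-- A string of length `a * (b * l)` as an `a × b` matrix of strings of length `l`. -/
def splitMat (a b l : ℕ) : Bits (a * (b * l)) ≃ (Fin a → Fin b → Bits l) :=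
  (splitVec a (b * l)).trans (Equiv.arrowCongr (Equiv.refl _) (splitVec b l))

theorem encMat_splitMat {a b l : ℕ} (c : Bits (a * (b * l))) :
    encMat (fun i j => encBits (splitMat a b l c i j)) = encBits c := by
  rw [← encVec_splitVec c, encMat]
  congr 1
  funext i
  exact encVec_splitVec (splitVec a (b * l) c i)

/-- A string of length `a + b` as two strings. -/
def splitAdd (a b : ℕ) : Bits (a + b) ≃ Bits a × Bits b := (Fin.appendEquiv a b).symm

theorem encBits_splitAdd {a b : ℕ} (c : Bits (a + b)) :
    encBits (splitAdd a b c).1 ++ encBits (splitAdd a b c).2 = encBits c := by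
  rw [encBits, encBits, encBits, ← List.ofFn_fin_append]
  congr 1
  exact (Fin.appendEquiv a b).apply_symm_apply c

/-- Truncation or padding with `false`. -/
def resize {a : ℕ} (c : ℕ) (x : Bits a) : Bits c := fun j => if h : j < a then x ⟨j, h⟩ else false

theorem resize_self {a : ℕ} (x : Bits a) : resize a x = x := by
  funext j; simp [resize]

section

theorem expect_prod {α β : Type} [Fintype α] [Fintype β] (f : α × β → ℝ) :
    𝔼 p, f p = 𝔼 a, 𝔼 b, f (a, b) :=
  Finset.expect_product Finset.univ Finset.univ f

theorem expect_comp_equiv {α β : Type} [Fintype α] [Fintype β] (e : α ≃ β) (f : β → ℝ) :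
    𝔼 a, f (e a) = 𝔼 b, f b := Fintype.expect_equiv e _ _ fun _ => rfl

end

/-- Moves a common average outermost, so that it can be fixed while the outer averages over
different coin spaces are compared. -/
theorem abs_expect_comm_sub_le {α β γ : Type} [Fintype α] [Fintype β] [Fintype γ] [Nonempty γ]
    {f : α → γ → ℝ} {g : β → γ → ℝ} {ε : ℝ} (h : ∀ c, |𝔼 a, f a c - 𝔼 b, g b c| ≤ ε) :
    |𝔼 a, 𝔼 c, f a c - 𝔼 b, 𝔼 c, g b c| ≤ ε := by
  rw [Finset.expect_comm, Finset.expect_comm (f := g)]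
  exact abs_expect_sub_le h

theorem bitsOf_const_subset {α : Type} {S : Set (α → Bool)} (h₀ : (fun _ => false) ∈ S)
    (h₁ : (fun _ => true) ∈ S) (x : List Bool) : bitsOf (fun _ => x) ⊆ S := by
  rintro _ ⟨i, rfl⟩
  simp only
  cases x.getD i false <;> assumption

theorem bitsOf_append_subset_of {α : Type} {S : Set (α → Bool)} {f g : α → List Bool} (l : ℕ)
    (hl : ∀ a, (f a).length = l) (hf : bitsOf f ⊆ S) (hg : bitsOf g ⊆ S) :
    bitsOf (fun a => f a ++ g a) ⊆ S :=
  (bitsOf_append_subset hl).trans (Set.union_subset hf hg)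

theorem length_encPt {H : HEScheme} {n : ℕ} {pk : Bits (H.pkLen n)} (x : H.Pt n pk) :
    (H.encPt x).length = H.ptLen n := length_encNat _ _

/-! ### Corrupted party 0: transcripts and single-query distinguishers. -/

namespace MatrixMul

variable {H : HEScheme} {k m b : ℕ → ℕ} {R : PIRScheme (fun n => m n * k n) H.ctLen}

theorem length_encShare {n : ℕ} {pk : Bits (H.pkLen n)}
    (Z : Matrix (Fin (k n)) (Fin (m n)) (H.Pt n pk)) :
    (encShare Z).length = k n * (m n * H.ptLen n) :=
  length_encMat fun _ _ => length_encPt _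

variable (H k m R) in
/-- The length of a view of party 0. -/
def view0Len (n t : ℕ) : ℕ :=
  k n * (m n * H.encLen n) + t * (k n * R.respCoinLen n) + t * (k n * R.queryLen n)
    + k n * (m n * H.ctLen n)

theorem length_encode0 {n t : ℕ} (v : View0 H k m R n t) : v.encode.length = view0Len H k m R n t := by
  simp only [View0.encode, List.length_append, view0Len]
  rw [length_encMat fun _ _ => length_encBits _, length_encMat fun _ _ => length_encBits _,
    length_encMat fun _ _ => length_encBits _, length_encMat fun _ _ => length_encBits _]

theorem bitsOf_encShare_subset {α : Type} {S : Set (α → Bool)} (hS : (fun _ => false) ∈ S) {n : ℕ}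
    {pk : α → Bits (H.pkLen n)} {Z : ∀ x, Matrix (Fin (k n)) (Fin (m n)) (H.Pt n (pk x))}
    (h : ∀ i j, bitsOf (fun x => H.encPt (Z x i j)) ⊆ S) :
    bitsOf (fun x => encShare (Z x)) ⊆ S :=
  bitsOf_encMat_subset hS (fun _ _ _ => length_encPt _) h

theorem bitsOf_encode0_subset {α : Type} {S : Set (α → Bool)} (hS : (fun _ => false) ∈ S) {n t : ℕ}
    {v : α → View0 H k m R n t}
    (h₁ : ∀ i j, bitsOf (fun x => encBits ((v x).tape.encCoins i j)) ⊆ S)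
    (h₂ : ∀ i j, bitsOf (fun x => encBits ((v x).tape.respCoins i j)) ⊆ S)
    (h₃ : ∀ i j, bitsOf (fun x => encBits ((v x).queries i j)) ⊆ S)
    (h₄ : ∀ i j, bitsOf (fun x => encBits ((v x).masked i j)) ⊆ S) :
    bitsOf (fun x => (v x).encode) ⊆ S := by
  unfold View0.encode
  refine bitsOf_append_subset_of (k n * (m n * H.encLen n) + t * (k n * R.respCoinLen n)
    + t * (k n * R.queryLen n)) (fun x => ?_) (bitsOf_append_subset_of
      (k n * (m n * H.encLen n) + t * (k n * R.respCoinLen n)) (fun x => ?_)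
      (bitsOf_append_subset_of (k n * (m n * H.encLen n)) (fun x => ?_) ?_ ?_) ?_) ?_
  · rw [List.length_append, List.length_append, length_encMat fun _ _ => length_encBits _,
      length_encMat fun _ _ => length_encBits _, length_encMat fun _ _ => length_encBits _]
  · rw [List.length_append, length_encMat fun _ _ => length_encBits _,
      length_encMat fun _ _ => length_encBits _]
  · rw [length_encMat fun _ _ => length_encBits _]
  · exact bitsOf_encMat_subset hS (fun _ _ _ => length_encBits _) h₁
  · exact bitsOf_encMat_subset hS (fun _ _ _ => length_encBits _) h₂
  · exact bitsOf_encMat_subset hS (fun _ _ _ => length_encBits _) h₃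
  · exact bitsOf_encMat_subset hS (fun _ _ _ => length_encBits _) h₄

/-- What a distinguisher sees if party 0 is corrupted. -/
def transcript0 {n t : ℕ} (w : Bits (H.genLen n)) (v : View0 H k m R n t)
    (Z₀ Z₁ : Matrix (Fin (k n)) (Fin (m n)) (H.Pt n (H.pk w))) : List Bool :=
  encBits w ++ v.encode ++ encShare Z₀ ++ encShare Z₁

/-- A distinguisher for transcripts gives a distinguisher for a single query. -/
theorem exists_query_distinguisher (D : Circuit) {n t : ℕ} (w : Bits (H.genLen n))
    (T : Tape0 H k m R n t) (q : Fin t × Fin (k n) → Bits (R.queryLen n))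
    (M : Fin (k n) → Fin (m n) → Bits (H.ctLen n))
    (Z₀ Z₁ : Matrix (Fin (k n)) (Fin (m n)) (H.Pt n (H.pk w))) (p : Fin t × Fin (k n)) :
    ∃ D' : Circuit, D'.size ≤ D.size + 3 ∧ ∀ x : Bits (R.queryLen n), D'.accepts (encBits x)
      = D.accepts (transcript0 w ⟨T, fun s i => Function.update q p x (s, i), M⟩ Z₀ Z₁) := by
  set S : Set (Bits (R.queryLen n) → Bool) := bitsOf fun x => encBits x
  have hS : (fun _ => false) ∈ S := false_mem_bitsOf fun _ => length_encBits _
  have hS' : (fun _ => false) ∈ S ∪ {fun _ => true} := .inl hS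
  have hconst := bitsOf_const_subset hS' (.inr rfl)
  -- Everything but the one query is constant. A single gate for `true` supplies all constant bits,
  -- so the size grows by that gate and the overhead 2 of the conversion to a circuit.
  have h := (Computes.const hS true).trans (D.computes_accepts (f := fun x =>
    transcript0 w ⟨T, fun s i => Function.update q p x (s, i), M⟩ Z₀ Z₁)
    (l := H.genLen n + view0Len H k m R n t + k n * (m n * H.ptLen n) + k n * (m n * H.ptLen n))
    (S := S ∪ {fun _ => true}) (fun x => by
      simp only [transcript0, List.length_append, length_encBits, length_encode0, length_encShare])
    (by
      unfold transcript0
      refine bitsOf_append_subset_of (H.genLen n + view0Len H k m R n t + k n * (m n * H.ptLen n))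
        (fun x => by
          simp only [List.length_append, length_encBits, length_encode0, length_encShare])
        (bitsOf_append_subset_of (H.genLen n + view0Len H k m R n t) (fun x => by
          simp only [List.length_append, length_encBits, length_encode0])
          (bitsOf_append_subset_of (H.genLen n) (fun x => by
            simp only [length_encBits]) (hconst _) ?_) (hconst _)) (hconst _)
      refine bitsOf_encode0_subset hS' (fun i j => hconst (encBits (T.encCoins i j)))
        (fun i j => hconst (encBits (T.respCoins i j))) (fun s i => ?_)
        fun i j => hconst (encBits (M i j))
      by_cases hp : (s, i) = p
      · simp only [hp, Function.update_self]
        exact Set.subset_union_left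
      · simp only [Function.update_of_ne hp]
        exact hconst _))
  obtain ⟨D', hD, hD'⟩ := Circuit.exists_accepts_of_computes (fun x => length_encBits x) h
  exact ⟨D', by omega, hD'⟩

/-! ### The simulator for party 0. -/

section Sim

variable (H k m b R)

/-- The number of coins of the simulated queries. -/
def simQueryLen (n : ℕ) : ℕ := if 0 < m n * k n then R.queryCoinLen n else 0

/-- The query for the first record, if there is one. -/
def simQuery (n : ℕ) (c : Bits (simQueryLen H k m R n)) : Bits (R.queryLen n) :=
  if h : 0 < m n * k n then R.query n ⟨0, h⟩ (resize (R.queryCoinLen n) c) else fun _ => false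

/-- The number of coins of the simulator for party 0. -/
abbrev simCoinLen0 (n t : ℕ) : ℕ :=
  k n * (m n * H.encLen n) + (t * (k n * R.respCoinLen n) +
    (t * (k n * simQueryLen H k m R n) + k n * (m n * H.encLen n)))

/-- The coins of the simulator for party 0: encryption coins, response coins, query coins, and
coins for encrypting the output share. -/
def simCoins0 (n t : ℕ) : Bits (simCoinLen0 H k m R n t) ≃
    (Fin (k n) → Fin (m n) → Bits (H.encLen n)) × (Fin t → Fin (k n) → Bits (R.respCoinLen n)) ×
    (Fin t → Fin (k n) → Bits (simQueryLen H k m R n)) ×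
    (Fin (k n) → Fin (m n) → Bits (H.encLen n)) :=
  (splitAdd _ _).trans (Equiv.prodCongr (splitMat _ _ _) ((splitAdd _ _).trans
    (Equiv.prodCongr (splitMat _ _ _) ((splitAdd _ _).trans
      (Equiv.prodCongr (splitMat _ _ _) (splitMat _ _ _))))))

/-- The simulator for party 0 queries the first record only, and encrypts party 0's output. -/
def simulator0 : Simulator0 H k m b R where
  coinLen := simCoinLen0 H k m R
  run n t w _ Z c :=
    ⟨⟨(simCoins0 H k m R n t c).1, (simCoins0 H k m R n t c).2.1⟩,
      fun s i => simQuery H k m R n ((simCoins0 H k m R n t c).2.2.1 s i),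
      fun i j => H.enc n (H.pk w) (Z i j) ((simCoins0 H k m R n t c).2.2.2 i j)⟩

end Sim

/-! ### The hybrid argument for party 0. -/

section Bound

variable {n : ℕ} (X : Matrix (Fin (k n)) (Fin (m n)) (BInt (b n)))
  (Y : Matrix (Fin (m n)) (Fin (m n)) (BInt (b n))) (g : List Bool → Bool)

theorem prob_real0 : prob g (real0 R n X Y) = 𝔼 w, 𝔼 e, 𝔼 s, 𝔼 q, 𝔼 z, 𝔼 u, 𝔼 e',
    if g (transcript0 w (view0 X Y w (⟨e, s⟩ : Tape0 H k m R n (nnz Y)) ⟨q, z, u, e'⟩)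
      (out0 X Y w (⟨e, s⟩ : Tape0 H k m R n (nnz Y)) ⟨q, z, u, e'⟩) (-Matrix.of u))
    then 1 else 0 := by
  unfold real0 tape0Dist tape1Dist
  simp only [LawfulMonad.bind_assoc, LawfulMonad.pure_bind, prob_bind_unif, prob_pure]
  rfl

theorem prob_ideal0 : prob g ((simulator0 H k m b R).ideal n X Y) =
    𝔼 w, 𝔼 u : Fin (k n) → Fin (m n) → H.Pt n (H.pk w), 𝔼 e, 𝔼 s,
    𝔼 q : Fin (nnz Y) → Fin (k n) → Bits (simQueryLen H k m R n),
    𝔼 e' : Fin (k n) → Fin (m n) → Bits (H.encLen n),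
    if g (transcript0 w (⟨⟨e, s⟩, fun s i => simQuery H k m R n (q s i), fun i j =>
        H.enc n (H.pk w) ((residues (H.modulus n (H.pk w)) X * residues (H.modulus n (H.pk w)) Y
          + Matrix.of u) i j) (e' i j)⟩ : View0 H k m R n (nnz Y))
      (residues (H.modulus n (H.pk w)) X * residues (H.modulus n (H.pk w)) Y + Matrix.of u)
      (-Matrix.of u)) then 1 else 0 := by
  unfold Simulator0.ideal functionality
  simp only [LawfulMonad.bind_assoc, LawfulMonad.pure_bind, prob_bind_unif, prob_pure]
  refine Finset.expect_congr rfl fun w _ => ?_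
  -- The functionality draws `Z₁`, the protocol the mask `u = -Z₁`; negation preserves the uniform
  -- distribution.
  rw [← expect_comp_equiv (Equiv.neg _)]
  refine Finset.expect_congr rfl fun u _ => ?_
  have := expect_comp_equiv (simCoins0 H k m R n (nnz Y)) fun p =>
    if g (transcript0 w (⟨⟨p.1, p.2.1⟩, fun s i => simQuery H k m R n (p.2.2.1 s i), fun i j =>
        H.enc n (H.pk w) ((residues (H.modulus n (H.pk w)) X * residues (H.modulus n (H.pk w)) Y
          + Matrix.of u) i j) (p.2.2.2 i j)⟩ : View0 H k m R n (nnz Y))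
      (residues (H.modulus n (H.pk w)) X * residues (H.modulus n (H.pk w)) Y + Matrix.of u)
      (-Matrix.of u)) then (1 : ℝ) else 0
  rw [expect_prod] at this
  simp only [expect_prod] at this
  rw [← this]
  refine Finset.expect_congr rfl fun c _ => ?_
  have e : residues (H.modulus n (H.pk w)) X * residues (H.modulus n (H.pk w)) Y
      - Matrix.of (-u) = residues (H.modulus n (H.pk w)) X * residues (H.modulus n (H.pk w)) Y
      + Matrix.of u := by
    ext i j; simp
  rw [Equiv.neg_apply, e]
  rfl

/-- Two hybrid arguments: the `k * m` masked ciphertexts become fresh encryptions of the output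
share, each costing `2 * ν₁` statistically; then the `nnz Y * k` queries become queries for the
first record, each costing `ν₂`. -/
theorem advantage_party0_le (hH : H.Homomorphic) (hc : H.Correct) (hR : R.Correct) (D : Circuit)
    {ν₁ ν₂ : ℝ}
    (h₁ : ∀ (w : Bits (H.genLen n)) (x y : H.Pt n (H.pk w)) (s : Bits (H.encLen n)),
      statDist
        ((H.encDist n (H.pk w) x).map fun c => H.add n (H.pk w) c (H.enc n (H.pk w) y s))
        (H.encDist n (H.pk w) (x + y)) ≤ ν₁)
    (h₂ : ∀ D' : Circuit, D'.size ≤ D.size + 3 → ∀ i j,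
      advantage D' (R.queryDist n i) (R.queryDist n j) ≤ ν₂) :
    advantage D (real0 R n X Y) ((simulator0 H k m b R).ideal n X Y)
      ≤ k n * m n * (2 * ν₁) + nnz Y * k n * ν₂ := by
  let P (w : Bits (H.genLen n)) := residues (H.modulus n (H.pk w)) X *
    residues (H.modulus n (H.pk w)) Y
  let f (w : Bits (H.genLen n)) (e : Fin (k n) → Fin (m n) → Bits (H.encLen n))
      (s : Fin (nnz Y) → Fin (k n) → Bits (R.respCoinLen n))
      (Q : Fin (nnz Y) → Fin (k n) → Bits (R.queryLen n))
      (u : Fin (k n) → Fin (m n) → H.Pt n (H.pk w))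
      (M : Fin (k n) → Fin (m n) → Bits (H.ctLen n)) : ℝ :=
    if D.accepts (transcript0 w (⟨⟨e, s⟩, Q, M⟩ : View0 H k m R n (nnz Y)) (P w + Matrix.of u)
      (-Matrix.of u)) then 1 else 0
  -- The middle experiment has real queries and simulated ciphertexts. The average over the coins
  -- `_z` is idle and only keeps the shape of the real experiment.
  let mid := 𝔼 w, 𝔼 e, 𝔼 s, 𝔼 q : Fin (nnz Y) → Fin (k n) → Bits (R.queryCoinLen n),
    𝔼 _z : Fin (k n) → Fin (m n) → Bits (H.encLen n), 𝔼 u,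
    𝔼 e' : Fin (k n) → Fin (m n) → Bits (H.encLen n),
    f w e s (fun s i => R.query n (dbIndex i (loc Y s).1) (q s i)) u
      (fun i j => H.enc n (H.pk w) (u i j + P w i j) (e' i j))
  have step₁ : |prob D.accepts (real0 R n X Y) - mid| ≤ k n * m n * (2 * ν₁) := by
    rw [prob_real0]
    refine abs_expect_sub_le fun w => abs_expect_sub_le fun e => abs_expect_sub_le fun s =>
      abs_expect_sub_le fun q => abs_expect_sub_le fun z => abs_expect_sub_le fun u => ?_
    simp only [out0_eq X Y w _ _ hH hc hR]
    -- The inner products do not involve the coins of the mask encryptions, so a dummy value can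
    -- stand for these coins and each inner product is fixed while they vary.
    have h := hybrid_matrix
      (fun i j a => H.add n (H.pk w) (H.enc n (H.pk w) (u i j) a)
        (innerProduct X Y w (⟨e, s⟩ : Tape0 H k m R n (nnz Y)) ⟨q, z, u, fun _ _ _ => false⟩ i j))
      (fun i j a => H.enc n (H.pk w) (u i j + P w i j) a)
      (f w e s (fun s i => R.query n (dbIndex i (loc Y s).1) (q s i)) u) (ε := 2 * ν₁)
      (fun p c _ => by
        obtain ⟨r, hr⟩ := exists_innerProduct_eq X Y w (⟨e, s⟩ : Tape0 H k m R n (nnz Y))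
          ⟨q, z, u, fun _ _ _ => false⟩ hH hR p.1 p.2
        rw [hr]
        refine (abs_expect_sub_le_statDist _ _ (F := fun x => f w e s _ u
          fun i' j' => Function.update c p x (i', j')) fun x => ite_mem_Icc _).trans ?_
        have := h₁ w (u p.1 p.2) (P w p.1 p.2) r
        rw [HEScheme.encDist, PMF.map_comp] at this
        exact mul_le_mul_of_nonneg_left this zero_le_two)
    rw [Fintype.card_fin, Fintype.card_fin] at h
    exact h
  have step₂ : |mid - prob D.accepts ((simulator0 H k m b R).ideal n X Y)|
      ≤ nnz Y * k n * ν₂ := by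
    have e : prob D.accepts ((simulator0 H k m b R).ideal n X Y)
        = 𝔼 w, 𝔼 e, 𝔼 s, 𝔼 q : Fin (nnz Y) → Fin (k n) → Bits (simQueryLen H k m R n),
          𝔼 _z : Fin (k n) → Fin (m n) → Bits (H.encLen n), 𝔼 u,
          𝔼 e' : Fin (k n) → Fin (m n) → Bits (H.encLen n),
          f w e s (fun s i => simQuery H k m R n (q s i)) u
            (fun i j => H.enc n (H.pk w) (u i j + P w i j) (e' i j)) := by
      rw [prob_ideal0]
      refine Finset.expect_congr rfl fun w _ => ?_
      rw [Finset.expect_comm]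
      refine Finset.expect_congr rfl fun e _ => ?_
      rw [Finset.expect_comm]
      refine Finset.expect_congr rfl fun s _ => ?_
      rw [Finset.expect_comm]
      refine Finset.expect_congr rfl fun q _ => ?_
      rw [Fintype.expect_const]
      refine Finset.expect_congr rfl fun u _ => Finset.expect_congr rfl fun e' _ => ?_
      simp only [f, P, Matrix.add_apply, Matrix.of_apply, add_comm]
    rw [e]
    refine abs_expect_sub_le fun w => abs_expect_sub_le fun e => abs_expect_sub_le fun s => ?_
    refine abs_expect_comm_sub_le fun z => abs_expect_comm_sub_le fun u =>
      abs_expect_comm_sub_le fun e' => ?_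
    have h := hybrid_matrix (fun s i a => R.query n (dbIndex i (loc Y s).1) a)
      (fun (_ : Fin (nnz Y)) (_ : Fin (k n)) a => simQuery H k m R n a)
      (fun Q => f w e s Q u (fun i j => H.enc n (H.pk w) (u i j + P w i j) (e' i j))) (ε := ν₂)
      (fun p c _ => by
        -- A query to be exchanged exists, so the database is nonempty and the default branch of
        -- `simQuery` is not taken.
        have hN : 0 < m n * k n := (dbIndex p.2 (loc Y p.1).1).pos
        obtain ⟨D', hD, hD'⟩ := exists_query_distinguisher D w (⟨e, s⟩ : Tape0 H k m R n (nnz Y)) c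
          (fun i j => H.enc n (H.pk w) (u i j + P w i j) (e' i j)) (P w + Matrix.of u)
          (-Matrix.of u) p
        have h := h₂ D' hD (dbIndex p.2 (loc Y p.1).1) ⟨0, hN⟩
        simp only [advantage_eq, PIRScheme.queryDist, prob_map, prob_unif, hD'] at h
        convert h using 3
        have hl : simQueryLen H k m R n = R.queryCoinLen n := if_pos hN
        have hq : simQuery H k m R n = fun c => R.query n ⟨0, hN⟩ (resize _ c) := by
          funext c; rw [simQuery, dif_pos hN]
        rw [hq]
        revert hl
        generalize simQueryLen H k m R n = l
        rintro rfl
        simp only [resize_self]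
        rfl)
    rw [Fintype.card_fin, Fintype.card_fin] at h
    exact h
  rw [advantage_eq]
  exact (abs_sub_le _ mid _).trans (add_le_add step₁ step₂)

end Bound

end MatrixMul

/-! ### Polynomial size of the simulator for party 0. -/

theorem bitsOf_splitAdd_fst {α : Type} {a b : ℕ} (c : α → Bits (a + b)) :
    bitsOf (fun x => encBits (splitAdd a b (c x)).1) ⊆ bitsOf fun x => encBits (c x) := by
  simp only [← encBits_splitAdd (c _)]
  exact bitsOf_subset_append_left (fun _ => length_encBits _) fun _ => length_encBits _

theorem bitsOf_splitAdd_snd {α : Type} {a b : ℕ} (c : α → Bits (a + b)) :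
    bitsOf (fun x => encBits (splitAdd a b (c x)).2) ⊆ bitsOf fun x => encBits (c x) := by
  simp only [← encBits_splitAdd (c _)]
  exact bitsOf_subset_append_right fun _ => length_encBits _

theorem bitsOf_splitMat {α : Type} {a b l : ℕ} (c : α → Bits (a * (b * l))) (i : Fin a)
    (j : Fin b) :
    bitsOf (fun x => encBits (splitMat a b l (c x) i j)) ⊆ bitsOf fun x => encBits (c x) := by
  simp only [← encMat_splitMat (c _)]
  exact bitsOf_subset_encMat (f := fun i j x => encBits (splitMat a b l (c x) i j))
    (fun _ _ _ => length_encBits _) i j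

theorem bitsOf_resize_subset {α : Type} {S : Set (α → Bool)} (hS : (fun _ => false) ∈ S) {a : ℕ}
    (c : ℕ) {x : α → Bits a} (hx : bitsOf (fun y => encBits (x y)) ⊆ S) :
    bitsOf (fun y => encBits (resize c (x y))) ⊆ S := by
  refine bitsOf_subset hS (fun _ => length_encBits _) fun i hi => ?_
  by_cases h : i < a
  · convert hx ⟨i, rfl⟩ using 1
    funext y
    simp [encBits, List.getD, hi, h, resize]
  · convert hS using 1
    funext y
    simp [encBits, List.getD, hi, h, resize]

section Lengths

variable {H : HEScheme} (hH : H.Efficient)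

include hH

namespace HEScheme.Efficient

theorem polyBounded_genLen : PolyBounded H.genLen :=
  hH.gen.polyBound_inp fun _ => .inr ⟨fun _ => false, (length_encBits _).ge⟩

theorem polyBounded_enc : PolyBounded fun n => H.pkLen n + H.ptLen n + H.encLen n :=
  hH.enc.polyBound_inp fun _ => .inr ⟨⟨fun _ => false, 0, fun _ => false⟩, by
    simp only [List.length_append, length_encBits, length_encPt, le_refl]⟩

theorem polyBounded_pkLen : PolyBounded H.pkLen :=
  PolyBound.mono hH.polyBounded_enc fun n => by omega

theorem polyBounded_ptLen : PolyBounded H.ptLen :=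
  PolyBound.mono hH.polyBounded_enc fun n => by omega

theorem polyBounded_encLen : PolyBounded H.encLen :=
  PolyBound.mono hH.polyBounded_enc fun n => by omega

theorem polyBounded_ctLen : PolyBounded H.ctLen :=
  hH.enc.polyBound_out fun _ => ⟨⟨fun _ => false, 0, fun _ => false⟩, (length_encBits _).ge⟩

end HEScheme.Efficient

end Lengths

theorem length_encIdx {N : ℕ → ℕ} {n : ℕ} (i : Fin (N n)) :
    (PIRScheme.encIdx (N := N) i).length = Nat.size (N n) := length_encNat _ _

namespace PIRScheme.Efficient

variable {N d : ℕ → ℕ} {R : PIRScheme N d} (hR : R.Efficient)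

include hR

theorem polyBounded_response :
    PolyBounded fun n => N n * d n + R.queryLen n + R.respCoinLen n :=
  hR.response.polyBound_inp fun _ => .inr ⟨⟨fun _ _ => false, fun _ => false, fun _ => false⟩, by
    rw [List.length_append, List.length_append, length_encVec fun _ => length_encBits _,
      length_encBits, length_encBits]⟩

theorem polyBounded_queryLen : PolyBounded R.queryLen :=
  PolyBound.mono hR.polyBounded_response fun n => by omega

theorem polyBounded_respCoinLen : PolyBounded R.respCoinLen :=
  PolyBound.mono hR.polyBounded_response fun n => by omega

theorem polyBounded_respLen : PolyBounded R.respLen :=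
  hR.response.polyBound_out fun _ =>
    ⟨⟨fun _ _ => false, fun _ => false, fun _ => false⟩, (length_encBits _).ge⟩

/-- For an empty database there is no query input, and efficiency puts no bound on the number of
query coins. The simulators therefore use this truncated length. -/
theorem polyBounded_queryCoinLen : PolyBounded fun n => if 0 < N n then R.queryCoinLen n else 0 :=
  hR.query.polyBound_inp fun n => by
    by_cases h : 0 < N n
    · exact .inr ⟨⟨⟨0, h⟩, fun _ => false⟩, by
        rw [if_pos h, List.length_append, length_encBits]; omega⟩
    · exact .inl (if_neg h)

end PIRScheme.Efficient

namespace MatrixMul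

variable {H : HEScheme} {k m b : ℕ → ℕ} {R : PIRScheme (fun n => m n * k n) H.ctLen}

theorem simulator0_efficient (hH : H.Efficient) (hR : R.Efficient) (hk : PolyBounded k)
    (hm : PolyBounded m) (hb : PolyBounded b) : (simulator0 H k m b R).Efficient := by
  have hfst : PolyBound (fun i : ℕ × ℕ => i.1 + i.2) fun i => i.1 :=
    PolyBound.self.mono fun i => by omega
  have ht : PolyBound (fun i : ℕ × ℕ => i.1 + i.2) fun i => i.2 :=
    PolyBound.self.mono fun i => by omega
  have lift {f : ℕ → ℕ} (hf : PolyBounded f) :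
      PolyBound (fun i : ℕ × ℕ => i.1 + i.2) fun i => f i.1 := PolyBound.comp hf hfst
  obtain ⟨cg, hcg, gen⟩ := hH.gen.exists_computes fun n a => length_encBits a
  obtain ⟨ce, hce, enc⟩ := hH.enc.exists_computes (l := fun n => H.pkLen n + H.ptLen n + H.encLen n)
    fun n a => by simp only [List.length_append, length_encBits, length_encPt]
  obtain ⟨cq, hcq, query⟩ := hR.query.exists_computes
    (l := fun n => Nat.size (m n * k n) + R.queryCoinLen n)
    fun n a => by rw [List.length_append, length_encBits, length_encIdx]
  have hcoin : PolyBound (fun i : ℕ × ℕ => i.1 + i.2) fun i => simCoinLen0 H k m R i.1 i.2 :=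
    ((lift hk).mul ((lift hm).mul (lift hH.polyBounded_encLen))).add
      ((ht.mul ((lift hk).mul (lift hR.polyBounded_respCoinLen))).add
      ((ht.mul ((lift hk).mul (lift hR.polyBounded_queryCoinLen))).add
      ((lift hk).mul ((lift hm).mul (lift hH.polyBounded_encLen)))))
  refine PolySize.of_computes
    (l := fun i => H.genLen i.1 + k i.1 * (m i.1 * (b i.1 + 1)) + k i.1 * (m i.1 * H.ptLen i.1)
      + simCoinLen0 H k m R i.1 i.2)
    (l' := fun i => view0Len H k m R i.1 i.2)
    (c := fun i => cg i.1 + (i.2 * k i.1 * (1 + cq i.1) + k i.1 * m i.1 * ce i.1))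
    ?_ (fun _ _ => length_encode0 _) ?_ ?_ ?_ ?_
  · rintro ⟨n, t⟩ a
    have hX : (encMat fun i j => encInt (a.2.1 i j)).length = k n * (m n * (b n + 1)) :=
      length_encMat fun _ _ => length_encInt _
    rw [List.length_append, List.length_append, List.length_append, length_encBits, length_encBits,
      length_encShare, hX]
    rfl
  · exact (((lift hH.polyBounded_genLen).add ((lift hk).mul ((lift hm).mul ((lift hb).add
      (PolyBound.const 1))))).add ((lift hk).mul ((lift hm).mul (lift hH.polyBounded_ptLen)))).add
      hcoin
  · exact ((((lift hk).mul ((lift hm).mul (lift hH.polyBounded_encLen))).add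
      (ht.mul ((lift hk).mul (lift hR.polyBounded_respCoinLen)))).add
      (ht.mul ((lift hk).mul (lift hR.polyBounded_queryLen)))).add
      ((lift hk).mul ((lift hm).mul (lift hH.polyBounded_ctLen)))
  · exact (lift hcg).add (((ht.mul (lift hk)).mul ((PolyBound.const 1).add (lift hcq))).add
      (((lift hk).mul (lift hm)).mul (lift hce)))
  · rintro ⟨n, t⟩
    dsimp only
    set α := Σ w : Bits (H.genLen n), Matrix (Fin (k n)) (Fin (m n)) (BInt (b n)) ×
      Matrix (Fin (k n)) (Fin (m n)) (H.Pt n (H.pk w)) × Bits (simCoinLen0 H k m R n t)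
    set S : Set (α → Bool) := bitsOf fun a : α =>
      encBits a.1 ++ encMat (fun i j => encInt (a.2.1 i j)) ++ encShare a.2.2.1 ++ encBits a.2.2.2
    have hlX : ∀ a : α, (encMat fun i j => encInt (a.2.1 i j)).length = k n * (m n * (b n + 1)) :=
      fun a => length_encMat fun _ _ => length_encInt _
    have hcoins : bitsOf (fun a : α => encBits a.2.2.2) ⊆ S :=
      bitsOf_subset_append_right (l := H.genLen n + k n * (m n * (b n + 1))
        + k n * (m n * H.ptLen n)) fun a => by
        rw [List.length_append, List.length_append, length_encBits, hlX, length_encShare]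
    have hS : (fun _ => false) ∈ S := hcoins (false_mem_bitsOf fun _ => length_encBits _)
    have hw : bitsOf (fun a : α => encBits a.1) ⊆ S :=
      ((bitsOf_subset_append_left (fun _ => length_encBits _) hlX).trans
      (bitsOf_subset_append_left (l := H.genLen n + k n * (m n * (b n + 1)))
        (fun a => by rw [List.length_append, length_encBits, hlX])
        fun a => length_encShare a.2.2.1)).trans
      (bitsOf_subset_append_left (l := H.genLen n + k n * (m n * (b n + 1))
        + k n * (m n * H.ptLen n)) (fun a => by
        rw [List.length_append, List.length_append, length_encBits, hlX, length_encShare])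
        fun _ => length_encBits _)
    have hZ : ∀ i j, bitsOf (fun a : α => H.encPt (a.2.2.1 i j)) ⊆ S := fun i j =>
      ((bitsOf_subset_encMat (f := fun i j (a : α) => H.encPt (a.2.2.1 i j))
        (fun _ _ _ => length_encPt _) i j).trans
      (bitsOf_subset_append_right (l := H.genLen n + k n * (m n * (b n + 1))) fun a => by
        rw [List.length_append, length_encBits, hlX])).trans
      (bitsOf_subset_append_left (l := H.genLen n + k n * (m n * (b n + 1))
        + k n * (m n * H.ptLen n)) (fun a => by
        rw [List.length_append, List.length_append, length_encBits, hlX, ← length_encShare a.2.2.1]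
        rfl)
        fun _ => length_encBits _)
    -- Key generation is rerun once on the given coins to recover the public key; all encryptions
    -- share its wires.
    have h₁ := gen n (fun a : α => a.1) hw
    refine h₁.trans ?_
    set S₁ := S ∪ bitsOf fun a : α => encBits (H.pk a.1) ++ encBits (H.sk a.1)
    have hS₁ : S ⊆ S₁ := Set.subset_union_left
    have hpk : bitsOf (fun a : α => encBits (H.pk a.1)) ⊆ S₁ :=
      (bitsOf_subset_append_left (fun _ => length_encBits _) fun _ => length_encBits _).trans
        Set.subset_union_right
    have c₁ : ∀ i j, bitsOf (fun a : α => encBits ((simCoins0 H k m R n t a.2.2.2).1 i j)) ⊆ S :=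
      fun i j => ((bitsOf_splitMat _ i j).trans (bitsOf_splitAdd_fst _)).trans hcoins
    have c₂ : ∀ i j, bitsOf (fun a : α => encBits ((simCoins0 H k m R n t a.2.2.2).2.1 i j)) ⊆ S :=
      fun i j => (((bitsOf_splitMat _ i j).trans (bitsOf_splitAdd_fst _)).trans
        (bitsOf_splitAdd_snd _)).trans hcoins
    have c₃ : ∀ i j, bitsOf (fun a : α => encBits ((simCoins0 H k m R n t a.2.2.2).2.2.1 i j))
        ⊆ S :=
      fun i j => ((((bitsOf_splitMat _ i j).trans (bitsOf_splitAdd_fst _)).trans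
        (bitsOf_splitAdd_snd _)).trans (bitsOf_splitAdd_snd _)).trans hcoins
    have c₄ : ∀ i j, bitsOf (fun a : α => encBits ((simCoins0 H k m R n t a.2.2.2).2.2.2 i j))
        ⊆ S :=
      fun i j => ((((bitsOf_splitMat _ i j).trans (bitsOf_splitAdd_snd _)).trans
        (bitsOf_splitAdd_snd _)).trans (bitsOf_splitAdd_snd _)).trans hcoins
    have hM : ∀ p : Fin (k n) × Fin (m n), Computes S₁ (ce n) (bitsOf fun a : α =>
        encBits (H.enc n (H.pk a.1) (a.2.2.1 p.1 p.2)
          ((simCoins0 H k m R n t a.2.2.2).2.2.2 p.1 p.2))) := fun p =>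
      enc n (fun a : α => ⟨H.pk a.1, a.2.2.1 p.1 p.2, (simCoins0 H k m R n t a.2.2.2).2.2.2 p.1 p.2⟩)
        (bitsOf_append_subset_of (H.pkLen n + H.ptLen n) (fun a => by
          rw [List.length_append, length_encBits, length_encPt])
          (bitsOf_append_subset_of (H.pkLen n) (fun a => length_encBits _) hpk
            ((hZ p.1 p.2).trans hS₁)) ((c₄ p.1 p.2).trans hS₁))
    have hQ : ∀ p : Fin t × Fin (k n), Computes S₁ (1 + cq n) (bitsOf fun a : α =>
        encBits (simQuery H k m R n ((simCoins0 H k m R n t a.2.2.2).2.2.1 p.1 p.2))) := fun p => by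
      by_cases hN : 0 < m n * k n
      · simp only [simQuery, dif_pos hN]
        refine (Computes.const_bits (hS₁ hS)
          (PIRScheme.encIdx (N := fun n => m n * k n) (⟨0, hN⟩ : Fin (m n * k n)))).trans ?_
        exact query n (fun a : α => (⟨0, hN⟩, resize (R.queryCoinLen n)
          ((simCoins0 H k m R n t a.2.2.2).2.2.1 p.1 p.2))) (bitsOf_append_subset_of _
          (fun _ => length_encIdx _) Set.subset_union_right
          ((bitsOf_resize_subset hS _ (c₃ p.1 p.2)).trans (hS₁.trans Set.subset_union_left)))
      · simp only [simQuery, dif_neg hN]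
        exact (Computes.const_bits (hS₁ hS) _).mono (by omega)
    have h := ((Computes.iUnion hQ).union (Computes.iUnion hM)).union
      (Computes.of_subset (s := 0) hS₁)
    simp only [Fintype.card_prod, Fintype.card_fin, add_zero] at h
    refine h.mono_right (bitsOf_encode0_subset (.inr hS) (fun i j => ?_) (fun i j => ?_)
      (fun i j => ?_) fun i j => ?_)
    · exact (c₁ i j).trans Set.subset_union_right
    · exact (c₂ i j).trans Set.subset_union_right
    · refine Set.Subset.trans ?_ (Set.subset_union_left.trans Set.subset_union_left)
      exact Set.subset_iUnion_of_subset (i, j) le_rfl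
    · refine Set.Subset.trans ?_ (Set.subset_union_right.trans Set.subset_union_left)
      exact Set.subset_iUnion_of_subset (i, j) le_rfl

theorem exists_secure_simulator0 (hH_eff : H.Efficient) (hH_correct : H.Correct)
    (hH_hom : H.Homomorphic) (hk : PolyBounded k) (hm : PolyBounded m) (hb : PolyBounded b)
    (hR_eff : R.Efficient) (hR_correct : R.Correct) (hR_sec : R.Secure) :
    ∃ S : Simulator0 H k m b R, S.Efficient ∧
      ∀ (X : ∀ n, Matrix (Fin (k n)) (Fin (m n)) (BInt (b n)))
        (Y : ∀ n, Matrix (Fin (m n)) (Fin (m n)) (BInt (b n))),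
        Indistinguishable (fun n => real0 R n (X n) (Y n)) (fun n => S.ideal n (X n) (Y n)) := by
  refine ⟨simulator0 H k m b R, simulator0_efficient hH_eff hR_eff hk hm hb, fun X Y D hD => ?_⟩
  obtain ⟨ν₁, hν₁, h₁⟩ := hH_hom.add_fresh
  have : ∀ n, Nonempty {D' : Circuit // D'.size ≤ (D n).size + 3} := fun n => ⟨⟨D n, by omega⟩⟩
  -- PIR security gives a separate bound for each family of circuits, but the reduction meets a
  -- different circuit for each fixed choice of coins. The supremum is taken over all circuits of
  -- the permitted size and all index pairs. `Option` keeps the choice type nonempty if the database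
  -- is empty.
  obtain ⟨ν₂, hν₂, h₂⟩ := exists_negligible_bound
    (X := fun n => {D' : Circuit // D'.size ≤ (D n).size + 3} ×
      Option (Fin (m n * k n) × Fin (m n * k n)))
    (f := fun n x => x.2.elim 0 fun p => advantage x.1 (R.queryDist n p.1) (R.queryDist n p.2))
    (fun n x => by rcases x with ⟨_, _ | p⟩ <;> simp [advantage_nonneg])
    (fun n x => by rcases x with ⟨_, _ | p⟩ <;> simp [advantage_le_one])
    (fun x => by
      obtain ⟨ν, hν, h⟩ := hR_sec (fun n => (x n).1.1)
        (PolyBound.mono (PolyBound.add hD (PolyBound.const 3)) fun n => (x n).1.2)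
      refine hν.mono fun n => ?_
      rcases (x n).2 with _ | p
      · simp
      · exact (abs_of_nonneg (advantage_nonneg _ _ _)).le.trans ((h n p.1 p.2).trans (le_abs_self _)))
  have hnnz : PolyBounded fun n => nnz (Y n) := PolyBound.mono (PolyBound.mul hm hm) fun n => by
    simpa [nnz] using (locations (Y n)).card_le_univ
  refine Negligible.mono (((hν₁.const_mul 2).polyBounded_mul (PolyBound.mul hk hm)).add
    (hν₂.polyBounded_mul (PolyBound.mul hnnz hk))) fun n => ?_
  rw [abs_of_nonneg (advantage_nonneg _ _ _)]
  refine (advantage_party0_le (X n) (Y n) hH_hom hH_correct hR_correct (D n) (h₁ n)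
    fun D' hD' i j => h₂ n (⟨D', hD'⟩, some (i, j))).trans (le_trans (le_of_eq ?_) (le_abs_self _))
  push_cast
  ring

end MatrixMul

/-! Ranks of selected positions by gates. -/

section Rank

variable {α : Type}

/-- The increasing enumeration carries the indices below `s` onto the elements below its `s`-th
value. Thus selection by rank becomes a membership test and a counting test, both suited to gates.
-/
theorem orderEmbOfFin_eq_iff {M t : ℕ} (S : Finset (Fin M)) (h : S.card = t) (s : Fin t)
    (p : Fin M) : S.orderEmbOfFin h s = p ↔ p ∈ S ∧ (S.filter (· < p)).card = s := by
  have key : ∀ s : Fin t, (S.filter (· < S.orderEmbOfFin h s)).card = s := by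
    intro s
    have : S.filter (· < S.orderEmbOfFin h s) = (Finset.Iio s).map (S.orderEmbOfFin h).toEmbedding := by
      ext q
      simp only [Finset.mem_filter, Finset.mem_map, Finset.mem_Iio]
      constructor
      · rintro ⟨hq, hlt⟩
        obtain ⟨r, rfl⟩ : q ∈ Set.range (S.orderEmbOfFin h) := by
          rw [Finset.range_orderEmbOfFin]; exact hq
        exact ⟨r, (S.orderEmbOfFin h).lt_iff_lt.1 hlt, rfl⟩
      · rintro ⟨r, hr, rfl⟩
        exact ⟨Finset.orderEmbOfFin_mem _ _ _, (S.orderEmbOfFin h).lt_iff_lt.2 hr⟩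
    rw [this, Finset.card_map, Fin.card_Iio]
  constructor
  · rintro rfl
    exact ⟨Finset.orderEmbOfFin_mem _ _ _, key s⟩
  · rintro ⟨hp, hc⟩
    obtain ⟨r, rfl⟩ : p ∈ Set.range (S.orderEmbOfFin h) := by
      rw [Finset.range_orderEmbOfFin]; exact hp
    rw [key] at hc
    rw [Fin.ext hc]

/-- The indicators of the numbers of selected positions among the first `i` positions. -/
theorem Computes.count {S : Set (α → Bool)} (hS : (fun _ => false) ∈ S) {f : ℕ → α → Bool} (M t : ℕ)
    (hf : ∀ i < M, f i ∈ S) : Computes S (1 + M * (t * 4))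
      {g | ∃ i ≤ M, ∃ s < t, g = fun a => decide (Nat.count (fun q => f q a = true) i = s)} := by
  induction M with
  | zero =>
    -- Before any position the count is 0, so the indicators are `true` for `s = 0` and `false`
    -- otherwise.
    refine ((Computes.union (Computes.const hS true)
      (Computes.of_subset (s := 0) (le_refl S))).mono (by omega)).mono_right ?_
    rintro _ ⟨i, hi, s, -, rfl⟩
    obtain rfl : i = 0 := by omega
    rcases s with _ | s
    · left; simp
    · right; simpa using hS
  | succ M ih =>
    rw [add_mul, one_mul, ← add_assoc]
    set T := {g : α → Bool | ∃ i ≤ M, ∃ s < t,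
      g = fun a => decide (Nat.count (fun q => f q a = true) i = s)}
    have h₁ : ∀ s : Fin t, Computes (S ∪ T) 4
        {fun a => decide (Nat.count (fun q => f q a = true) (M + 1) = s)} := by
      rintro ⟨s, hs⟩
      have e : (fun a => decide (Nat.count (fun q => f q a = true) (M + 1) = s))
          = fun a => bif f M a then decide (Nat.count (fun q => f q a = true) M + 1 = s)
            else decide (Nat.count (fun q => f q a = true) M = s) := by
        funext a
        rw [Nat.count_succ]
        cases f M a <;> simp
      rw [e]
      -- If position `M` is selected, the previous count must have been `s - 1`, which is impossible
      -- for `s = 0`.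
      refine mux (f := f M) (.inl (hf M (by omega))) ?_ (.inr ⟨M, le_rfl, s, hs, rfl⟩)
      rcases s with _ | s
      · left; simpa using hS
      · right; exact ⟨M, le_rfl, s, by omega, by simp⟩
    have h₂ := (ih fun i hi => hf i (by omega)).trans ((Computes.iUnion h₁).union
      (Computes.of_subset (s := 0) (Set.subset_union_right (s := S) (t := T))))
    rw [Fintype.card_fin, add_zero] at h₂
    refine h₂.mono_right ?_
    rintro _ ⟨i, hi, s, hs, rfl⟩
    rcases Nat.lt_or_ge M i with h | h
    · obtain rfl : i = M + 1 := by omega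
      exact .inl (Set.mem_iUnion.2 ⟨⟨s, hs⟩, rfl⟩)
    · exact .inr ⟨i, h, s, hs, rfl⟩

/-- Table lookup at the `s`-th selected position. -/
theorem Computes.select {S : Set (α → Bool)} (hS : (fun _ => false) ∈ S) {M t : ℕ}
    (L : α → Finset (Fin M)) (hL : ∀ a, (L a).card = t)
    (hf : ∀ p, (fun a => decide (p ∈ L a)) ∈ S) :
    Computes S (1 + M * (t * 4) + M * t * 6) {g | ∃ (s : Fin t) (p : Fin M),
      g = fun a => decide ((L a).orderEmbOfFin (hL a) s = p)} := by
  let f (i : ℕ) (a : α) : Bool := if h : i < M then decide ((⟨i, h⟩ : Fin M) ∈ L a) else false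
  have hcount : ∀ (a : α) (p : Fin M),
      Nat.count (fun q => f q a = true) p = ((L a).filter (· < p)).card := by
    intro a p
    rw [Nat.count_eq_card_filter_range, ← Finset.card_map Fin.valEmbedding]
    congr 1
    ext q
    simp only [Finset.mem_filter, Finset.mem_range, Finset.mem_map, Fin.valEmbedding_apply, f]
    constructor
    · rintro ⟨hq, h⟩
      rw [dif_pos (hq.trans p.2)] at h
      exact ⟨⟨q, hq.trans p.2⟩, ⟨of_decide_eq_true h, hq⟩, rfl⟩
    · rintro ⟨r, ⟨hr, hlt⟩, rfl⟩
      exact ⟨hlt, by simpa using hr⟩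
  have h₁ := Computes.count hS (f := f) M t fun i hi => by
    simp only [f, dif_pos hi]; exact hf _
  refine h₁.trans ?_
  set T := S ∪ {g | ∃ i ≤ M, ∃ s < t,
    g = fun a => decide (Nat.count (fun q => f q a = true) i = s)}
  have h₂ : ∀ x : Fin M × Fin t, Computes T 6
      {fun a => decide ((L a).orderEmbOfFin (hL a) x.2 = x.1)} := by
    intro x
    have := op2 (S := T) (f := fun a => decide (x.1 ∈ L a))
      (g := fun a => decide (Nat.count (fun q => f q a = true) x.1 = x.2)) (.inl hS)
      (.inl (hf x.1)) (.inr ⟨x.1, x.1.2.le, x.2, x.2.2, rfl⟩) and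
    convert this using 3 with a
    rw [hcount, ← Bool.decide_and]
    simp only [orderEmbOfFin_eq_iff]
  have h₃ := Computes.iUnion h₂
  rw [Fintype.card_prod, Fintype.card_fin, Fintype.card_fin] at h₃
  refine h₃.mono_right ?_
  rintro _ ⟨s, p, rfl⟩
  exact Set.mem_iUnion.2 ⟨(p, s), rfl⟩

/-- The index is given in one-hot form, so each output bit is the disjunction of the indicators of
those table rows that have this bit set. -/
theorem Computes.lookup {S : Set (α → Bool)} (hS : (fun _ => false) ∈ S) {M l : ℕ} (j : α → Fin M)
    (hj : ∀ p, (fun a => decide (j a = p)) ∈ S) (x : Fin M → List Bool)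
    (hx : ∀ p, (x p).length = l) : Computes S (l * (M * 6)) (bitsOf fun a => x (j a)) := by
  have h : ∀ i : Fin l, Computes S (M * 6) {fun a => (x (j a)).getD i false} := by
    intro i
    have := Computes.any hS (Finset.univ.filter fun p => (x p).getD i false = true)
      (F := fun p a => decide (j a = p)) fun p _ => hj p
    refine (this.mono (Nat.mul_le_mul_right _ ?_)).mono_right ?_
    · simpa using (Finset.univ.filter fun p => (x p).getD i false = true).card_le_univ
    · rw [Set.singleton_subset_iff, Set.mem_singleton_iff]
      funext a
      simp only [Finset.mem_filter, Finset.mem_univ, true_and, decide_eq_true_eq,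
        exists_eq_right']
      simp
  have h' := (Computes.iUnion h).union (Computes.of_subset (s := 0) (le_refl S))
  rw [Fintype.card_fin, add_zero] at h'
  refine h'.mono_right (bitsOf_subset (.inr hS) (fun a => hx (j a)) fun i hi => ?_)
  exact .inl (Set.mem_iUnion.2 ⟨⟨i, hi⟩, rfl⟩)

/-- A number is nonzero if and only if its magnitude has a set digit; the shift by one skips the
sign bit. -/
theorem decide_ne_zero_eq {b : ℕ} (z : BInt b) :
    decide (z.1 ≠ 0) = decide (∃ i ∈ (Finset.univ : Finset (Fin b)),
      (encInt z).getD (i + 1) false = true) := by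
  rw [decide_eq_decide]
  have e : ∀ i : Fin b, (encInt z).getD (i + 1) false = z.1.natAbs.testBit i := fun i => by
    simp [encInt, encNat, List.getD]
  simp only [e, Finset.mem_univ, true_and]
  constructor
  · intro h
    by_contra hcon
    apply h
    rw [← Int.natAbs_eq_zero]
    refine Nat.eq_of_testBit_eq fun i => ?_
    rw [Nat.zero_testBit]
    by_cases hi : i < b
    · by_contra hne
      exact hcon ⟨⟨i, hi⟩, by simpa using hne⟩
    · exact Nat.testBit_lt_two_pow (z.2.trans_le (Nat.pow_le_pow_right (by omega) (by omega)))
  · rintro ⟨i, hi⟩ h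
    simp [h] at hi

theorem Computes.ne_zero {S : Set (α → Bool)} (hS : (fun _ => false) ∈ S) {b : ℕ} (z : α → BInt b)
    (hz : bitsOf (fun a => encInt (z a)) ⊆ S) :
    Computes S (b * 6) {fun a => decide ((z a).1 ≠ 0)} := by
  simp only [decide_ne_zero_eq]
  simpa using Computes.any hS Finset.univ (F := fun (i : Fin b) a =>
    (encInt (z a)).getD (i + 1) false) fun i _ => hz ⟨i + 1, rfl⟩

end Rank

/-! Computations with plaintexts. -/

namespace HEScheme

variable {α : Type} (H : HEScheme) {n : ℕ} {S : Set (α → Bool)} {pk : α → Bits (H.pkLen n)}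

theorem computes_encPt_neg {x : ∀ a, H.Pt n (pk a)}
    (hd : digits (fun a => (H.modulus n (pk a) : ℕ)) ⊆ S)
    (hx : bitsOf (fun a => H.encPt (x a)) ⊆ S) :
    Computes S (H.ptLen n * 72) (bitsOf fun a => H.encPt (-x a)) := by
  have hx' : ∀ a, (x a).val < H.modulus n (pk a) := fun a => ZMod.val_lt _
  have hS := hd (false_mem_digits fun a => H.modulus_lt n (pk a))
  have h := Computes.neg_mod (fun a => H.modulus_lt n (pk a)) hx'
    ((digits_subset_encNat fun a => (hx' a).trans (H.modulus_lt n (pk a))).trans hx) hd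
  refine (h.union (Computes.of_subset (s := 0) (le_refl S))).mono_right
    (bitsOf_encNat_subset _ (.inr hS) ?_)
  simp only [ZMod.neg_val']
  exact Set.subset_union_left

/-- The number of gates for reducing an integer of `B` bits. -/
def constCost (B n : ℕ) : ℕ := B * ((H.ptLen n + 1) * 36 + 1) + H.ptLen n * 72

/-- The integer is hardwired while the modulus is computed from the key. The absolute value is
reduced first, and a negative sign is handled by one modular negation. -/
theorem computes_encPt_intCast (hd : digits (fun a => (H.modulus n (pk a) : ℕ)) ⊆ S) {B : ℕ} {z : ℤ}
    (hz : z.natAbs < 2 ^ B) :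
    Computes S (H.constCost B n) (bitsOf fun a => H.encPt ((z : ℤ) : H.Pt n (pk a))) := by
  have hS := hd (false_mem_digits fun a => H.modulus_lt n (pk a))
  have h : Computes S (B * ((H.ptLen n + 1) * 36 + 1))
      (bitsOf fun a => H.encPt ((z.natAbs : ℕ) : H.Pt n (pk a))) := by
    have h := Computes.const_mod (fun a => H.modulus_lt n (pk a))
      (fun a => (H.modulus n (pk a)).pos) hd B z.natAbs hz
    refine (h.union (Computes.of_subset (s := 0) (le_refl S))).mono_right
      (bitsOf_encNat_subset _ (.inr hS) ?_)
    simp only [ZMod.val_natCast]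
    exact Set.subset_union_left
  rcases Int.natAbs_eq z with hz | hz
  · rw [hz]
    simpa using h.mono (r := H.constCost B n) (Nat.le_add_right _ _)
  · rw [hz]
    simp only [Int.cast_neg, Int.cast_natCast]
    exact h.trans (H.computes_encPt_neg (hd.trans Set.subset_union_left) Set.subset_union_right)

theorem Efficient.exists_computes_modulus (hH : H.Efficient) : ∃ c : ℕ → ℕ, PolyBounded c ∧
    ∀ (n : ℕ) {β : Type} {S : Set (β → Bool)} (pk : β → Bits (H.pkLen n)),
      bitsOf (fun x => encBits (pk x)) ⊆ S →
      Computes S (c n) (digits fun a => (H.modulus n (pk a) : ℕ)) := by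
  obtain ⟨c, hc, h⟩ := hH.modulus.exists_computes fun n a => length_encBits a
  exact ⟨c, hc, fun n β S pk hpk => (h n pk hpk).mono_right
    (digits_subset_encNat fun a => H.modulus_lt n (pk a))⟩

/-- A family of integer constants is a family of plaintexts that are chosen in polynomial size. -/
theorem Efficient.polySize_intCast (hH : H.Efficient) {b : ℕ → ℕ} (hb : PolyBounded b)
    (z : ∀ n, BInt (b n)) : PolySize (id : ℕ → ℕ) (α := fun n => Bits (H.pkLen n))
      (fun _ p => encBits p) (fun n p => H.encPt ((z n).1 : H.Pt n p)) := by
  obtain ⟨c, hc, h⟩ := Efficient.exists_computes_modulus H hH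
  refine PolySize.of_computes (fun n a => length_encBits a) (fun n a => length_encPt _)
    hH.polyBounded_pkLen hH.polyBounded_ptLen (c := fun n => c n + H.constCost (b n) n) ?_ fun n => ?_
  · exact PolyBound.add hc ((PolyBound.mul hb (((PolyBound.add hH.polyBounded_ptLen
      (PolyBound.const 1)).mul (PolyBound.const 36)).add (PolyBound.const 1))).add
      (PolyBound.mul hH.polyBounded_ptLen (PolyBound.const 72)))
  · exact (h n (fun p => p) le_rfl).trans
      (H.computes_encPt_intCast (pk := fun p => p) Set.subset_union_right (z n).2)

end HEScheme

/-! ### Corrupted party 1: reduction to semantic security. -/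

namespace MatrixMul

variable {H : HEScheme} {k m b : ℕ → ℕ} {R : PIRScheme (fun n => m n * k n) H.ctLen}

variable (H k m R) in
/-- The length of a view of party 1. -/
def view1Len (n t : ℕ) : ℕ :=
  t * (k n * R.queryCoinLen n) + k n * (m n * H.encLen n) + k n * (m n * H.ptLen n)
    + k n * (m n * H.encLen n) + t * (k n * R.respLen n)

theorem length_encode1 {n t : ℕ} {pk : Bits (H.pkLen n)} (v : View1 H k m R n t pk) :
    v.encode.length = view1Len H k m R n t := by
  simp only [View1.encode, List.length_append, view1Len]
  rw [length_encMat fun _ _ => length_encBits _, length_encMat fun _ _ => length_encBits _,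
    length_encMat fun _ _ => length_encPt _, length_encMat fun _ _ => length_encBits _,
    length_encMat fun _ _ => length_encBits _]

theorem bitsOf_encode1_subset {α : Type} {S : Set (α → Bool)} (hS : (fun _ => false) ∈ S) {n t : ℕ}
    {pk : α → Bits (H.pkLen n)} {v : ∀ x, View1 H k m R n t (pk x)}
    (h₁ : ∀ i j, bitsOf (fun x => encBits ((v x).tape.queryCoins i j)) ⊆ S)
    (h₂ : ∀ i j, bitsOf (fun x => encBits ((v x).tape.zeroCoins i j)) ⊆ S)
    (h₃ : ∀ i j, bitsOf (fun x => H.encPt ((v x).tape.mask i j)) ⊆ S)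
    (h₄ : ∀ i j, bitsOf (fun x => encBits ((v x).tape.maskCoins i j)) ⊆ S)
    (h₅ : ∀ i j, bitsOf (fun x => encBits ((v x).responses i j)) ⊆ S) :
    bitsOf (fun x => (v x).encode) ⊆ S := by
  unfold View1.encode
  refine bitsOf_append_subset_of (t * (k n * R.queryCoinLen n) + k n * (m n * H.encLen n)
    + k n * (m n * H.ptLen n) + k n * (m n * H.encLen n)) (fun x => ?_) (bitsOf_append_subset_of
      (t * (k n * R.queryCoinLen n) + k n * (m n * H.encLen n) + k n * (m n * H.ptLen n))
      (fun x => ?_) (bitsOf_append_subset_of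
      (t * (k n * R.queryCoinLen n) + k n * (m n * H.encLen n)) (fun x => ?_)
      (bitsOf_append_subset_of (t * (k n * R.queryCoinLen n)) (fun x => ?_) ?_ ?_) ?_) ?_) ?_
  · rw [List.length_append, List.length_append, List.length_append,
      length_encMat fun _ _ => length_encBits _, length_encMat fun _ _ => length_encBits _,
      length_encMat fun _ _ => length_encPt _, length_encMat fun _ _ => length_encBits _]
  · rw [List.length_append, List.length_append, length_encMat fun _ _ => length_encBits _,
      length_encMat fun _ _ => length_encBits _, length_encMat fun _ _ => length_encPt _]
  · rw [List.length_append, length_encMat fun _ _ => length_encBits _,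
      length_encMat fun _ _ => length_encBits _]
  · rw [length_encMat fun _ _ => length_encBits _]
  · exact bitsOf_encMat_subset hS (fun _ _ _ => length_encBits _) h₁
  · exact bitsOf_encMat_subset hS (fun _ _ _ => length_encBits _) h₂
  · exact bitsOf_encMat_subset hS (fun _ _ _ => length_encPt _) h₃
  · exact bitsOf_encMat_subset hS (fun _ _ _ => length_encBits _) h₄
  · exact bitsOf_encMat_subset hS (fun _ _ _ => length_encBits _) h₅

/-- The encryption of a matrix, entry by entry. -/
def encAll {n : ℕ} (pk : Bits (H.pkLen n)) (x : Matrix (Fin (k n)) (Fin (m n)) (H.Pt n pk))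
    (e : Fin (k n) → Fin (m n) → Bits (H.encLen n)) : Fin (k n) → Fin (m n) → Bits (H.ctLen n) :=
  fun i j => H.enc n pk (x i j) (e i j)

variable (H k m R) in
/-- The coins other than masks and database encryptions that enter the view of party 1: response
coins, query coins, coins for the encryptions of zero and of the masks. -/
abbrev Coins1 (n t : ℕ) : Type :=
  (Fin t → Fin (k n) → Bits (R.respCoinLen n)) × (Fin t → Fin (k n) → Bits (R.queryCoinLen n)) ×
    (Fin (k n) → Fin (m n) → Bits (H.encLen n)) × (Fin (k n) → Fin (m n) → Bits (H.encLen n))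

/-- The view of party 1 if the database consists of the ciphertexts `C` and the `s`-th query is for
the entries with column index `row s`. -/
def view1Of {n t : ℕ} (pk : Bits (H.pkLen n)) (row : Fin t → Fin (m n))
    (C : Fin (k n) → Fin (m n) → Bits (H.ctLen n)) (c : Coins1 H k m R n t)
    (u : Fin (k n) → Fin (m n) → H.Pt n pk) : View1 H k m R n t pk :=
  ⟨⟨c.2.1, c.2.2.1, u, c.2.2.2⟩, fun s i => R.response n
    (fun idx => C (finProdFinEquiv.symm idx).2 (finProdFinEquiv.symm idx).1)
    (R.query n (dbIndex i (row s)) (c.2.1 s i)) (c.1 s i)⟩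

/-- What a distinguisher sees if party 1 is corrupted. -/
def transcript1 {n t : ℕ} (pk : Bits (H.pkLen n)) (row : Fin t → Fin (m n))
    (C : Fin (k n) → Fin (m n) → Bits (H.ctLen n)) (c : Coins1 H k m R n t)
    (P : Matrix (Fin (k n)) (Fin (m n)) (H.Pt n pk)) (u : Fin (k n) → Fin (m n) → H.Pt n pk) :
    List Bool :=
  encBits pk ++ (view1Of pk row C c u).encode ++ encShare (P + Matrix.of u) ++
    encShare (-Matrix.of u)

theorem length_transcript1 {n t : ℕ} (pk : Bits (H.pkLen n)) (row : Fin t → Fin (m n))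
    (C : Fin (k n) → Fin (m n) → Bits (H.ctLen n)) (c : Coins1 H k m R n t)
    (P : Matrix (Fin (k n)) (Fin (m n)) (H.Pt n pk)) (u : Fin (k n) → Fin (m n) → H.Pt n pk) :
    (transcript1 pk row C c P u).length = H.pkLen n + view1Len H k m R n t
      + k n * (m n * H.ptLen n) + k n * (m n * H.ptLen n) := by
  simp only [transcript1, List.length_append, length_encBits, length_encode1, length_encShare]

theorem bitsOf_transcript1_subset {α : Type} {S : Set (α → Bool)} (hS : (fun _ => false) ∈ S)
    {n t : ℕ} {pk : α → Bits (H.pkLen n)} {row : Fin t → Fin (m n)}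
    {C : α → Fin (k n) → Fin (m n) → Bits (H.ctLen n)} {c : Coins1 H k m R n t}
    {P : ∀ x, Matrix (Fin (k n)) (Fin (m n)) (H.Pt n (pk x))}
    {u : ∀ x, Fin (k n) → Fin (m n) → H.Pt n (pk x)}
    (h₀ : bitsOf (fun x => encBits (pk x)) ⊆ S)
    (h₁ : bitsOf (fun x => (view1Of (pk x) row (C x) c (u x)).encode) ⊆ S)
    (h₂ : ∀ i j, bitsOf (fun x => H.encPt ((P x + Matrix.of (u x)) i j)) ⊆ S)
    (h₃ : ∀ i j, bitsOf (fun x => H.encPt ((-Matrix.of (u x)) i j)) ⊆ S) :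
    bitsOf (fun x => transcript1 (pk x) row (C x) c (P x) (u x)) ⊆ S := by
  unfold transcript1
  refine bitsOf_append_subset_of (H.pkLen n + view1Len H k m R n t + k n * (m n * H.ptLen n))
    (fun x => ?_) (bitsOf_append_subset_of (H.pkLen n + view1Len H k m R n t) (fun x => ?_)
      (bitsOf_append_subset_of (H.pkLen n) (fun x => length_encBits _) h₀ h₁)
      (bitsOf_encShare_subset hS h₂)) (bitsOf_encShare_subset hS h₃)
  · simp only [List.length_append, length_encBits, length_encode1, length_encShare]
  · simp only [List.length_append, length_encBits, length_encode1]

/-- The sum of products is at most `m * 2 ^ (2 * b) ≤ 2 ^ (m + 2 * b)`, crudely using `m < 2 ^ m`.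
The final `+ 1` in the exponent absorbs the addition of `u`. -/
theorem natAbs_lt_two_pow {m b L : ℕ} (x y : Fin m → BInt b) {u : ℕ} (hu : u < 2 ^ L) :
    ((∑ a, (x a).1 * (y a).1) + u : ℤ).natAbs < 2 ^ (m + (b + b) + L + 1) := by
  have h₁ : (∑ a, (x a).1 * (y a).1).natAbs ≤ m * (2 ^ b * 2 ^ b) := by
    refine (Int.natAbs_sum_le _ _).trans ?_
    have := Finset.sum_le_card_nsmul (Finset.univ : Finset (Fin m))
      (fun a => ((x a).1 * (y a).1).natAbs) (2 ^ b * 2 ^ b) fun a _ => by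
        rw [Int.natAbs_mul]
        exact Nat.mul_le_mul (x a).2.le (y a).2.le
    simpa using this
  have h₂ : m * (2 ^ b * 2 ^ b) ≤ 2 ^ (m + (b + b)) := by
    rw [pow_add, pow_add]
    exact Nat.mul_le_mul_right _ Nat.lt_two_pow_self.le
  have h₃ := Int.natAbs_add_le (∑ a, (x a).1 * (y a).1) u
  rw [Int.natAbs_natCast] at h₃
  have h₄ : 2 ^ (m + (b + b)) ≤ 2 ^ (m + (b + b) + L) := Nat.pow_le_pow_right (by omega) (by omega)
  have h₅ : 2 ^ L ≤ 2 ^ (m + (b + b) + L) := Nat.pow_le_pow_right (by omega) (by omega)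
  rw [pow_succ]
  omega

variable (H m b) in
/-- A bound for the bit lengths of the integers in the reduction to semantic security. -/
def intLen (n : ℕ) : ℕ := m n + (b n + b n) + (H.ptLen n + n) + 1

variable (H k m b) in
/-- The number of gates of the reduction to semantic security. -/
def reductionCost (cm ce cr : ℕ → ℕ) (n t : ℕ) : ℕ :=
  1 + cm n + (k n * m n * (H.constCost (intLen H m b n) n + ce n) +
    (k n * m n * H.constCost (intLen H m b n) n + k n * m n * H.constCost (intLen H m b n) n
      + k n * m n * H.constCost (intLen H m b n) n)) + t * k n * cr n + 2

/-- A distinguisher for transcripts gives a distinguisher for a single encryption. -/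
theorem exists_enc_distinguisher {n t : ℕ} {cm ce cr : ℕ → ℕ}
    (modulus : ∀ {β : Type} {S : Set (β → Bool)} (pk : β → Bits (H.pkLen n)),
      bitsOf (fun x => encBits (pk x)) ⊆ S →
      Computes S (cm n) (digits fun a => (H.modulus n (pk a) : ℕ)))
    (enc : ∀ {β : Type} {S : Set (β → Bool)} (e : β → Σ p : Bits (H.pkLen n),
      H.Pt n p × Bits (H.encLen n)),
      bitsOf (fun x => encBits (e x).1 ++ H.encPt (e x).2.1 ++ encBits (e x).2.2) ⊆ S →
      Computes S (ce n) (bitsOf fun x => encBits (H.enc n (e x).1 (e x).2.1 (e x).2.2)))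
    (response : ∀ {β : Type} {S : Set (β → Bool)} (e : β → (Fin (m n * k n) → Bits (H.ctLen n)) ×
      Bits (R.queryLen n) × Bits (R.respCoinLen n)),
      bitsOf (fun x => encVec (fun i => encBits ((e x).1 i)) ++ encBits (e x).2.1 ++
        encBits (e x).2.2) ⊆ S →
      Computes S (cr n) (bitsOf fun x => encBits (R.response n (e x).1 (e x).2.1 (e x).2.2)))
    (D : Circuit) (X : Matrix (Fin (k n)) (Fin (m n)) (BInt (b n)))
    (Y : Matrix (Fin (m n)) (Fin (m n)) (BInt (b n))) (row : Fin t → Fin (m n))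
    (c : Coins1 H k m R n t) (U : Fin (k n) → Fin (m n) → Fin (2 ^ (H.ptLen n + n)))
    (x : Fin (k n) × Fin (m n) → BInt (b n)) (r : Fin (k n) × Fin (m n) → Bits (H.encLen n))
    (p : Fin (k n) × Fin (m n)) :
    ∃ D' : Circuit, D'.size ≤ D.size + reductionCost H k m b cm ce cr n t ∧
      ∀ (pk : Bits (H.pkLen n)) (ct : Bits (H.ctLen n)), D'.accepts (encBits pk ++ encBits ct)
        = D.accepts (transcript1 pk row (fun i j => Function.update
          (fun q => H.enc n pk ((x q).1 : H.Pt n pk) (r q)) p ct (i, j)) c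
          (residues (H.modulus n pk) X * residues (H.modulus n pk) Y)
          fun i j => ((U i j : ℕ) : H.Pt n pk)) := by
  set α := Bits (H.pkLen n) × Bits (H.ctLen n)
  set B := intLen H m b n with hB
  have hlen : ∀ a : α, (encBits a.1 ++ encBits a.2).length = H.pkLen n + H.ctLen n := fun a => by
    rw [List.length_append, length_encBits, length_encBits]
  set S₀ : Set (α → Bool) := bitsOf fun a : α => encBits a.1 ++ encBits a.2
  have hS₀ : (fun _ => false) ∈ S₀ := false_mem_bitsOf hlen
  have hpk₀ : bitsOf (fun a : α => encBits a.1) ⊆ S₀ :=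
    bitsOf_subset_append_left (fun _ => length_encBits _) fun _ => length_encBits _
  have hct₀ : bitsOf (fun a : α => encBits a.2) ⊆ S₀ :=
    bitsOf_subset_append_right fun _ => length_encBits _
  -- The modulus is computed once from the key; every later plaintext is a hardwired integer reduced
  -- by it.
  have stage₁ := ((Computes.const hS₀ true).union (modulus (fun a : α => a.1) hpk₀)).union
    (Computes.of_subset (s := 0) (le_refl S₀))
  set S₁ := S₀ ∪ ({fun _ => true} ∪ (digits fun a : α => (H.modulus n a.1 : ℕ)) ∪ S₀)
  have hS₁ : S₀ ⊆ S₁ := Set.subset_union_left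
  have hconst : ∀ y, bitsOf (fun _ : α => y) ⊆ S₁ :=
    bitsOf_const_subset (hS₁ hS₀) (.inr (.inl (.inl rfl)))
  have hd : (digits fun a : α => (H.modulus n a.1 : ℕ)) ⊆ S₁ := fun f hf => .inr (.inl (.inr hf))
  have int {z : ℤ} (hz : z.natAbs < 2 ^ B) : Computes S₁ (H.constCost B n)
      (bitsOf fun a : α => H.encPt ((z : ℤ) : H.Pt n a.1)) := H.computes_encPt_intCast hd hz
  let C (a : α) (i : Fin (k n)) (j : Fin (m n)) : Bits (H.ctLen n) := Function.update
    (fun q => H.enc n a.1 ((x q).1 : H.Pt n a.1) (r q)) p a.2 (i, j)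
  have hC : ∀ q : Fin (k n) × Fin (m n), Computes S₁ (H.constCost B n + ce n)
      (bitsOf fun a : α => encBits (C a q.1 q.2)) := by
    intro q
    by_cases hq : q = p
    -- At position `p` the challenge ciphertext is inserted; every other entry is encrypted under
    -- the received key with hardwired plaintext and coins.
    · simp only [C, hq, Function.update_self]
      exact .of_subset (hct₀.trans hS₁)
    · simp only [C, Function.update_of_ne hq]
      refine (int ((x q).2.trans_le (Nat.pow_le_pow_right (by omega)
        (by rw [hB, intLen]; omega)))).trans ?_
      refine enc (fun a : α => ⟨a.1, ((x q).1 : H.Pt n a.1), r q⟩) ?_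
      exact bitsOf_append_subset_of (H.pkLen n + H.ptLen n) (fun a => by
          rw [List.length_append, length_encBits, length_encPt])
          (bitsOf_append_subset_of (H.pkLen n) (fun a => length_encBits _)
            ((hpk₀.trans hS₁).trans Set.subset_union_left) Set.subset_union_right)
          ((hconst (encBits (r q))).trans Set.subset_union_left)
  have hUlt : ∀ i j, ((U i j : ℕ) : ℤ).natAbs < 2 ^ B := fun i j => by
    rw [Int.natAbs_natCast]
    exact (U i j).2.trans_le (Nat.pow_le_pow_right (by omega) (by rw [hB, intLen]; omega))
  have hU : ∀ q : Fin (k n) × Fin (m n), Computes S₁ (H.constCost B n)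
      (bitsOf fun a : α => H.encPt ((U q.1 q.2 : ℕ) : H.Pt n a.1)) := fun q => by
    simpa using int (hUlt q.1 q.2)
  have hnegU : ∀ q : Fin (k n) × Fin (m n), Computes S₁ (H.constCost B n)
      (bitsOf fun a : α => H.encPt ((-Matrix.of fun i j => ((U i j : ℕ) : H.Pt n a.1)) q.1 q.2)) :=
    fun q => by
      have := int (z := -((U q.1 q.2 : ℕ) : ℤ)) (by rw [Int.natAbs_neg]; exact hUlt _ _)
      simpa using this
  have hP : ∀ q : Fin (k n) × Fin (m n), Computes S₁ (H.constCost B n)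
      (bitsOf fun a : α => H.encPt ((residues (H.modulus n a.1) X * residues (H.modulus n a.1) Y
        + Matrix.of fun i j => ((U i j : ℕ) : H.Pt n a.1)) q.1 q.2)) := fun q => by
    -- The entry of `X * Y + U` is formed over the integers outside the circuit, and only its
    -- reduction is computed by gates.
    have := int (natAbs_lt_two_pow (fun a => X q.1 a) (fun a => Y a q.2) (U q.1 q.2).2)
    simpa [Matrix.mul_apply, residues] using this
  have stage₂ := ((Computes.iUnion hC).union (((Computes.iUnion hU).union
    (Computes.iUnion hnegU)).union (Computes.iUnion hP)))
  set T₂ := (⋃ q : Fin (k n) × Fin (m n), bitsOf fun a : α => encBits (C a q.1 q.2)) ∪ _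
  set S₂ := S₁ ∪ T₂
  have hS₂ : S₁ ⊆ S₂ := Set.subset_union_left
  have hC₂ : ∀ i j, bitsOf (fun a : α => encBits (C a i j)) ⊆ S₂ := fun i j =>
    (Set.subset_iUnion (fun q : Fin (k n) × Fin (m n) =>
      bitsOf fun a : α => encBits (C a q.1 q.2)) (i, j)).trans
      (Set.subset_union_left.trans Set.subset_union_right)
  have hresp : ∀ q : Fin t × Fin (k n), Computes S₂ (cr n) (bitsOf fun a : α =>
      encBits (R.response n
        (fun idx => C a (finProdFinEquiv.symm idx).2 (finProdFinEquiv.symm idx).1)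
        (R.query n (dbIndex q.2 (row q.1)) (c.2.1 q.1 q.2)) (c.1 q.1 q.2))) := fun q =>
    response (fun a : α =>
      (fun idx => C a (finProdFinEquiv.symm idx).2 (finProdFinEquiv.symm idx).1,
        R.query n (dbIndex q.2 (row q.1)) (c.2.1 q.1 q.2), c.1 q.1 q.2))
      (bitsOf_append_subset_of (m n * k n * H.ctLen n + R.queryLen n) (fun a => by
          rw [List.length_append, length_encVec fun _ => length_encBits _, length_encBits])
        (bitsOf_append_subset_of (m n * k n * H.ctLen n) (fun a =>
            length_encVec fun _ => length_encBits _)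
          (bitsOf_encVec_subset (hS₂ (hS₁ hS₀)) (fun _ _ => length_encBits _) fun _ => hC₂ _ _)
          ((hconst (encBits (R.query n (dbIndex q.2 (row q.1)) (c.2.1 q.1 q.2)))).trans hS₂))
        ((hconst (encBits (c.1 q.1 q.2))).trans hS₂))
  have stage₃ := Computes.iUnion hresp
  set T₃ := (⋃ q : Fin t × Fin (k n), bitsOf fun a : α => encBits (R.response n
        (fun idx => C a (finProdFinEquiv.symm idx).2 (finProdFinEquiv.symm idx).1)
        (R.query n (dbIndex q.2 (row q.1)) (c.2.1 q.1 q.2)) (c.1 q.1 q.2)))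
  set S₃ := S₂ ∪ T₃
  have hS₃ : S₁ ⊆ S₃ := hS₂.trans Set.subset_union_left
  have hT₂ : T₂ ⊆ S₃ := (Set.subset_union_right (s := S₁)).trans Set.subset_union_left
  have stage₄ := D.computes_accepts (S := S₃)
    (fun a : α => length_transcript1 a.1 row (C a) c
      (residues (H.modulus n a.1) X * residues (H.modulus n a.1) Y)
      fun i j => ((U i j : ℕ) : H.Pt n a.1))
    (bitsOf_transcript1_subset (hS₃ (hS₁ hS₀)) ((hpk₀.trans hS₁).trans hS₃)
      (bitsOf_encode1_subset (hS₃ (hS₁ hS₀))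
        (fun i j => (hconst (encBits (c.2.1 i j))).trans hS₃)
        (fun i j => (hconst (encBits (c.2.2.1 i j))).trans hS₃)
        (fun i j => by
          refine Set.Subset.trans ?_ ((Set.subset_union_left.trans
            (Set.subset_union_left.trans Set.subset_union_right)).trans hT₂)
          exact Set.subset_iUnion_of_subset (i, j) le_rfl)
        (fun i j => (hconst (encBits (c.2.2.2 i j))).trans hS₃)
        (fun i j => by
          refine Set.Subset.trans ?_ (Set.subset_union_right (s := S₂))
          exact Set.subset_iUnion_of_subset (i, j) le_rfl))
      (fun i j => by
        refine Set.Subset.trans ?_ ((Set.subset_union_right.trans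
            Set.subset_union_right).trans hT₂)
        exact Set.subset_iUnion_of_subset (i, j) le_rfl)
      (fun i j => by
        refine Set.Subset.trans ?_ ((Set.subset_union_right.trans
            (Set.subset_union_left.trans Set.subset_union_right)).trans hT₂)
        exact Set.subset_iUnion_of_subset (i, j) le_rfl))
  have h := stage₁.trans (stage₂.trans (stage₃.trans stage₄))
  obtain ⟨D', hD, hD'⟩ := Circuit.exists_accepts_of_computes hlen h
  refine ⟨D', hD.trans ?_, fun pk ct => hD' (pk, ct)⟩
  simp only [Fintype.card_prod, Fintype.card_fin, reductionCost, ← hB]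
  omega

end MatrixMul

theorem HEScheme.prob_cpaDist (H : HEScheme) (M : ∀ n (p : Bits (H.pkLen n)), H.Pt n p) (n : ℕ)
    (g : List Bool → Bool) : prob g (H.cpaDist M n) = 𝔼 w, 𝔼 r,
      if g (encBits (H.pk w) ++ encBits (H.enc n (H.pk w) (M n (H.pk w)) r)) then 1 else 0 := by
  unfold HEScheme.cpaDist HEScheme.encDist
  rw [prob_bind_unif]
  refine Finset.expect_congr rfl fun w _ => ?_
  rw [show ∀ (p : PMF (Bits (H.ctLen n))) (f : Bits (H.ctLen n) → PMF (List Bool)),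
    p >>= f = p.bind f from fun _ _ => rfl, PMF.bind_map]
  exact (prob_bind_unif _ _).trans (Finset.expect_congr rfl fun r _ => prob_pure _ _)

namespace MatrixMul

variable {H : HEScheme} {k m b : ℕ → ℕ} {R : PIRScheme (fun n => m n * k n) H.ctLen}

/-! ### The simulator and the hybrid argument for party 1. -/

section Sim

variable (H k m b R)

/-- The number of coins of the simulator for party 1. -/
abbrev simCoinLen1 (n t : ℕ) : ℕ :=
  k n * (m n * H.encLen n) + (t * (k n * R.respCoinLen n) +
    (t * (k n * simQueryLen H k m R n) + (k n * (m n * H.encLen n) + k n * (m n * H.encLen n))))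

/-- The coins of the simulator for party 1: database coins, response coins, query coins, and coins
for the encryptions of zero and of the masks. -/
def simCoins1 (n t : ℕ) : Bits (simCoinLen1 H k m R n t) ≃
    (Fin (k n) → Fin (m n) → Bits (H.encLen n)) × (Fin t → Fin (k n) → Bits (R.respCoinLen n)) ×
    (Fin t → Fin (k n) → Bits (simQueryLen H k m R n)) ×
    (Fin (k n) → Fin (m n) → Bits (H.encLen n)) × (Fin (k n) → Fin (m n) → Bits (H.encLen n)) :=
  (splitAdd _ _).trans (Equiv.prodCongr (splitMat _ _ _) ((splitAdd _ _).trans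
    (Equiv.prodCongr (splitMat _ _ _) ((splitAdd _ _).trans
      (Equiv.prodCongr (splitMat _ _ _) ((splitAdd _ _).trans
        (Equiv.prodCongr (splitMat _ _ _) (splitMat _ _ _))))))))

variable {H k m R} in
/-- The simulated view of party 1: the database contains encryptions of zero. -/
def simView1 {n t : ℕ} (pk : Bits (H.pkLen n)) (row : Fin t → Fin (m n))
    (Z : Matrix (Fin (k n)) (Fin (m n)) (H.Pt n pk)) (c : Bits (simCoinLen1 H k m R n t)) :
    View1 H k m R n t pk :=
  view1Of pk row (encAll pk 0 (simCoins1 H k m R n t c).1)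
    ((simCoins1 H k m R n t c).2.1,
      fun s i => resize (R.queryCoinLen n) ((simCoins1 H k m R n t c).2.2.1 s i),
      (simCoins1 H k m R n t c).2.2.2.1, (simCoins1 H k m R n t c).2.2.2.2)
    fun i j => -Z i j

/-- The simulator for party 1. -/
def simulator1 : Simulator1 H k m b R where
  coinLen := simCoinLen1 H k m R
  run _ pk Y Z c := simView1 pk (fun s => (loc Y s).1) Z c

end Sim

/-- Either the database is nonempty and both coin lengths agree, or there are no queries at all and
both averages run over a single empty tuple. -/
theorem expect_resize {n t : ℕ} (h : Fin t → Fin (k n) → 0 < m n * k n)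
    (F : (Fin t → Fin (k n) → Bits (R.queryCoinLen n)) → ℝ) :
    𝔼 q : Fin t → Fin (k n) → Bits (simQueryLen H k m R n), F (fun s i => resize _ (q s i))
      = 𝔼 q, F q := by
  by_cases hN : 0 < m n * k n
  · have hl : simQueryLen H k m R n = R.queryCoinLen n := if_pos hN
    revert hl
    generalize simQueryLen H k m R n = l
    rintro rfl
    simp only [resize_self]
  · have : ∀ q q' : Fin t → Fin (k n) → Bits (R.queryCoinLen n), q = q' := fun q q' => by
      funext s i; exact absurd (h s i) hN
    have e₁ : ∀ q, F q = F fun _ _ _ => false := fun q => congrArg F (this _ _)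
    simp only [e₁ (fun s i => resize _ _), e₁, Fintype.expect_const]

section Bound

variable {n : ℕ} (X : Matrix (Fin (k n)) (Fin (m n)) (BInt (b n)))
  (Y : Matrix (Fin (m n)) (Fin (m n)) (BInt (b n)))

/-- The product modulo the plaintext modulus. -/
abbrev prodMod (pk : Bits (H.pkLen n)) : Matrix (Fin (k n)) (Fin (m n)) (H.Pt n pk) :=
  residues (H.modulus n pk) X * residues (H.modulus n pk) Y

theorem prob_real1 (hH : H.Homomorphic) (hc : H.Correct) (hR : R.Correct) (g : List Bool → Bool) :
    prob g (real1 R n X Y) = 𝔼 w, 𝔼 e, 𝔼 c : Coins1 H k m R n (nnz Y), 𝔼 u,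
      if g (transcript1 (H.pk w) (fun s => (loc Y s).1)
        (encAll (H.pk w) (residues (H.modulus n (H.pk w)) X) e) c (prodMod X Y (H.pk w)) u)
      then 1 else 0 := by
  unfold real1 tape0Dist tape1Dist
  simp only [LawfulMonad.bind_assoc, LawfulMonad.pure_bind, prob_bind_unif, prob_pure,
    out0_eq X Y _ _ _ hH hc hR]
  refine Finset.expect_congr rfl fun w _ => Finset.expect_congr rfl fun e _ => ?_
  rw [expect_prod]
  refine Finset.expect_congr rfl fun s _ => ?_
  rw [expect_prod]
  refine Finset.expect_congr rfl fun q _ => ?_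
  rw [expect_prod]
  refine Finset.expect_congr rfl fun z _ => ?_
  rw [Finset.expect_comm]
  rfl

set_option synthInstance.maxSize 1024 in
theorem prob_ideal1 (g : List Bool → Bool) :
    prob g ((simulator1 H k m b R).ideal n X Y)
      = 𝔼 w, 𝔼 e, 𝔼 c : Coins1 H k m R n (nnz Y), 𝔼 u,
      if g (transcript1 (H.pk w) (fun s => (loc Y s).1)
        (encAll (H.pk w) 0 e) c (prodMod X Y (H.pk w)) u) then 1 else 0 := by
  unfold Simulator1.ideal functionality
  simp only [LawfulMonad.bind_assoc, LawfulMonad.pure_bind, prob_bind_unif, prob_pure]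
  refine Finset.expect_congr rfl fun w _ => ?_
  let G (e : Fin (k n) → Fin (m n) → Bits (H.encLen n)) (c : Coins1 H k m R n (nnz Y))
    (u : Fin (k n) → Fin (m n) → H.Pt n (H.pk w)) : ℝ :=
    if g (transcript1 (H.pk w) (fun s => (loc Y s).1)
        (encAll (H.pk w) 0 e) c (prodMod X Y (H.pk w)) u) then 1 else 0
  have e₁ : ∀ u, (𝔼 e, 𝔼 c, G e c u) = 𝔼 c : Bits (simCoinLen1 H k m R n (nnz Y)),
      G (simCoins1 H k m R n (nnz Y) c).1 ((simCoins1 H k m R n (nnz Y) c).2.1,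
        fun s i => resize (R.queryCoinLen n) ((simCoins1 H k m R n (nnz Y) c).2.2.1 s i),
        (simCoins1 H k m R n (nnz Y) c).2.2.2.1, (simCoins1 H k m R n (nnz Y) c).2.2.2.2) u := by
    intro u
    rw [expect_comp_equiv (simCoins1 H k m R n (nnz Y)) fun p =>
      G p.1 (p.2.1, fun s i => resize (R.queryCoinLen n) (p.2.2.1 s i), p.2.2.2.1, p.2.2.2.2) u,
      expect_prod]
    refine Finset.expect_congr rfl fun e _ => ?_
    rw [expect_prod, expect_prod]
    refine Finset.expect_congr rfl fun s _ => ?_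
    rw [expect_prod, expect_prod]
    exact (expect_resize (fun s i => (dbIndex i (loc Y s).1).pos)
      fun q => 𝔼 p : (Fin (k n) → Fin (m n) → Bits (H.encLen n)) ×
        (Fin (k n) → Fin (m n) → Bits (H.encLen n)), G e (s, q, p) u).symm
  have e₂ : 𝔼 e, 𝔼 c, 𝔼 u, G e c u = 𝔼 u, 𝔼 e, 𝔼 c, G e c u := by
    rw [Finset.expect_comm (s := Finset.univ (α := Fin (k n) → Fin (m n) → H.Pt n (H.pk w)))]
    exact Finset.expect_congr rfl fun e _ => Finset.expect_comm _ _ _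
  refine Eq.trans ?_ e₂.symm
  -- As for party 0, the ideal share is `-u`, and the simulator recovers the mask `u` by negating
  -- it.
  rw [← expect_comp_equiv (Equiv.neg _)]
  refine Finset.expect_congr rfl fun u _ => ?_
  rw [e₁]
  refine Finset.expect_congr rfl fun c _ => ?_
  have e₃ : residues (H.modulus n (H.pk w)) X * residues (H.modulus n (H.pk w)) Y
      - Matrix.of (-u) = prodMod X Y (H.pk w) + Matrix.of u := by
    ext i j; simp
  have e₄ : (fun i j => -(Matrix.of (-u) : Matrix _ _ (H.Pt n (H.pk w))) i j) = u := by
    funext i j; simp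
  have e₅ : (simulator1 H k m b R).run n (H.pk w) Y (Matrix.of (-u)) c
      = view1Of (H.pk w) (fun s => (loc Y s).1)
        (encAll (H.pk w) 0 (simCoins1 H k m R n (nnz Y) c).1)
        ((simCoins1 H k m R n (nnz Y) c).2.1,
          fun s i => resize (R.queryCoinLen n) ((simCoins1 H k m R n (nnz Y) c).2.2.1 s i),
          (simCoins1 H k m R n (nnz Y) c).2.2.2.1, (simCoins1 H k m R n (nnz Y) c).2.2.2.2) u :=
    congrArg (view1Of _ _ _ _) e₄
  rw [Equiv.neg_apply, e₃]
  exact congrArg (fun v : View1 H k m R n (nnz Y) (H.pk w) =>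
    if g (encBits (H.pk w) ++ v.encode ++ encShare (prodMod X Y (H.pk w) + Matrix.of u) ++
      encShare (-Matrix.of u)) then (1 : ℝ) else 0) e₅

/-- Almost uniform masks may be used in place of uniform masks. -/
theorem abs_expect_mask_sub_le (pk : Bits (H.pkLen n))
    {F : (Fin (k n) → Fin (m n) → H.Pt n pk) → ℝ} (hF : ∀ u, F u ∈ Set.Icc (0 : ℝ) 1) :
    |𝔼 U : Fin (k n) → Fin (m n) → Fin (2 ^ (H.ptLen n + n)),
      F (fun i j => ((U i j : ℕ) : H.Pt n pk)) - 𝔼 u, F u| ≤ k n * m n * ((2 : ℝ) ^ n)⁻¹ := by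
  have h := hybrid_matrix
    (fun (_ : Fin (k n)) (_ : Fin (m n)) (x : Fin (2 ^ (H.ptLen n + n))) =>
      ((x : ℕ) : H.Pt n pk)) (fun _ _ x => x) F (ε := ((2 : ℝ) ^ n)⁻¹) (fun p c _ => by
        refine (abs_expect_fin_sub_le (F := fun x => F fun i j => Function.update c p x (i, j))
          fun g => hF _).trans ?_
        -- The `n` additional bits of the integer masks leave an error of at most `2 ^ ptLen / 2 ^
        -- (ptLen + n)` per entry.
        have h₁ : ((H.modulus n pk : ℕ) : ℝ) ≤ 2 ^ H.ptLen n := by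
          exact_mod_cast (H.modulus_lt n pk).le
        rw [div_le_iff₀ (by positivity)]
        push_cast
        rw [pow_add, mul_comm ((2 : ℝ) ^ H.ptLen n), ← mul_assoc, inv_mul_cancel₀ (by positivity),
          one_mul]
        exact h₁)
  rw [Fintype.card_fin, Fintype.card_fin] at h
  exact h

/-- Pass from uniform to integer masks, exchange the `k * m` database entries for encryptions of
zero, and pass back to uniform masks. The two changes of masks give the last summand. -/
theorem advantage_party1_le (hH : H.Homomorphic) (hc : H.Correct) (hR : R.Correct) (D : Circuit)
    {ν : ℝ}
    (h : ∀ (c : Coins1 H k m R n (nnz Y)) (U : Fin (k n) → Fin (m n) → Fin (2 ^ (H.ptLen n + n)))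
      (x : Fin (k n) × Fin (m n) → BInt (b n)) (r : Fin (k n) × Fin (m n) → Bits (H.encLen n))
      (p : Fin (k n) × Fin (m n)) (x₀ x₁ : BInt (b n)),
      let f (w : Bits (H.genLen n)) (ct : Bits (H.ctLen n)) : ℝ :=
        if D.accepts (transcript1 (H.pk w) (fun s => (loc Y s).1) (fun i j => Function.update
          (fun q => H.enc n (H.pk w) ((x q).1 : H.Pt n (H.pk w)) (r q)) p ct (i, j)) c
          (prodMod X Y (H.pk w)) fun i j => ((U i j : ℕ) : H.Pt n (H.pk w))) then 1 else 0
      |𝔼 w, 𝔼 a, f w (H.enc n (H.pk w) (x₀.1 : H.Pt n (H.pk w)) a)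
        - 𝔼 w, 𝔼 a, f w (H.enc n (H.pk w) (x₁.1 : H.Pt n (H.pk w)) a)| ≤ ν) :
    advantage D (real1 R n X Y) ((simulator1 H k m b R).ideal n X Y)
      ≤ k n * m n * ν + 2 * (k n * m n * ((2 : ℝ) ^ n)⁻¹) := by
  let G (w : Bits (H.genLen n)) (C : Fin (k n) → Fin (m n) → Bits (H.ctLen n))
      (c : Coins1 H k m R n (nnz Y)) (u : Fin (k n) → Fin (m n) → H.Pt n (H.pk w)) : ℝ :=
    if D.accepts (transcript1 (H.pk w) (fun s => (loc Y s).1) C c (prodMod X Y (H.pk w)) u)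
      then 1 else 0
  let mid (x : ∀ w, Matrix (Fin (k n)) (Fin (m n)) (H.Pt n (H.pk w))) : ℝ :=
    𝔼 w, 𝔼 e, 𝔼 c, 𝔼 U : Fin (k n) → Fin (m n) → Fin (2 ^ (H.ptLen n + n)),
      G w (encAll (H.pk w) (x w) e) c fun i j => ((U i j : ℕ) : H.Pt n (H.pk w))
  have step : ∀ x : ∀ w, Matrix (Fin (k n)) (Fin (m n)) (H.Pt n (H.pk w)),
      |mid x - 𝔼 w, 𝔼 e, 𝔼 c, 𝔼 u, G w (encAll (H.pk w) (x w) e) c u|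
        ≤ k n * m n * ((2 : ℝ) ^ n)⁻¹ := fun x =>
    abs_expect_sub_le fun w => abs_expect_sub_le fun e => abs_expect_sub_le fun c =>
      abs_expect_mask_sub_le (H.pk w) fun u => ite_mem_Icc _
  have step₂ : |mid (fun w => residues (H.modulus n (H.pk w)) X) - mid fun _ => 0|
      ≤ k n * m n * ν := by
    have e : ∀ x, mid x = 𝔼 e : Fin (k n) → Fin (m n) → Bits (H.encLen n), 𝔼 w, 𝔼 c,
        𝔼 U : Fin (k n) → Fin (m n) → Fin (2 ^ (H.ptLen n + n)),
        G w (encAll (H.pk w) (x w) e) c fun i j => ((U i j : ℕ) : H.Pt n (H.pk w)) :=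
      fun x => Finset.expect_comm _ _ _
    rw [e, e]
    have hz : ((0 : ℤ).natAbs) < 2 ^ b n := by simp
    -- Semantic security averages over keys, so the key coins `w` cannot be fixed as the other coins
    -- are. The coordinates of the hybrid are therefore ciphertexts as functions of `w`.
    have hyb := hybrid_matrix
      (fun i j a (w : Bits (H.genLen n)) =>
        H.enc n (H.pk w) (residues (H.modulus n (H.pk w)) X i j) a)
      (fun (_ : Fin (k n)) (_ : Fin (m n)) a (w : Bits (H.genLen n)) => H.enc n (H.pk w) 0 a)
      (fun C => 𝔼 w, 𝔼 c, 𝔼 U : Fin (k n) → Fin (m n) → Fin (2 ^ (H.ptLen n + n)),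
        G w (fun i j => C i j w) c fun i j => ((U i j : ℕ) : H.Pt n (H.pk w))) (ε := ν)
      (fun p C hC => by
        -- The range condition of the hybrid argument is used here: each remaining entry encrypts,
        -- for all keys at once, one bounded integer with one string of coins. It can thus be
        -- hardwired before the key is known.
        have hC' : ∀ q, ∃ (x : BInt (b n)) (r : Bits (H.encLen n)),
            C q = fun w => H.enc n (H.pk w) (x.1 : H.Pt n (H.pk w)) r := by
          intro q
          rcases hC q with ⟨r, hr⟩ | ⟨r, hr⟩
          · exact ⟨X q.1 q.2, r, hr.symm⟩
          · exact ⟨⟨0, hz⟩, r, hr.symm.trans (by simp)⟩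
        choose x r hxr using hC'
        have reorder : ∀ φ : Bits (H.encLen n) → Bits (H.genLen n) → Coins1 H k m R n (nnz Y) →
            (Fin (k n) → Fin (m n) → Fin (2 ^ (H.ptLen n + n))) → ℝ,
            𝔼 a, 𝔼 w, 𝔼 c, 𝔼 U, φ a w c U = 𝔼 c, 𝔼 U, 𝔼 w, 𝔼 a, φ a w c U := by
          intro φ
          rw [Finset.expect_comm]
          have : ∀ w, 𝔼 a, 𝔼 c, 𝔼 U, φ a w c U = 𝔼 c, 𝔼 U, 𝔼 a, φ a w c U := by
            intro w
            rw [Finset.expect_comm]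
            exact Finset.expect_congr rfl fun c _ => Finset.expect_comm _ _ _
          simp only [this]
          rw [Finset.expect_comm]
          exact Finset.expect_congr rfl fun c _ => Finset.expect_comm _ _ _
        rw [reorder, reorder]
        refine abs_expect_sub_le fun c => abs_expect_sub_le fun U => ?_
        have key := h c U x r p (X p.1 p.2) ⟨0, hz⟩
        have hupd : ∀ (y : Bits (H.genLen n) → Bits (H.ctLen n)) (w : Bits (H.genLen n)),
            (fun i j => Function.update C p y (i, j) w) = fun i j => Function.update
              (fun q => H.enc n (H.pk w) ((x q).1 : H.Pt n (H.pk w)) (r q)) p (y w) (i, j) := by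
          intro y w
          funext i j
          by_cases hq : (i, j) = p
          · simp only [hq, Function.update_self]
          · simp only [Function.update_of_ne hq, hxr]
        simp only [hupd]
        simp only [Int.cast_zero] at key
        exact key)
    rw [Fintype.card_fin, Fintype.card_fin] at hyb
    exact hyb
  rw [advantage_eq, prob_real1 X Y hH hc hR, prob_ideal1]
  have h₁ := step fun w => residues (H.modulus n (H.pk w)) X
  have h₂ := step fun _ => 0
  rw [abs_sub_comm] at h₁
  have h₃ := abs_sub_le _ _ _ |>.trans (add_le_add h₁ step₂)
  have h₄ := abs_sub_le _ _ _ |>.trans (add_le_add h₃ h₂)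
  refine h₄.trans (le_of_eq ?_)
  ring

end Bound

end MatrixMul

/-! ### Polynomial size of the simulator for party 1, and its security. -/

namespace MatrixMul

variable {H : HEScheme} {k m b : ℕ → ℕ} {R : PIRScheme (fun n => m n * k n) H.ctLen}

theorem encBits_cast {a c : ℕ} (h : a = c) (x : Bits a) :
    encBits (fun j : Fin c => x (Fin.cast h.symm j)) = encBits x := by
  subst h; rfl

/-- The type of the simulated view depends on `nnz Y`. Encoding removes this dependence and permits
gate counting for a fixed `t`. -/
theorem simulator1_run_encode {n t : ℕ} (pk : Bits (H.pkLen n))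
    (Y : {Y : Matrix (Fin (m n)) (Fin (m n)) (BInt (b n)) // nnz Y = t})
    (Z : Matrix (Fin (k n)) (Fin (m n)) (H.Pt n pk))
    (c : Bits (simCoinLen1 H k m R n (nnz Y.1))) :
    ((simulator1 H k m b R).run n pk Y.1 Z c).encode
      = (simView1 pk (fun s => (loc Y.1 (Fin.cast Y.2.symm s)).1) Z
        (fun j : Fin (simCoinLen1 H k m R n t) => c (Fin.cast (by rw [Y.2]) j))).encode := by
  obtain ⟨Y, rfl⟩ := Y
  rfl

theorem bitsOf_simCoins1_subset {α : Type} {S : Set (α → Bool)} {n t : ℕ}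
    (c : α → Bits (simCoinLen1 H k m R n t)) (hc : bitsOf (fun a => encBits (c a)) ⊆ S) :
    (∀ i j, bitsOf (fun a => encBits ((simCoins1 H k m R n t (c a)).1 i j)) ⊆ S) ∧
    (∀ i j, bitsOf (fun a => encBits ((simCoins1 H k m R n t (c a)).2.1 i j)) ⊆ S) ∧
    (∀ i j, bitsOf (fun a => encBits ((simCoins1 H k m R n t (c a)).2.2.1 i j)) ⊆ S) ∧
    (∀ i j, bitsOf (fun a => encBits ((simCoins1 H k m R n t (c a)).2.2.2.1 i j)) ⊆ S) ∧
    ∀ i j, bitsOf (fun a => encBits ((simCoins1 H k m R n t (c a)).2.2.2.2 i j)) ⊆ S := by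
  have h₁ := (bitsOf_splitAdd_snd c).trans hc
  have h₂ := (bitsOf_splitAdd_snd _).trans h₁
  have h₃ := (bitsOf_splitAdd_snd _).trans h₂
  have h₄ := (bitsOf_splitAdd_snd _).trans h₃
  exact ⟨fun i j => (bitsOf_splitMat _ i j).trans ((bitsOf_splitAdd_fst c).trans hc),
    fun i j => (bitsOf_splitMat _ i j).trans ((bitsOf_splitAdd_fst _).trans h₁),
    fun i j => (bitsOf_splitMat _ i j).trans ((bitsOf_splitAdd_fst _).trans h₂),
    fun i j => (bitsOf_splitMat _ i j).trans ((bitsOf_splitAdd_fst _).trans h₃),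
    fun i j => (bitsOf_splitMat _ i j).trans h₄⟩

/-- The length is expressed by `simQueryLen`, which is polynomially bounded; `queryCoinLen` itself
need not be when the database is empty. -/
theorem length_simulator1_run {n t : ℕ} (pk : Bits (H.pkLen n))
    (Y : {Y : Matrix (Fin (m n)) (Fin (m n)) (BInt (b n)) // nnz Y = t})
    (Z : Matrix (Fin (k n)) (Fin (m n)) (H.Pt n pk))
    (c : Bits (simCoinLen1 H k m R n (nnz Y.1))) :
    ((simulator1 H k m b R).run n pk Y.1 Z c).encode.length
      = t * (k n * simQueryLen H k m R n) + k n * (m n * H.encLen n) + k n * (m n * H.ptLen n)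
        + k n * (m n * H.encLen n) + t * (k n * R.respLen n) := by
  obtain ⟨Y, rfl⟩ := Y
  have : nnz Y * (k n * R.queryCoinLen n) = nnz Y * (k n * simQueryLen H k m R n) := by
    rcases Nat.eq_zero_or_pos (nnz Y) with h | h
    · rw [h, zero_mul, zero_mul]
    rcases Nat.eq_zero_or_pos (k n) with h' | h'
    · rw [h', zero_mul, zero_mul]
    rw [simQueryLen, if_pos (dbIndex ⟨0, h'⟩ (loc Y ⟨0, h⟩).1).pos]
  rw [length_encode1, view1Len, this]

theorem simulator1_efficient (hH : H.Efficient) (hR : R.Efficient) (hk : PolyBounded k)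
    (hm : PolyBounded m) (hb : PolyBounded b) : (simulator1 H k m b R).Efficient := by
  have hfst : PolyBound (fun i : ℕ × ℕ => i.1 + i.2) fun i => i.1 :=
    PolyBound.self.mono fun i => by omega
  have ht : PolyBound (fun i : ℕ × ℕ => i.1 + i.2) fun i => i.2 :=
    PolyBound.self.mono fun i => by omega
  have lift {f : ℕ → ℕ} (hf : PolyBounded f) :
      PolyBound (fun i : ℕ × ℕ => i.1 + i.2) fun i => f i.1 := PolyBound.comp hf hfst
  have cst (c : ℕ) : PolyBound (fun i : ℕ × ℕ => i.1 + i.2) fun _ => c := PolyBound.const c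
  obtain ⟨cm, hcm, modulus⟩ := HEScheme.Efficient.exists_computes_modulus H hH
  obtain ⟨ce, hce, enc⟩ := hH.enc.exists_computes (l := fun n => H.pkLen n + H.ptLen n + H.encLen n)
    fun n a => by simp only [List.length_append, length_encBits, length_encPt]
  obtain ⟨cq, hcq, query⟩ := hR.query.exists_computes
    (l := fun n => Nat.size (m n * k n) + R.queryCoinLen n)
    fun n a => by rw [List.length_append, length_encBits, length_encIdx]
  obtain ⟨cr, hcr, response⟩ := hR.response.exists_computes
    (l := fun n => m n * k n * H.ctLen n + R.queryLen n + R.respCoinLen n)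
    fun n a => by
      rw [List.length_append, List.length_append, length_encVec fun _ => length_encBits _,
        length_encBits, length_encBits]
  have hsize : PolyBounded fun n => Nat.size (m n * k n) :=
    PolyBound.mono (PolyBound.mul hm hk) fun n => Nat.size_le.2 Nat.lt_two_pow_self
  have hcoin : PolyBound (fun i : ℕ × ℕ => i.1 + i.2) fun i => simCoinLen1 H k m R i.1 i.2 :=
    ((lift hk).mul ((lift hm).mul (lift hH.polyBounded_encLen))).add
      ((ht.mul ((lift hk).mul (lift hR.polyBounded_respCoinLen))).add
      ((ht.mul ((lift hk).mul (lift hR.polyBounded_queryCoinLen))).add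
      (((lift hk).mul ((lift hm).mul (lift hH.polyBounded_encLen))).add
      ((lift hk).mul ((lift hm).mul (lift hH.polyBounded_encLen))))))
  refine PolySize.of_computes
    (l := fun i => H.pkLen i.1 + m i.1 * (m i.1 * (b i.1 + 1)) + k i.1 * (m i.1 * H.ptLen i.1)
      + simCoinLen1 H k m R i.1 i.2)
    (l' := fun i => i.2 * (k i.1 * simQueryLen H k m R i.1) + k i.1 * (m i.1 * H.encLen i.1)
      + k i.1 * (m i.1 * H.ptLen i.1) + k i.1 * (m i.1 * H.encLen i.1)
      + i.2 * (k i.1 * R.respLen i.1))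
    (c := fun i => (cm i.1 + m i.1 * m i.1 * (b i.1 * 6)) +
      ((1 + m i.1 * m i.1 * (i.2 * 4) + m i.1 * m i.1 * i.2 * 6) +
      ((i.2 * k i.1 * (Nat.size (m i.1 * k i.1) * (m i.1 * m i.1 * 6) + cq i.1) +
        (k i.1 * m i.1 * (H.ptLen i.1 * 72) + k i.1 * m i.1 * (1 + ce i.1))) +
      i.2 * k i.1 * cr i.1)))
    ?_ ?_ ?_ ?_ ?_ ?_
  · rintro ⟨n, t⟩ ⟨pk, Y, Z, c⟩
    have hlY : (encMat fun i j => encInt (Y.1 i j)).length = m n * (m n * (b n + 1)) :=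
      length_encMat fun _ _ => length_encInt _
    have hlc : (encBits c).length = simCoinLen1 H k m R n t :=
      (length_encBits c).trans (congrArg (simCoinLen1 H k m R n) Y.2)
    dsimp only
    rw [List.length_append, List.length_append, List.length_append, length_encBits, hlc,
      length_encShare, hlY]
  · rintro ⟨n, t⟩ ⟨pk, Y, Z, c⟩
    exact length_simulator1_run pk Y Z c
  · exact (((lift hH.polyBounded_pkLen).add ((lift hm).mul ((lift hm).mul ((lift hb).add
      (PolyBound.const 1))))).add ((lift hk).mul ((lift hm).mul (lift hH.polyBounded_ptLen)))).add
      hcoin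
  · exact ((((ht.mul ((lift hk).mul (lift hR.polyBounded_queryCoinLen))).add
      ((lift hk).mul ((lift hm).mul (lift hH.polyBounded_encLen)))).add
      ((lift hk).mul ((lift hm).mul (lift hH.polyBounded_ptLen)))).add
      ((lift hk).mul ((lift hm).mul (lift hH.polyBounded_encLen)))).add
      (ht.mul ((lift hk).mul (lift hR.polyBounded_respLen)))
  · have hmm := (lift hm).mul (lift hm)
    have htk := ht.mul (lift hk)
    have hkm := (lift hk).mul (lift hm)
    exact ((lift hcm).add (hmm.mul ((lift hb).mul (cst 6)))).add
      ((((cst 1).add (hmm.mul (ht.mul (cst 4)))).add ((hmm.mul ht).mul (cst 6))).add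
      (((htk.mul (((lift hsize).mul (hmm.mul (cst 6))).add (lift hcq))).add
      ((hkm.mul ((lift hH.polyBounded_ptLen).mul (cst 72))).add
      (hkm.mul ((cst 1).add (lift hce))))).add (htk.mul (lift hcr))))
  · rintro ⟨n, t⟩
    dsimp only
    set α := Σ pk : Bits (H.pkLen n),
      Σ Y : {Y : Matrix (Fin (m n)) (Fin (m n)) (BInt (b n)) // nnz Y = t},
        Matrix (Fin (k n)) (Fin (m n)) (H.Pt n pk) × Bits (simCoinLen1 H k m R n (nnz Y.1))
    set S : Set (α → Bool) := bitsOf fun a : α => encBits a.1 ++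
      encMat (fun i j => encInt (a.2.1.1 i j)) ++ encShare a.2.2.1 ++ encBits a.2.2.2
    let row (a : α) (s : Fin t) : Fin (m n) := (loc a.2.1.1 (Fin.cast a.2.1.2.symm s)).1
    let coins (a : α) : Bits (simCoinLen1 H k m R n t) :=
      fun j => a.2.2.2 (Fin.cast (by rw [a.2.1.2]) j)
    have hout : (fun a : α => ((simulator1 H k m b R).run n a.1 a.2.1.1 a.2.2.1 a.2.2.2).encode)
        = fun a => (simView1 a.1 (row a) a.2.2.1 (coins a)).encode :=
      funext fun a => simulator1_run_encode a.1 a.2.1 a.2.2.1 a.2.2.2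
    refine Eq.mpr (congrArg (fun f => Computes S _ (bitsOf f)) hout) ?_
    have hlY : ∀ a : α, (encMat fun i j => encInt (a.2.1.1 i j)).length
        = m n * (m n * (b n + 1)) := fun a => length_encMat fun _ _ => length_encInt _
    have hlc : ∀ a : α, (encBits a.2.2.2).length = simCoinLen1 H k m R n t := fun a => by
      rw [length_encBits, a.2.1.2]
    have hlen₂ : ∀ a : α, (encBits a.1 ++ encMat (fun i j => encInt (a.2.1.1 i j))).length
        = H.pkLen n + m n * (m n * (b n + 1)) := fun a => by
      rw [List.length_append, length_encBits, hlY]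
    have hlen₃ : ∀ a : α, (encBits a.1 ++ encMat (fun i j => encInt (a.2.1.1 i j)) ++
        encShare a.2.2.1).length
        = H.pkLen n + m n * (m n * (b n + 1)) + k n * (m n * H.ptLen n) := fun a => by
      rw [List.length_append, hlen₂, length_encShare]
    have hcoins : bitsOf (fun a : α => encBits (coins a)) ⊆ S := by
      have e : (fun a : α => encBits (coins a)) = fun a => encBits a.2.2.2 :=
        funext fun a => encBits_cast (by rw [a.2.1.2]) _
      rw [e]
      exact bitsOf_subset_append_right hlen₃
    have hS : (fun _ => false) ∈ S := hcoins (false_mem_bitsOf fun _ => length_encBits _)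
    have hpk : bitsOf (fun a : α => encBits a.1) ⊆ S :=
      ((bitsOf_subset_append_left (fun _ => length_encBits _) hlY).trans
      (bitsOf_subset_append_left hlen₂ fun a => length_encShare a.2.2.1)).trans
      (bitsOf_subset_append_left hlen₃ hlc)
    have hY : ∀ i j, bitsOf (fun a : α => encInt (a.2.1.1 i j)) ⊆ S := fun i j =>
      (((bitsOf_subset_encMat (f := fun i j (a : α) => encInt (a.2.1.1 i j))
        (fun _ _ _ => length_encInt _) i j).trans
      (bitsOf_subset_append_right fun _ => length_encBits _)).trans
      (bitsOf_subset_append_left hlen₂ fun a => length_encShare a.2.2.1)).trans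
      (bitsOf_subset_append_left hlen₃ hlc)
    have hZ : ∀ i j, bitsOf (fun a : α => H.encPt (a.2.2.1 i j)) ⊆ S := fun i j =>
      ((bitsOf_subset_encMat (f := fun i j (a : α) => H.encPt (a.2.2.1 i j))
        (fun _ _ _ => length_encPt _) i j).trans
      (bitsOf_subset_append_right hlen₂)).trans
      (bitsOf_subset_append_left hlen₃ hlc)
    obtain ⟨c₁, c₂, c₃', c₄, c₅⟩ := bitsOf_simCoins1_subset coins hcoins
    have c₃ : ∀ i j, bitsOf (fun a : α => encBits (resize (R.queryCoinLen n)
        ((simCoins1 H k m R n t (coins a)).2.2.1 i j))) ⊆ S :=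
      fun i j => bitsOf_resize_subset hS _ (c₃' i j)
    have hflag : ∀ p : Fin (m n * m n), Computes S (b n * 6)
        {fun a : α => decide (p ∈ locations a.2.1.1)} := fun p => by
      have := Computes.ne_zero hS (fun a : α => a.2.1.1 (finProdFinEquiv.symm p).1
        (finProdFinEquiv.symm p).2) (hY _ _)
      simpa [locations] using this
    have stage₁ := (modulus n (fun a : α => a.1) hpk).union (Computes.iUnion hflag)
    set S₁ := S ∪ ((digits fun a : α => (H.modulus n a.1 : ℕ)) ∪
      ⋃ p : Fin (m n * m n), {fun a : α => decide (p ∈ locations a.2.1.1)})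
    have hS₁ : S ⊆ S₁ := Set.subset_union_left
    -- Unlike party 0's simulator, this one makes queries at the true locations, which depend on its
    -- input `Y`. Their one-hot indicators are found by rank, and `lookup` then yields the database
    -- index.
    have stage₂ := Computes.select (S := S₁) (hS₁ hS) (fun a : α => locations a.2.1.1)
      (fun a => a.2.1.2) fun p => .inr (.inr (Set.mem_iUnion.2 ⟨p, rfl⟩))
    set S₂ := S₁ ∪ {g | ∃ (s : Fin t) (p : Fin (m n * m n)), g = fun a : α =>
      decide ((locations a.2.1.1).orderEmbOfFin a.2.1.2 s = p)}
    have hS₂ : S ⊆ S₂ := hS₁.trans Set.subset_union_left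
    have hd₂ : (digits fun a : α => (H.modulus n a.1 : ℕ)) ⊆ S₂ :=
      (Set.subset_union_left.trans Set.subset_union_right).trans
        (Set.subset_union_left (s := S₁))
    have hQ : ∀ q : Fin t × Fin (k n), Computes S₂
        (Nat.size (m n * k n) * (m n * m n * 6) + cq n) (bitsOf fun a : α =>
        encBits (R.query n (dbIndex q.2 (row a q.1)) (resize (R.queryCoinLen n)
          ((simCoins1 H k m R n t (coins a)).2.2.1 q.1 q.2)))) := fun q => by
      have h := Computes.lookup (S := S₂) (hS₂ hS)
        (fun a : α => (locations a.2.1.1).orderEmbOfFin a.2.1.2 q.1)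
        (fun p => .inr ⟨q.1, p, rfl⟩) (fun p => PIRScheme.encIdx (N := fun n => m n * k n)
          (dbIndex q.2 (finProdFinEquiv.symm p).1 : Fin (m n * k n))) fun _ => length_encIdx _
      refine h.trans ?_
      refine query n (fun a : α => (dbIndex q.2 (row a q.1), resize (R.queryCoinLen n)
        ((simCoins1 H k m R n t (coins a)).2.2.1 q.1 q.2))) (bitsOf_append_subset_of _
          (fun _ => length_encIdx _) ?_ ((c₃ q.1 q.2).trans (hS₂.trans Set.subset_union_left)))
      simp only [row]
      exact Set.subset_union_right
    have hU : ∀ q : Fin (k n) × Fin (m n), Computes S₂ (H.ptLen n * 72)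
        (bitsOf fun a : α => H.encPt (-a.2.2.1 q.1 q.2)) := fun q =>
      H.computes_encPt_neg hd₂ ((hZ q.1 q.2).trans hS₂)
    have hC : ∀ q : Fin (k n) × Fin (m n), Computes S₂ (1 + ce n) (bitsOf fun a : α =>
        encBits (H.enc n a.1 0 ((simCoins1 H k m R n t (coins a)).1 q.1 q.2))) := fun q => by
      refine (Computes.const_bits (hS₂ hS) (encNat (H.ptLen n) 0)).trans ?_
      refine enc n (fun a : α => ⟨a.1, 0, (simCoins1 H k m R n t (coins a)).1 q.1 q.2⟩)
        (bitsOf_append_subset_of (H.pkLen n + H.ptLen n) (fun a => by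
          rw [List.length_append, length_encBits, length_encPt])
          (bitsOf_append_subset_of (H.pkLen n) (fun a => length_encBits _)
            ((hpk.trans hS₂).trans Set.subset_union_left) ?_)
          ((c₁ q.1 q.2).trans (hS₂.trans Set.subset_union_left)))
      simp only [HEScheme.encPt, ZMod.val_zero]
      exact Set.subset_union_right
    have stage₃ := (Computes.iUnion hQ).union ((Computes.iUnion hU).union (Computes.iUnion hC))
    set T₃ := (⋃ q : Fin t × Fin (k n), bitsOf fun a : α =>
        encBits (R.query n (dbIndex q.2 (row a q.1)) (resize (R.queryCoinLen n)
          ((simCoins1 H k m R n t (coins a)).2.2.1 q.1 q.2)))) ∪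
      ((⋃ q : Fin (k n) × Fin (m n), bitsOf fun a : α => H.encPt (-a.2.2.1 q.1 q.2)) ∪
      ⋃ q : Fin (k n) × Fin (m n), bitsOf fun a : α =>
        encBits (H.enc n a.1 0 ((simCoins1 H k m R n t (coins a)).1 q.1 q.2)))
    set S₃ := S₂ ∪ T₃
    have hS₃ : S ⊆ S₃ := hS₂.trans Set.subset_union_left
    have hT₃ : T₃ ⊆ S₃ := Set.subset_union_right
    have hresp : ∀ q : Fin t × Fin (k n), Computes S₃ (cr n) (bitsOf fun a : α =>
        encBits ((simView1 a.1 (row a) a.2.2.1 (coins a)).responses q.1 q.2)) := fun q => by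
      refine response n (fun a : α => (fun idx => encAll a.1 0 (simCoins1 H k m R n t (coins a)).1
        (finProdFinEquiv.symm idx).2 (finProdFinEquiv.symm idx).1,
        R.query n (dbIndex q.2 (row a q.1)) (resize (R.queryCoinLen n)
          ((simCoins1 H k m R n t (coins a)).2.2.1 q.1 q.2)),
        (simCoins1 H k m R n t (coins a)).2.1 q.1 q.2))
        (bitsOf_append_subset_of (m n * k n * H.ctLen n + R.queryLen n) (fun a => by
          rw [List.length_append, length_encVec fun _ => length_encBits _, length_encBits])
        (bitsOf_append_subset_of (m n * k n * H.ctLen n) (fun a =>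
            length_encVec fun _ => length_encBits _)
          (bitsOf_encVec_subset (hS₃ hS) (fun _ _ => length_encBits _) fun idx => ?_) ?_)
        ((c₂ q.1 q.2).trans hS₃))
      · refine Set.Subset.trans ?_ ((Set.subset_union_right.trans Set.subset_union_right).trans hT₃)
        exact Set.subset_iUnion_of_subset ((finProdFinEquiv.symm idx).2,
          (finProdFinEquiv.symm idx).1) le_rfl
      · refine Set.Subset.trans ?_ (Set.subset_union_left.trans hT₃)
        exact Set.subset_iUnion_of_subset q le_rfl
    have stage₄ := (Computes.iUnion hresp).union (Computes.of_subset (s := 0) (le_refl S₃))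
    have h := stage₁.trans (stage₂.trans (stage₃.trans stage₄))
    simp only [Fintype.card_prod, Fintype.card_fin, add_zero] at h
    refine h.mono_right (bitsOf_encode1_subset (.inr (hS₃ hS)) (fun i j => ?_) (fun i j => ?_)
      (fun i j => ?_) (fun i j => ?_) fun i j => ?_)
    · exact ((c₃ i j).trans hS₃).trans Set.subset_union_right
    · exact ((c₄ i j).trans hS₃).trans Set.subset_union_right
    · refine Set.Subset.trans ?_ (((Set.subset_union_left.trans Set.subset_union_right).trans
        hT₃).trans Set.subset_union_right)
      exact Set.subset_iUnion_of_subset (i, j) le_rfl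
    · exact ((c₅ i j).trans hS₃).trans Set.subset_union_right
    · refine Set.Subset.trans ?_ Set.subset_union_left
      exact Set.subset_iUnion_of_subset (i, j) le_rfl

theorem exists_secure_simulator1 (hH_eff : H.Efficient) (hH_correct : H.Correct)
    (hH_hom : H.Homomorphic) (hH_sec : H.SemanticallySecure) (hk : PolyBounded k)
    (hm : PolyBounded m) (hb : PolyBounded b) (hR_eff : R.Efficient) (hR_correct : R.Correct) :
    ∃ S : Simulator1 H k m b R, S.Efficient ∧
      ∀ (X : ∀ n, Matrix (Fin (k n)) (Fin (m n)) (BInt (b n)))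
        (Y : ∀ n, Matrix (Fin (m n)) (Fin (m n)) (BInt (b n))),
        Indistinguishable (fun n => real1 R n (X n) (Y n)) (fun n => S.ideal n (X n) (Y n)) := by
  refine ⟨simulator1 H k m b R, simulator1_efficient hH_eff hR_eff hk hm hb, fun X Y D hD => ?_⟩
  obtain ⟨cm, hcm, modulus⟩ := HEScheme.Efficient.exists_computes_modulus H hH_eff
  obtain ⟨ce, hce, enc⟩ := hH_eff.enc.exists_computes
    (l := fun n => H.pkLen n + H.ptLen n + H.encLen n)
    fun n a => by simp only [List.length_append, length_encBits, length_encPt]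
  obtain ⟨cr, hcr, response⟩ := hR_eff.response.exists_computes
    (l := fun n => m n * k n * H.ctLen n + R.queryLen n + R.respCoinLen n)
    fun n a => by
      rw [List.length_append, List.length_append, length_encVec fun _ => length_encBits _,
        length_encBits, length_encBits]
  have hnnz : PolyBounded fun n => nnz (Y n) := PolyBound.mono (PolyBound.mul hm hm) fun n => by
    simpa [nnz] using (locations (Y n)).card_le_univ
  have hint : PolyBounded (intLen H m b) := PolyBound.add (PolyBound.add (PolyBound.add hm
    (PolyBound.add hb hb)) (PolyBound.add hH_eff.polyBounded_ptLen PolyBound.self))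
    (PolyBound.const 1)
  have hconst : PolyBounded fun n => H.constCost (intLen H m b n) n :=
    PolyBound.add (PolyBound.mul hint (((PolyBound.add hH_eff.polyBounded_ptLen
      (PolyBound.const 1)).mul (PolyBound.const 36)).add (PolyBound.const 1)))
      (PolyBound.mul hH_eff.polyBounded_ptLen (PolyBound.const 72))
  have hkm : PolyBounded fun n => k n * m n := PolyBound.mul hk hm
  have hcost : PolyBounded fun n =>
      (D n).size + reductionCost H k m b cm ce cr n (nnz (Y n)) := by
    have hkmc : PolyBounded fun n => k n * m n * H.constCost (intLen H m b n) n :=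
      PolyBound.mul hkm hconst
    exact PolyBound.add hD ((((PolyBound.add (PolyBound.const 1) hcm).add
      ((PolyBound.mul hkm (PolyBound.add hconst hce)).add
      ((PolyBound.add hkmc hkmc).add hkmc))).add
      (PolyBound.mul (PolyBound.mul hnnz hk) hcr)).add (PolyBound.const 2))
  have : ∀ n, Nonempty {D' : Circuit //
    D'.size ≤ (D n).size + reductionCost H k m b cm ce cr n (nnz (Y n))} :=
    fun n => ⟨⟨D n, by omega⟩⟩
  have : ∀ n, Nonempty (BInt (b n)) := fun n => ⟨⟨0, by simp⟩⟩
  -- The acceptance probability in the attack experiment whose plaintext is the fixed integer `x`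
  -- reduced modulo `δ`.
  let E (n : ℕ) (D' : Circuit) (x : BInt (b n)) : ℝ := 𝔼 w, 𝔼 r,
    if D'.accepts (encBits (H.pk w) ++ encBits (H.enc n (H.pk w) (x.1 : H.Pt n (H.pk w)) r))
      then 1 else 0
  have hE : ∀ n D' x, E n D' x ∈ Set.Icc (0 : ℝ) 1 := fun n D' x =>
    expect_mem_Icc fun w => expect_mem_Icc fun r => ite_mem_Icc _
  -- The bound must be uniform over the reduction circuits and the pairs of plaintexts, which vary
  -- with the fixed coins and the database position.
  obtain ⟨ν, hν, h⟩ := exists_negligible_bound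
    (X := fun n => {D' : Circuit //
      D'.size ≤ (D n).size + reductionCost H k m b cm ce cr n (nnz (Y n))} ×
      BInt (b n) × BInt (b n))
    (f := fun n x => |E n x.1 x.2.1 - E n x.1 x.2.2|)
    (fun n x => abs_nonneg _) (fun n x => abs_sub_le_one (hE _ _ _) (hE _ _ _))
    (fun x => by
      have := hH_sec _ _
        (HEScheme.Efficient.polySize_intCast H hH_eff hb fun n => (x n).2.1)
        (HEScheme.Efficient.polySize_intCast H hH_eff hb fun n => (x n).2.2)
        (fun n => (x n).1.1) (PolyBound.mono hcost fun n => (x n).1.2)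
      simp only [advantage_eq, H.prob_cpaDist] at this
      exact this)
  refine Negligible.mono ((hν.polyBounded_mul hkm).add
    ((negligible_inv_two_pow.polyBounded_mul hkm).const_mul 2)) fun n => ?_
  rw [abs_of_nonneg (advantage_nonneg _ _ _)]
  refine (advantage_party1_le (X n) (Y n) hH_hom hH_correct hR_correct (D n) (ν := ν n)
    fun c U x r p x₀ x₁ => ?_).trans (le_trans (le_of_eq ?_) (le_abs_self _))
  · obtain ⟨D', hs, hD'⟩ := exists_enc_distinguisher (modulus n) (enc n) (response n) (D n) (X n)
      (Y n) (fun s => (loc (Y n) s).1) c U x r p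
    have key := h n (⟨D', hs⟩, x₀, x₁)
    simp only [E, hD'] at key
    exact key
  · push_cast
    ring

end MatrixMul

end

theorem lemma2 (H : HEScheme) (hH_eff : H.Efficient) (hH_correct : H.Correct)
    (hH_hom : H.Homomorphic) (hH_sec : H.SemanticallySecure)
    (k m b : ℕ → ℕ) (hk : PolyBounded k) (hm : PolyBounded m) (hb : PolyBounded b)
    (R : PIRScheme (fun n => m n * k n) H.ctLen) (hR_eff : R.Efficient) (hR_correct : R.Correct)
    (hR_sec : R.Secure) :
    MatrixMul.SemiHonestSecure H k m b R :=
  ⟨MatrixMul.exists_secure_simulator0 hH_eff hH_correct hH_hom hk hm hb hR_eff hR_correct hR_sec,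
    MatrixMul.exists_secure_simulator1 hH_eff hH_correct hH_hom hH_sec hk hm hb hR_eff hR_correct⟩
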